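/- **Setting.** Functions $f(n,t)$ depend on $n\in\mathbb Z$ and $t=(t_1,t_2,t_3,\dots)$, $t_i\in\mathbb R$, are real- or complex-valued, and are smooth in $t$ (that is, $C^\infty$ in any finite set of the variables $t_i$ when the others are frozen). Put $(\varGamma f)(n)=f(n+1)$, $\Delta=\varGamma-I$, $\Delta^*=\varGamma^{-1}-I$. Pseudo-difference operators are formal sums $\sum_{i\ll\infty}u_i(n,t)\Delta^i$, multiplied by the Leibniz rule $\Delta^k\circ g=\sum_{i\ge0}\binom ki(\Delta^ig)(n+k-i)\Delta^{k-i}$ $(k\in\mathbb Z)$; $A_{\ge1}$ and $A_{\le0}$ are the parts of $A$ with powers $\Delta^i$, $i\ge1$, resp. $i\le0$; $A(n-1)$ is $A$ with the coefficients shifted by $n\mapsto n-1$; and $\big(\sum_iu_i\Delta^i\big)^*=\sum_i(\Delta^*)^i\circ u_i$, expanded in powers of $\Delta^*$. A solution of the discrete modified KP (dmKP) hierarchy is an operator $L=u_{-1}\Delta+u_0+u_1\Delta^{-1}+u_2\Delta^{-2}+\cdots$ with smooth coefficients and $u_{-1}$ nowhere zero (for instance $u_{-1}=1$) such that $$\frac{\partial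 L}{\partial t_i}=[(L^i)_{\ge1},L],\qquad i=1,2,3,\dots$$ A dressing operator of $L$ is an operator $Z=z_0+z_1\Delta^{-1}+z_2\Delta^{-2}+\cdots$ with smooth coefficients and $z_0$ nowhere zero such that $L=Z\Delta Z^{-1}$ and $\partial Z/\partial t_i=-(L^i)_{\le0}Z$ for all $i\ge1$. With $\xi(t,\lambda)=\sum_{i\ge1}t_i\lambda^i$, its wave function and adjoint wave function are the formal expressions $$w(n,t,\lambda)=Z(n)\,(1+\lambda)^ne^{\xi(t,\lambda)},\qquad w^*(n,t,\lambda)=\big(Z^{-1}(n-1)\Delta^{-1}\big)^*(1+\lambda)^{-n}e^{-\xi(t,\lambda)},$$ where $\Delta^k$ acts on $(1+\lambda)^ne^{\xi}$, and $(\Delta^*)^k$ on $(1+\lambda)^{-n}e^{-\xi}$, as multiplication by $\lambda^k$, $k\in\mathbb Z$. Finally $[\lambda]=(\lambda,\lambda^2/2,\lambda^3/3,\dots)$, and $f(n,t\pm[\lambda^{-1}])$ is the formal Taylor series $\exp\big(\pm\sum_{l\ge1}\tfrac{\lambda^{-l}}{l}\tfrac{\partial}{\partial t_l}\big)f(n,t)$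 in powers of $\lambda^{-1}$. **Theorem 2.1.** Every solution $L$ of the dmKP hierarchy has a dressing operator, and for every dressing operator $Z$ of $L$ there are two smooth, nowhere vanishing functions $\tau_0(n,t)$, $\tau_1(n,t)$ (tau functions) such that the wave function and the adjoint wave function are $$w(n,t,\lambda)=\frac{\tau_0(n,t-[\lambda^{-1}])}{\tau_1(n,t)}(1+\lambda)^ne^{\xi(t,\lambda)},\qquad w^*(n,t,\lambda)=\frac{\tau_1(n,t+[\lambda^{-1}])}{\tau_0(n,t)}\lambda^{-1}(1+\lambda)^{-n}e^{-\xi(t,\lambda)}.$$ -/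

import Mathlib

open scoped ContDiff

namespace DMKP

noncomputable section

/-! ### Functions of `n ∈ ℤ` and `t = (t₁, t₂, …)`, shifts, differences, partial derivatives -/

/-- Scalar functions `f(n, t)` with `n ∈ ℤ` and `t = (t₁, t₂, t₃, …)`, `tᵢ ∈ ℝ`.
The values are real or complex (`𝕜` is `ℝ` or `ℂ`). -/
abbrev Fn (𝕜 : Type*) := ℤ → (ℕ+ → ℝ) → 𝕜

variable {𝕜 : Type*} [RCLike 𝕜]

/-- `Γ^j`: `(Γ^j f)(n) = f(n + j)`. -/
def shift (j : ℤ) (f : Fn 𝕜) : Fn 𝕜 := fun n => f (n + j)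

/-- The difference operator on functions, `(Δ f)(n) = f(n + 1) - f(n)`. -/
def diff (f : Fn 𝕜) : Fn 𝕜 := shift 1 f - f

/-- The adjoint difference operator on functions, `Δ* = Γ⁻¹ - I = -Δ Γ⁻¹`. -/
def adjDiff (f : Fn 𝕜) : Fn 𝕜 := shift (-1) f - f

/-- The partial derivative `∂f/∂tᵢ`. -/
def pderiv (i : ℕ+) (f : Fn 𝕜) : Fn 𝕜 :=
  fun n t => deriv (fun s : ℝ => f n (Function.update t i s)) (t i)

/-- `f(n, t)` is infinitely differentiable in `t`: whenever all but finitely many of the `tᵢ` are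
frozen, `f` is a `C^∞` function of the remaining ones. -/
def Smooth (f : Fn 𝕜) : Prop :=
  ∀ (n : ℤ) (t : ℕ+ → ℝ) (S : Finset ℕ+),
    ContDiff ℝ ∞ (fun s : S → ℝ => f n (fun i => if h : i ∈ S then s ⟨i, h⟩ else t i))

/-- `f` has no zeros. -/
def NowhereZero (f : Fn 𝕜) : Prop := ∀ n t, f n t ≠ 0

/-! ### Pseudo-difference operators -/

/-- A pseudo-difference operator `∑_{k ≪ ∞} u_k Δ^k`; `coeff k = u_k`. -/
@[ext] structure PDO (𝕜 : Type*) [RCLike 𝕜] where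
  /-- the coefficient of `Δ^k` -/
  coeff : ℤ → Fn 𝕜
  bdd : ∃ N : ℤ, ∀ k, N < k → coeff k = 0

namespace PDO

/-- The monomial `u Δ^k`. -/
def mono (k : ℤ) (u : Fn 𝕜) : PDO 𝕜 where
  coeff j := if j = k then u else 0
  bdd := ⟨k, fun _ hj => if_neg hj.ne'⟩

/-- `Δ^k`, for any integer `k`. -/
def Δpow (k : ℤ) : PDO 𝕜 := mono k 1

instance : One (PDO 𝕜) := ⟨Δpow 0⟩

instance : Neg (PDO 𝕜) where
  neg A := ⟨fun k => -A.coeff k, by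
    obtain ⟨N, hN⟩ := A.bdd
    exact ⟨N, fun k hk => by simp [hN k hk]⟩⟩

instance : Sub (PDO 𝕜) where
  sub A B := ⟨fun k => A.coeff k - B.coeff k, by
    obtain ⟨N, hN⟩ := A.bdd
    obtain ⟨M, hM⟩ := B.bdd
    exact ⟨max N M, fun k hk => by
      rw [hN k (lt_of_le_of_lt (le_max_left _ _) hk), hM k (lt_of_le_of_lt (le_max_right _ _) hk),
        sub_zero]⟩⟩

/-- By the Leibniz rule `Δ^k ∘ g = ∑_{i ≥ 0} (k choose i) (Δ^i g)(n + k - i) Δ^{k-i}`, this is the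
contribution of `A_k Δ^k` and of the `i`-th summand of the rule to the coefficient of `Δ^m` in
`A ∘ B`, where `p = (k, i)`; it involves the coefficient of `B` at `Δ^l` with
`k - i + l = m`. -/
def mulTerm (A B : PDO 𝕜) (m : ℤ) (p : ℤ × ℕ) : Fn 𝕜 :=
  Ring.choose p.1 p.2 •
    (A.coeff p.1 * shift (p.1 - p.2) (diff^[p.2] (B.coeff (m - p.1 + p.2))))

theorem diff_iterate_zero (i : ℕ) : diff^[i] (0 : Fn 𝕜) = 0 := by
  induction i with
  | zero => rfl
  | succ i ih =>
    rw [Function.iterate_succ_apply', ih]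
    funext n t
    simp [diff, shift]

theorem mulTerm_eq_zero {A B : PDO 𝕜} {m : ℤ} {p : ℤ × ℕ}
    (h : A.coeff p.1 = 0 ∨ B.coeff (m - p.1 + p.2) = 0) : mulTerm A B m p = 0 := by
  rcases h with h | h
  · simp [mulTerm, h]
  · have h0 : shift (p.1 - p.2) (0 : Fn 𝕜) = 0 := rfl
    rw [mulTerm, h, diff_iterate_zero, h0, mul_zero, smul_zero]

/-- Only finitely many terms contribute to a given coefficient of a product. -/
theorem mulTerm_support_finite (A B : PDO 𝕜) (m : ℤ) :
    (Function.support (mulTerm A B m)).Finite := by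
  obtain ⟨N, hN⟩ := A.bdd
  obtain ⟨M, hM⟩ := B.bdd
  refine ((Set.finite_Icc (m - M) N).prod (Set.finite_Iic (M - m + N).toNat)).subset ?_
  rintro ⟨k, i⟩ hp
  have h1 : k ≤ N := by
    by_contra hk
    exact hp (mulTerm_eq_zero (Or.inl (hN k (by omega))))
  have h2 : m - k + i ≤ M := by
    by_contra hk
    exact hp (mulTerm_eq_zero (Or.inr (hM _ (by simpa using hk))))
  simp only [Set.mem_prod, Set.mem_Icc, Set.mem_Iic]
  omega

/-- Composition of pseudo-difference operators (a finite sum for each coefficient). -/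
instance : Mul (PDO 𝕜) where
  mul A B := ⟨fun m => ∑ᶠ p : ℤ × ℕ, mulTerm A B m p, by
    obtain ⟨N, hN⟩ := A.bdd
    obtain ⟨M, hM⟩ := B.bdd
    refine ⟨N + M, fun m hm => ?_⟩
    rw [← finsum_zero (α := ℤ × ℕ)]
    refine finsum_congr fun p => mulTerm_eq_zero ?_
    by_cases hp : N < p.1
    · exact Or.inl (hN _ hp)
    · exact Or.inr (hM _ (by omega))⟩

/-- Powers `A^i`, `i ≥ 0`. -/
def npow (A : PDO 𝕜) : ℕ → PDO 𝕜
  | 0 => 1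
  | i + 1 => npow A i * A

/-- `A_{≥ 1}`. -/
def geOne (A : PDO 𝕜) : PDO 𝕜 where
  coeff k := if 1 ≤ k then A.coeff k else 0
  bdd := by
    obtain ⟨N, hN⟩ := A.bdd
    exact ⟨N, fun k hk => by simp [hN k hk]⟩

/-- `A_{≤ 0}`. -/
def leZero (A : PDO 𝕜) : PDO 𝕜 where
  coeff k := if k ≤ 0 then A.coeff k else 0
  bdd := by
    obtain ⟨N, hN⟩ := A.bdd
    exact ⟨N, fun k hk => by simp [hN k hk]⟩

/-- The commutator `[A, B] = AB - BA`. -/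
def comm (A B : PDO 𝕜) : PDO 𝕜 := A * B - B * A

/-- `A(n + j)`: every coefficient is shifted, `u_k(n) ↦ u_k(n + j)`. -/
def shiftCoeff (j : ℤ) (A : PDO 𝕜) : PDO 𝕜 where
  coeff k := shift j (A.coeff k)
  bdd := by
    obtain ⟨N, hN⟩ := A.bdd
    exact ⟨N, fun k hk => by rw [hN k hk]; rfl⟩

/-- `∂A/∂tᵢ`, coefficient by coefficient. -/
def pderiv (i : ℕ+) (A : PDO 𝕜) : PDO 𝕜 where
  coeff k := DMKP.pderiv i (A.coeff k)
  bdd := by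
    obtain ⟨N, hN⟩ := A.bdd
    exact ⟨N, fun k hk => by rw [hN k hk]; funext n t; simp [DMKP.pderiv]⟩

end PDO

/-- An operator `∑_{k ≪ ∞} v_k (Δ*)^k` in powers of the adjoint difference operator `Δ*`;
`coeff k = v_k`. -/
@[ext] structure AdjPDO (𝕜 : Type*) [RCLike 𝕜] where
  /-- the coefficient of `(Δ*)^k` -/
  coeff : ℤ → Fn 𝕜
  bdd : ∃ N : ℤ, ∀ k, N < k → coeff k = 0

theorem adjDiff_iterate_zero (i : ℕ) : adjDiff^[i] (0 : Fn 𝕜) = 0 := by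
  induction i with
  | zero => rfl
  | succ i ih =>
    rw [Function.iterate_succ_apply', ih]
    funext n t
    simp [adjDiff, shift]

/-- The formal adjoint `(∑_k u_k Δ^k)* = ∑_k (Δ*)^k ∘ u_k`, written with the coefficients on the
left by the Leibniz rule for `Δ*` (the mirror image under `n ↦ -n` of that for `Δ`):
`(Δ*)^k ∘ g = ∑_{i ≥ 0} (k choose i) ((Δ*)^i g)(n - k + i) (Δ*)^{k-i}`.
The summand with index `i` below is the one coming from `k = m + i`; only finitely many of them are
nonzero. -/
def PDO.adjoint (A : PDO 𝕜) : AdjPDO 𝕜 where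
  coeff m := ∑ᶠ i : ℕ, Ring.choose (m + i) i • shift (-m) (adjDiff^[i] (A.coeff (m + i)))
  bdd := by
    obtain ⟨N, hN⟩ := A.bdd
    refine ⟨N, fun m hm => ?_⟩
    rw [← finsum_zero (α := ℕ)]
    refine finsum_congr fun i => ?_
    rw [hN _ (by omega), adjDiff_iterate_zero]
    have h0 : shift (-m) (0 : Fn 𝕜) = 0 := rfl
    rw [h0, smul_zero]

/-! ### Formal wave functions

Formal Laurent series `∑_{k ≪ ∞} a_k(n, t) λ^k` are elements of `LaurentSeries (Fn 𝕜)`, the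
variable of the Laurent series being `λ⁻¹`. -/

/-- The Laurent series `∑_{k ≪ ∞} c_k λ^k`. -/
def lamSeries (c : ℤ → Fn 𝕜) (h : ∃ N : ℤ, ∀ k, N < k → c k = 0) : LaurentSeries (Fn 𝕜) :=
  HahnSeries.ofSuppBddBelow (fun k => c (-k)) (by
    obtain ⟨N, hN⟩ := h
    refine ⟨-N, fun k hk => ?_⟩
    by_contra hlt
    exact hk (hN (-k) (by omega)))

/-- The series `λ^k`. -/
def lamPow (k : ℤ) : LaurentSeries (Fn 𝕜) := HahnSeries.single (-k) 1

/-- Formal wave functions `a(n, t, λ) (1 + λ)^n e^{ξ(t, λ)}`, `ξ(t, λ) = ∑_{i ≥ 1} tᵢ λ^i`, with an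
amplitude `a = ∑_{k ≪ ∞} a_k(n, t) λ^k`: the free module of rank one over the Laurent series
generated by the plane wave `(1 + λ)^n e^{ξ(t, λ)}`. -/
@[ext] structure Wave (𝕜 : Type*) [RCLike 𝕜] where
  /-- the amplitude `a` -/
  amp : LaurentSeries (Fn 𝕜)

/-- Formal adjoint wave functions `a(n, t, λ) (1 + λ)^{-n} e^{-ξ(t, λ)}`. -/
@[ext] structure AdjWave (𝕜 : Type*) [RCLike 𝕜] where
  /-- the amplitude `a` -/
  amp : LaurentSeries (Fn 𝕜)

instance : SMul (LaurentSeries (Fn 𝕜)) (Wave 𝕜) := ⟨fun a w => ⟨a * w.amp⟩⟩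

instance : SMul (LaurentSeries (Fn 𝕜)) (AdjWave 𝕜) := ⟨fun a w => ⟨a * w.amp⟩⟩

/-- The plane wave `(1 + λ)^n e^{ξ(t, λ)}`. -/
def planeWave : Wave 𝕜 := ⟨1⟩

/-- The adjoint plane wave `(1 + λ)^{-n} e^{-ξ(t, λ)}`. -/
def adjPlaneWave : AdjWave 𝕜 := ⟨1⟩

/-- For a number `λ ≠ -1` and with only the times `tᵢ`, `i ∈ S`, switched on, the plane wave is an
honest function. -/
def planeWaveFn (S : Finset ℕ+) (lam : 𝕜) : Fn 𝕜 :=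
  fun n t => (1 + lam) ^ n * NormedSpace.exp (∑ i ∈ S, (t i : 𝕜) * lam ^ (i : ℕ))

/-- The adjoint plane wave as a function. -/
def adjPlaneWaveFn (S : Finset ℕ+) (lam : 𝕜) : Fn 𝕜 :=
  fun n t => (1 + lam) ^ (-n) * NormedSpace.exp (-∑ i ∈ S, (t i : 𝕜) * lam ^ (i : ℕ))

/-- `Δ` multiplies the plane wave by `λ`. -/
theorem diff_planeWaveFn (S : Finset ℕ+) {lam : 𝕜} (h : 1 + lam ≠ 0) :
    diff (planeWaveFn S lam) = fun n t => lam * planeWaveFn S lam n t := by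
  funext n t
  simp only [diff, shift, planeWaveFn, Pi.sub_apply, zpow_add₀ h, zpow_one]
  ring

/-- `Δ*` multiplies the adjoint plane wave by `λ`. -/
theorem adjDiff_adjPlaneWaveFn (S : Finset ℕ+) {lam : 𝕜} (h : 1 + lam ≠ 0) :
    adjDiff (adjPlaneWaveFn S lam) = fun n t => lam * adjPlaneWaveFn S lam n t := by
  funext n t
  simp only [adjDiff, shift, adjPlaneWaveFn, Pi.sub_apply, neg_add, neg_neg, zpow_add₀ h, zpow_one]
  ring

/-- The action of `∑_k u_k Δ^k` on the plane wave: as `Δ` multiplies the plane wave by `λ`, the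
result is `(∑_k u_k λ^k) (1 + λ)^n e^{ξ(t, λ)}`. -/
def PDO.applyPlaneWave (A : PDO 𝕜) : Wave 𝕜 := lamSeries A.coeff A.bdd • planeWave

/-- The action of `∑_k v_k (Δ*)^k` on the adjoint plane wave: as `Δ*` multiplies it by `λ`, the
result is `(∑_k v_k λ^k) (1 + λ)^{-n} e^{-ξ(t, λ)}`. -/
def AdjPDO.applyPlaneWave (A : AdjPDO 𝕜) : AdjWave 𝕜 := lamSeries A.coeff A.bdd • adjPlaneWave

/-! ### The shifts `t ± [λ⁻¹]` -/

/-- The operator `∑_{l ≥ 1} (λ^{-l} / l) ∂/∂t_l` on formal power series in `λ⁻¹` with coefficients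
functions of `(n, t)`. -/
def miwaGen (F : PowerSeries (Fn 𝕜)) : PowerSeries (Fn 𝕜) :=
  PowerSeries.mk fun k => ∑ j : Fin k,
    fun n t => ((j : 𝕜) + 1)⁻¹ * pderiv j.1.succPNat (PowerSeries.coeff (k - (j + 1)) F) n t

/-- `f(n, t + c [λ⁻¹])` for `c = ±1`, where `[λ⁻¹] = (λ⁻¹, λ⁻²/2, λ⁻³/3, …)`, as its formal Taylor
series `exp(c ∑_{l ≥ 1} (λ^{-l} / l) ∂/∂t_l) f` in powers of `λ⁻¹`. The coefficient of `λ^{-k}` of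
the `m`-th term of the exponential series vanishes for `m > k`. -/
def miwaShift (c : ℤ) (f : Fn 𝕜) : LaurentSeries (Fn 𝕜) :=
  HahnSeries.ofPowerSeries ℤ (Fn 𝕜) (PowerSeries.mk fun k => ∑ m ∈ Finset.range (k + 1),
    fun n t => ((m.factorial : 𝕜)⁻¹ * (c : 𝕜) ^ m) *
      PowerSeries.coeff k (miwaGen^[m] (PowerSeries.C f)) n t)

/-! ### The discrete modified KP hierarchy -/

/-- `L = u₋₁ Δ + u₀ + u₁ Δ⁻¹ + u₂ Δ⁻² + ⋯`, with smooth coefficients and `u₋₁` without zeros, is a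
solution of the hierarchy `∂L/∂tᵢ = [(L^i)_{≥ 1}, L]`, `i = 1, 2, 3, …`. -/
structure IsSolution (L : PDO 𝕜) : Prop where
  order_le : ∀ k, 1 < k → L.coeff k = 0
  leading : NowhereZero (L.coeff 1)
  smooth : ∀ k, Smooth (L.coeff k)
  lax : ∀ i : ℕ+, L.pderiv i = PDO.comm (L.npow i).geOne L

/-- `Z = z₀ + z₁ Δ⁻¹ + z₂ Δ⁻² + ⋯`, with smooth coefficients and `z₀` without zeros, is a dressing
operator of `L`, with inverse `Y = Z⁻¹`: `L = Z Δ Z⁻¹` and `∂Z/∂tᵢ = -(L^i)_{≤ 0} Z`. -/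
structure IsDressing (L Z Y : PDO 𝕜) : Prop where
  order_le : ∀ k, 0 < k → Z.coeff k = 0
  leading : NowhereZero (Z.coeff 0)
  smooth : ∀ k, Smooth (Z.coeff k)
  mul_inv : Z * Y = 1
  inv_mul : Y * Z = 1
  dress : L = Z * PDO.Δpow 1 * Y
  sato : ∀ i : ℕ+, Z.pderiv i = -((L.npow i).leZero * Z)

/-- The wave function `w = Z(n) (1 + λ)^n e^{ξ(t, λ)}`. -/
def waveFunction (Z : PDO 𝕜) : Wave 𝕜 := Z.applyPlaneWave

/-- The adjoint wave function `w* = (Z⁻¹(n - 1) Δ⁻¹)* (1 + λ)^{-n} e^{-ξ(t, λ)}`, in terms of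
`Y = Z⁻¹`. -/
def adjWaveFunction (Y : PDO 𝕜) : AdjWave 𝕜 :=
  (Y.shiftCoeff (-1) * PDO.Δpow (-1)).adjoint.applyPlaneWave

end

end DMKP

set_option linter.unusedSectionVars false

namespace DMKP

noncomputable section

variable {𝕜 : Type*} [RCLike 𝕜]

/-! Existence of a dressing operator. The equations `L Z = Z Δ` and `∂Z/∂tᵢ = -(L^i)_{≤0} Z` are
linear in `Z`, and the maps measuring their failure, `dressDefect` and `satoDefect`, commute; this
is the Lax equation together with its zero-curvature consequence `IsSolution.pderiv_leZero_sub`. On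
top coefficients they act as `z ↦ u z(n+1) - z` and `z ↦ ∂z/∂tᵢ + aᵢ z`, where `u` is the leading
coefficient of `L` and `aᵢ` the `Δ⁰`-coefficient of `L^i`. So `Z` is built one coefficient at a
time: each correction solves an inhomogeneous scalar system whose compatibility conditions are the
top coefficients of the commutation relations. Division by a nowhere vanishing homogeneous solution
`z₀` reduces the system to `Δy = ρ₀`, `∂y/∂tᵢ = ρᵢ` with closed data, which the Poincaré lemma in
`t` and summation in `n` solve.

The first tau function. Let `X = λ⁻¹` and let `z(t, X)` be the amplitude of `w`. The dressing
equations say `∂Z/∂t_l + Z Δ^l = (L^l)_{≥1} Z`, and `e^{ξ(t-[X],λ)} = (1 - λX) e^{ξ(t,λ)}`. Hence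
the coefficients of the positive powers of `X` in `Z(t-[X]) (1 - ΔX)` have the form `Q Z` with only
positive powers of `Δ` in `Q`; by order, `Q` is a function times `Δ`. In coefficients
(`exists_shift_relation`) this reads `(V - X) z(t-[X], V) = V z(t, V) - X h(X) U(V)`. Putting `V =
X` gives `z = h U`; eliminating `U` makes the right side antisymmetric in `X, V`, so that, with
`g(X) = z₀(t-[X])`, `z(t-[X], V) g(V) z(t, X) = z(t-[V], X) g(X) z(t, V)` (`shift_relation_symm`).
The derivation `N = ∂_X + ∑ X^l ∂/∂t_{l+1}` annihilates functions of `t-[X]`. Logarithmic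
differentiation of the symmetric relation along `N`, in `X` and then in `V`, shows that the
coefficients of `Ψ = N z / z` form a closed family (`closed_of_shift_relation`). If `-Ψ` has
potential `log τ₁`, then `N(τ₁ z) = 0`, and a series killed by `N` is the shift of its constant
term. So `τ₁ z = (τ₁ z₀)(t-[X])`, and `τ₀ = τ₁ z₀`.

The adjoint wave function. With `t+[X]` and `(1 - ΔX)⁻¹` the same argument shows that `Z(t+[X]) (1 -
ΔX)⁻¹ Z⁻¹` has `Δ⁰`-coefficient 1. This says that the amplitude of `w*` without its factor `λ⁻¹` is
inverse to `z(t+[X], X)`, which equals `τ₀(t) / τ₁(t+[X])` by the formula for `w`.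

All of this takes place in a ring of operators, whose associativity is obtained by rewriting
operators as Laurent series in `Γ`. -/

/-! ### Smooth functions -/

/-- The point which agrees with `s` on `S` and with `t` elsewhere. -/
def merge (S : Finset ℕ+) (t : ℕ+ → ℝ) (s : S → ℝ) : ℕ+ → ℝ :=
  fun i => if h : i ∈ S then s ⟨i, h⟩ else t i

theorem merge_of_mem {S : Finset ℕ+} (t : ℕ+ → ℝ) (s : S → ℝ) {i : ℕ+} (h : i ∈ S) :
    merge S t s i = s ⟨i, h⟩ := dif_pos h

theorem merge_of_notMem {S : Finset ℕ+} (t : ℕ+ → ℝ) (s : S → ℝ) {i : ℕ+} (h : i ∉ S) :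
    merge S t s i = t i := dif_neg h

theorem contDiff_merge (S : Finset ℕ+) (t : ℕ+ → ℝ) (i : ℕ+) :
    ContDiff ℝ ∞ (fun s : S → ℝ => merge S t s i) := by
  by_cases h : i ∈ S
  · simp only [merge_of_mem _ _ h]; exact contDiff_apply ℝ ℝ _
  · simp only [merge_of_notMem _ _ h]; exact contDiff_const

/-- The chain rule for functions that are smooth only on finite-dimensional slices: the inner map
may move only the coordinates in a fixed finite set. -/
theorem Smooth.contDiff_comp {f : Fn 𝕜} (hf : Smooth f) (n : ℤ) {E : Type*}
    [NormedAddCommGroup E] [NormedSpace ℝ E] {g : E → ℕ+ → ℝ} (S : Finset ℕ+) (t : ℕ+ → ℝ)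
    (hg : ∀ i, ContDiff ℝ ∞ (fun e => g e i)) (hS : ∀ e, ∀ i ∉ S, g e i = t i) :
    ContDiff ℝ ∞ (fun e => f n (g e)) := by
  have h : (fun e => f n (g e)) = (fun s : S → ℝ => f n (merge S t s)) ∘
      (fun e => fun i : S => g e i) := by
    funext e
    simp only [Function.comp]
    congr 1
    funext i
    by_cases h : i ∈ S
    · rw [merge_of_mem _ _ h]
    · rw [merge_of_notMem _ _ h, hS e i h]
  rw [h]
  exact (hf n t S).comp (contDiff_pi.2 fun i => hg i)

theorem contDiff_update {E : Type*} [NormedAddCommGroup E] [NormedSpace ℝ E] {g : E → ℕ+ → ℝ}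
    {x : E → ℝ} (hg : ∀ i, ContDiff ℝ ∞ (fun e => g e i)) (hx : ContDiff ℝ ∞ x) (j i : ℕ+) :
    ContDiff ℝ ∞ (fun e => Function.update (g e) j (x e) i) := by
  by_cases h : i = j
  · subst h; simpa using hx
  · simpa [Function.update_of_ne h] using hg i

theorem Smooth.contDiff_update {f : Fn 𝕜} (hf : Smooth f) (n : ℤ) (t : ℕ+ → ℝ) (i : ℕ+) :
    ContDiff ℝ ∞ (fun s : ℝ => f n (Function.update t i s)) :=
  hf.contDiff_comp n {i} t
    (DMKP.contDiff_update (g := fun _ => t) (fun _ => contDiff_const) contDiff_id i)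
    fun e j hj => Function.update_of_ne (by simpa using hj) _ _

theorem Smooth.hasDerivAt {f : Fn 𝕜} (hf : Smooth f) (n : ℤ) (t : ℕ+ → ℝ) (i : ℕ+) (x : ℝ) :
    HasDerivAt (fun s : ℝ => f n (Function.update t i s))
      (pderiv i f n (Function.update t i x)) x := by
  have h := ((hf.contDiff_update n t i).differentiable (by simp) x).hasDerivAt
  simpa [pderiv] using h

theorem Smooth.hasDerivAt_self {f : Fn 𝕜} (hf : Smooth f) (n : ℤ) (t : ℕ+ → ℝ) (i : ℕ+) :
    HasDerivAt (fun s : ℝ => f n (Function.update t i s)) (pderiv i f n t) (t i) := by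
  simpa using hf.hasDerivAt n t i (t i)

theorem pderiv_eq_of_hasDerivAt {f : Fn 𝕜} {n : ℤ} {t : ℕ+ → ℝ} {i : ℕ+} {d : 𝕜}
    (h : HasDerivAt (fun s : ℝ => f n (Function.update t i s)) d (t i)) : pderiv i f n t = d :=
  h.deriv

theorem Smooth.zero : Smooth (0 : Fn 𝕜) := fun _ _ _ => contDiff_const

theorem Smooth.one : Smooth (1 : Fn 𝕜) := fun _ _ _ => contDiff_const

theorem Smooth.const (a : ℤ → 𝕜) : Smooth (fun n _ => a n) := fun _ _ _ => contDiff_const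

theorem Smooth.add {f g : Fn 𝕜} (hf : Smooth f) (hg : Smooth g) : Smooth (f + g) :=
  fun n t S => (hf n t S).add (hg n t S)

theorem Smooth.sub {f g : Fn 𝕜} (hf : Smooth f) (hg : Smooth g) : Smooth (f - g) :=
  fun n t S => (hf n t S).sub (hg n t S)

theorem Smooth.neg {f : Fn 𝕜} (hf : Smooth f) : Smooth (-f) :=
  fun n t S => (hf n t S).neg

theorem Smooth.mul {f g : Fn 𝕜} (hf : Smooth f) (hg : Smooth g) : Smooth (f * g) :=
  fun n t S => (hf n t S).mul (hg n t S)

theorem Smooth.smul {f : Fn 𝕜} (hf : Smooth f) (a : 𝕜) : Smooth (a • f) :=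
  fun n t S => contDiff_const.mul (hf n t S)

theorem Smooth.zsmul {f : Fn 𝕜} (hf : Smooth f) (a : ℤ) : Smooth (a • f) := by
  have : a • f = (a : 𝕜) • f := by funext n t; simp
  rw [this]; exact hf.smul _

theorem Smooth.shift {f : Fn 𝕜} (hf : Smooth f) (j : ℤ) : Smooth (shift j f) :=
  fun n t S => hf (n + j) t S

theorem Smooth.diff {f : Fn 𝕜} (hf : Smooth f) : Smooth (diff f) := (hf.shift 1).sub hf

theorem Smooth.iterate_diff {f : Fn 𝕜} (hf : Smooth f) (k : ℕ) : Smooth (DMKP.diff^[k] f) := by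
  induction k with
  | zero => exact hf
  | succ k ih => rw [Function.iterate_succ_apply']; exact ih.diff

theorem Smooth.sum {ι : Type*} (s : Finset ι) {f : ι → Fn 𝕜} (hf : ∀ i ∈ s, Smooth (f i)) :
    Smooth (∑ i ∈ s, f i) := by
  classical
  induction s using Finset.induction_on with
  | empty => simpa using Smooth.zero
  | insert a s ha ih =>
    rw [Finset.sum_insert ha]
    exact (hf a (by simp)).add (ih fun i hi => hf i (by simp [hi]))

theorem Smooth.inv {f : Fn 𝕜} (hf : Smooth f) (h0 : NowhereZero f) : Smooth f⁻¹ :=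
  fun n t S => (hf n t S).inv fun _ => h0 _ _

theorem Smooth.exp {f : Fn 𝕜} (hf : Smooth f) : Smooth (fun n t => NormedSpace.exp (f n t)) :=
  fun n t S =>
    (AnalyticOnNhd.contDiff fun x _ => NormedSpace.exp_analytic (𝕂 := ℝ) x).comp (hf n t S)

theorem Smooth.pderiv {f : Fn 𝕜} (hf : Smooth f) (i : ℕ+) : Smooth (pderiv i f) := by
  intro n t S
  change ContDiff ℝ ∞ fun s => DMKP.pderiv i f n (merge S t s)
  -- The differentiation variable is kept separate from the slice variables, so that the cases `i ∈
  -- S` and `i ∉ S` are treated alike; the derivative in direction `(0, 1)` is then evaluated where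
  -- the last variable equals the `i`-th coordinate.
  set H : (S → ℝ) × ℝ → 𝕜 := fun p => f n (Function.update (merge S t p.1) i p.2) with hH
  have hHs : ContDiff ℝ ∞ H := by
    refine hf.contDiff_comp n (insert i S) t
      (DMKP.contDiff_update (fun j => (contDiff_merge S t j).comp contDiff_fst) contDiff_snd i) ?_
    intro e j hj
    rw [Finset.mem_insert, not_or] at hj
    rw [Function.update_of_ne hj.1, merge_of_notMem _ _ hj.2]
  have h : (fun s => DMKP.pderiv i f n (merge S t s)) =
      fun s => fderiv ℝ H (s, merge S t s i) (0, 1) := by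
    funext s
    have h1 : HasDerivAt (fun x : ℝ => (s, x)) ((0 : S → ℝ), (1 : ℝ)) (merge S t s i) :=
      (hasDerivAt_const _ _).prodMk (hasDerivAt_id _)
    exact ((hHs.differentiable (by simp) _).hasFDerivAt.comp_hasDerivAt _ h1).deriv
  rw [h]
  exact ((hHs.fderiv_right (m := ∞) (by simp)).comp
    (contDiff_id.prodMk (contDiff_merge S t i))).clm_apply contDiff_const

theorem pderiv_zero (i : ℕ+) : pderiv i (0 : Fn 𝕜) = 0 := by
  funext n t; simp [pderiv]

theorem pderiv_const (i : ℕ+) (a : ℤ → 𝕜) : pderiv i (fun n _ => a n) = 0 := by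
  funext n t; simp [pderiv]

theorem pderiv_one (i : ℕ+) : pderiv i (1 : Fn 𝕜) = 0 := pderiv_const i fun _ => 1

theorem pderiv_add (i : ℕ+) {f g : Fn 𝕜} (hf : Smooth f) (hg : Smooth g) :
    pderiv i (f + g) = pderiv i f + pderiv i g := by
  funext n t
  exact pderiv_eq_of_hasDerivAt ((hf.hasDerivAt_self n t i).add (hg.hasDerivAt_self n t i))

theorem pderiv_neg (i : ℕ+) (f : Fn 𝕜) : pderiv i (-f) = -pderiv i f := by
  funext n t
  simp [pderiv]

theorem pderiv_sub (i : ℕ+) {f g : Fn 𝕜} (hf : Smooth f) (hg : Smooth g) :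
    pderiv i (f - g) = pderiv i f - pderiv i g := by
  rw [sub_eq_add_neg, pderiv_add i hf hg.neg, pderiv_neg, sub_eq_add_neg]

theorem pderiv_mul (i : ℕ+) {f g : Fn 𝕜} (hf : Smooth f) (hg : Smooth g) :
    pderiv i (f * g) = pderiv i f * g + f * pderiv i g := by
  funext n t
  have h := (hf.hasDerivAt_self n t i).mul (hg.hasDerivAt_self n t i)
  simp only [Function.update_eq_self] at h
  exact pderiv_eq_of_hasDerivAt h

theorem pderiv_smul (i : ℕ+) {f : Fn 𝕜} (hf : Smooth f) (a : 𝕜) :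
    pderiv i (a • f) = a • pderiv i f := by
  funext n t
  exact pderiv_eq_of_hasDerivAt ((hf.hasDerivAt_self n t i).const_smul a)

theorem pderiv_zsmul (i : ℕ+) {f : Fn 𝕜} (hf : Smooth f) (a : ℤ) :
    pderiv i (a • f) = a • pderiv i f := by
  have (g : Fn 𝕜) : a • g = (a : 𝕜) • g := by funext n t; simp
  rw [this, this, pderiv_smul i hf]

theorem pderiv_shift (i : ℕ+) (f : Fn 𝕜) (j : ℤ) : pderiv i (shift j f) = shift j (pderiv i f) :=
  rfl

theorem pderiv_diff (i : ℕ+) {f : Fn 𝕜} (hf : Smooth f) :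
    pderiv i (diff f) = diff (pderiv i f) := by
  rw [diff, pderiv_sub i (hf.shift 1) hf, pderiv_shift, diff]

theorem pderiv_iterate_diff (i : ℕ+) {f : Fn 𝕜} (hf : Smooth f) (k : ℕ) :
    pderiv i (diff^[k] f) = diff^[k] (pderiv i f) := by
  induction k with
  | zero => rfl
  | succ k ih =>
    rw [Function.iterate_succ_apply', Function.iterate_succ_apply',
      pderiv_diff i (hf.iterate_diff k), ih]

theorem pderiv_sum {ι : Type*} (i : ℕ+) (s : Finset ι) {f : ι → Fn 𝕜}
    (hf : ∀ j ∈ s, Smooth (f j)) : pderiv i (∑ j ∈ s, f j) = ∑ j ∈ s, pderiv i (f j) := by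
  classical
  induction s using Finset.induction_on with
  | empty => simpa using pderiv_zero i
  | insert a s ha ih =>
    rw [Finset.sum_insert ha, Finset.sum_insert ha, pderiv_add i (hf a (by simp))
      (Smooth.sum s fun j hj => hf j (by simp [hj])), ih fun j hj => hf j (by simp [hj])]

theorem pderiv_exp (i : ℕ+) {f : Fn 𝕜} (hf : Smooth f) :
    pderiv i (fun n t => NormedSpace.exp (f n t)) =
      pderiv i f * fun n t => NormedSpace.exp (f n t) := by
  funext n t
  have h := (hasFDerivAt_exp (𝕂 := ℝ) (𝔸 := 𝕜) (x := f n t))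
  have h1 := hf.hasDerivAt_self n t i
  have h2 : f n (Function.update t i (t i)) = f n t := by simp
  rw [← h2] at h
  have h3 := h.comp_hasDerivAt _ h1
  refine pderiv_eq_of_hasDerivAt (h3.congr_deriv ?_)
  simp [mul_comm]

theorem pderiv_comm (i j : ℕ+) {f : Fn 𝕜} (hf : Smooth f) :
    pderiv i (pderiv j f) = pderiv j (pderiv i f) := by
  rcases eq_or_ne i j with rfl | hij
  · rfl
  funext n t
  -- The claim becomes the symmetry of the second derivative of a smooth function on the plane
  -- spanned by the two coordinates.
  set H : ℝ × ℝ → 𝕜 := fun p => f n (Function.update (Function.update t i p.1) j p.2) with hH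
  have hHs : ContDiff ℝ ∞ H := by
    refine hf.contDiff_comp n {i, j} t (contDiff_update
      (contDiff_update (g := fun _ => t) (fun _ => contDiff_const) contDiff_fst i) contDiff_snd j) ?_
    intro e k hk
    simp only [Finset.mem_insert, Finset.mem_singleton, not_or] at hk
    rw [Function.update_of_ne hk.2, Function.update_of_ne hk.1]
  have hd1 (x y : ℝ) : HasDerivAt (fun x' : ℝ => (x', y)) ((1 : ℝ), (0 : ℝ)) x :=
    (hasDerivAt_id _).prodMk (hasDerivAt_const _ _)
  have hd2 (x y : ℝ) : HasDerivAt (fun y' : ℝ => (x, y')) ((0 : ℝ), (1 : ℝ)) y :=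
    (hasDerivAt_const _ _).prodMk (hasDerivAt_id _)
  have hH1 := fun p => (hHs.differentiable (by simp) p).hasFDerivAt
  have hH2 := fun p =>
    ((hHs.fderiv_right (m := ∞) (by simp)).differentiable (by simp) p).hasFDerivAt
  have e1 : pderiv i (pderiv j f) n t =
      fderiv ℝ (fderiv ℝ H) (t i, t j) (1, 0) (0, 1) := by
    have h : ∀ x, pderiv j f n (Function.update t i x) = fderiv ℝ H (x, t j) (0, 1) := by
      intro x
      refine pderiv_eq_of_hasDerivAt ?_
      rw [Function.update_of_ne hij.symm]
      exact (hH1 (x, t j)).comp_hasDerivAt _ (hd2 x (t j))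
    refine pderiv_eq_of_hasDerivAt ?_
    simp only [h]
    have h1 : HasDerivAt (fun x => fderiv ℝ H (x, t j))
        (fderiv ℝ (fderiv ℝ H) (t i, t j) (1, 0)) (t i) :=
      (hH2 (t i, t j)).comp_hasDerivAt (t i) (hd1 (t i) (t j))
    exact (ContinuousLinearMap.apply ℝ 𝕜 ((0 : ℝ), (1 : ℝ))).hasFDerivAt.comp_hasDerivAt (t i) h1
  have e2 : pderiv j (pderiv i f) n t =
      fderiv ℝ (fderiv ℝ H) (t i, t j) (0, 1) (1, 0) := by
    have h : ∀ y, pderiv i f n (Function.update t j y) = fderiv ℝ H (t i, y) (1, 0) := by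
      intro y
      refine pderiv_eq_of_hasDerivAt ?_
      rw [Function.update_of_ne hij]
      simp only [Function.update_comm hij.symm]
      exact (hH1 (t i, y)).comp_hasDerivAt (t i) (hd1 (t i) y)
    refine pderiv_eq_of_hasDerivAt ?_
    simp only [h]
    have h1 : HasDerivAt (fun y => fderiv ℝ H (t i, y))
        (fderiv ℝ (fderiv ℝ H) (t i, t j) (0, 1)) (t j) :=
      (hH2 (t i, t j)).comp_hasDerivAt (t j) (hd2 (t i) (t j))
    exact (ContinuousLinearMap.apply ℝ 𝕜 ((1 : ℝ), (0 : ℝ))).hasFDerivAt.comp_hasDerivAt (t j) h1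
  rw [e1, e2]
  exact (hHs.contDiffAt.isSymmSndFDerivAt (by simpa using ENat.LEInfty.out)) _ _

end

end DMKP

namespace DMKP

noncomputable section

variable {𝕜 : Type*} [RCLike 𝕜]

/-! ### The Poincaré lemma -/

theorem merge_update {S : Finset ℕ+} (t : ℕ+ → ℝ) (s : S → ℝ) (i : S) (x : ℝ) :
    merge S t (Function.update s i x) = Function.update (merge S t s) i x := by
  funext j
  by_cases hj : j ∈ S
  · by_cases h : j = i
    · subst h; simp [merge_of_mem]
    · have : (⟨j, hj⟩ : S) ≠ i := fun h' => h (by rw [← h'])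
      rw [merge_of_mem _ _ hj, Function.update_of_ne this, Function.update_of_ne h,
        merge_of_mem _ _ hj]
  · have h : j ≠ i := fun h => hj (h ▸ i.2)
    rw [merge_of_notMem _ _ hj, Function.update_of_ne h, merge_of_notMem _ _ hj]

/-- The one-form `∑_{i ∈ S} η_i dt_i` on a coordinate slice. -/
def sliceForm (η : ℕ+ → Fn 𝕜) (n : ℤ) (S : Finset ℕ+) (t : ℕ+ → ℝ) (s : S → ℝ) :
    (S → ℝ) →L[ℝ] 𝕜 :=
  ∑ i : S, (ContinuousLinearMap.proj (R := ℝ) (φ := fun _ : S => ℝ) i).smulRight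
    (η i n (merge S t s))

theorem sliceForm_apply (η : ℕ+ → Fn 𝕜) (n : ℤ) (S : Finset ℕ+) (t : ℕ+ → ℝ) (s v : S → ℝ) :
    sliceForm η n S t s v = ∑ i : S, v i • η i n (merge S t s) := by
  simp [sliceForm]

theorem Smooth.hasFDerivAt_merge {f : Fn 𝕜} (hf : Smooth f) (n : ℤ) (S : Finset ℕ+)
    (t : ℕ+ → ℝ) (s : S → ℝ) :
    HasFDerivAt (fun s : S → ℝ => f n (merge S t s))
      (sliceForm (fun i => DMKP.pderiv i f) n S t s) s := by
  have h : HasFDerivAt (fun s : S → ℝ => f n (merge S t s)) _ s :=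
    ((hf n t S).differentiable (by simp) s).hasFDerivAt
  refine h.congr_fderiv (Eq.symm ?_)
  -- Linear forms agree once they agree on basis vectors, where the Fréchet derivative is a
  -- one-variable derivative.
  refine ContinuousLinearMap.coe_injective (LinearMap.pi_ext' fun i => LinearMap.ext_ring ?_)
  have h1 : HasDerivAt (fun x : ℝ => Function.update s i x) (Pi.single i 1) (s i) :=
    hasDerivAt_update s i (s i)
  have h' := h
  rw [← Function.update_eq_self i s] at h'
  have h2 := h'.comp_hasDerivAt (s i) h1
  have h3 : HasDerivAt (fun x => f n (Function.update (merge S t s) i x))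
      (DMKP.pderiv i f n (merge S t s)) (s i) := by
    simpa [merge_of_mem] using hf.hasDerivAt_self n (merge S t s) i
  have h4 := h2.unique (by simpa only [Function.comp_def, merge_update] using h3)
  rw [Function.update_eq_self] at h4
  simp only [LinearMap.coe_comp, ContinuousLinearMap.coe_coe, LinearMap.coe_single,
    Function.comp_apply, sliceForm_apply]
  refine Eq.trans ?_ h4.symm
  rw [Finset.sum_eq_single i (fun j _ hj => by simp [hj]) (by simp)]
  simp

theorem contDiff_sliceForm {η : ℕ+ → Fn 𝕜} (hη : ∀ i, Smooth (η i)) (n : ℤ) (S : Finset ℕ+)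
    (t : ℕ+ → ℝ) : ContDiff ℝ ∞ (sliceForm η n S t) := by
  refine ContDiff.sum fun i _ => ?_
  exact ((ContinuousLinearMap.smulRightL ℝ (S → ℝ) 𝕜
    (ContinuousLinearMap.proj i)).contDiff).comp (hη i n t S)

theorem fderiv_sliceForm {η : ℕ+ → Fn 𝕜} (hη : ∀ i, Smooth (η i)) (n : ℤ) (S : Finset ℕ+)
    (t : ℕ+ → ℝ) (s u v : S → ℝ) : fderiv ℝ (sliceForm η n S t) s u v =
      ∑ i : S, ∑ j : S, v i • u j • pderiv j (η i) n (merge S t s) := by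
  have h1 : HasFDerivAt (fun s => sliceForm η n S t s v)
      (∑ i : S, v i • sliceForm (fun j => pderiv j (η i)) n S t s) s := by
    simp only [sliceForm_apply]
    exact HasFDerivAt.fun_sum fun i _ => ((hη i).hasFDerivAt_merge n S t s).const_smul (v i)
  have h2 := ((contDiff_sliceForm hη n S t).differentiable (by simp) s).hasFDerivAt.clm_apply
    (hasFDerivAt_const v s)
  have h3 := congrArg (fun D => D u) (h2.unique h1)
  simp only [ContinuousLinearMap.comp_zero, zero_add, ContinuousLinearMap.flip_apply] at h3
  rw [h3]
  simp [sliceForm_apply, Finset.smul_sum]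

/-- Points are equivalent if they differ in finitely many coordinates. -/
def finiteDiff : Setoid (ℕ+ → ℝ) where
  r t t' := {i | t i ≠ t' i}.Finite
  iseqv :=
    { refl := fun t => by simp
      symm := fun h => by simpa only [ne_comm] using h
      trans := fun {a b c} h h' => (h.union h').subset fun i hi => by
        by_contra hn
        simp only [Set.mem_union, Set.mem_ofPred_eq, not_or, not_not] at hn
        exact hi (hn.1.trans hn.2) }

/-- A chosen representative of the class of `t`. -/
def basePoint (t : ℕ+ → ℝ) : ℕ+ → ℝ := (Quotient.mk finiteDiff t).out

theorem finite_ne_basePoint (t : ℕ+ → ℝ) : {i | basePoint t i ≠ t i}.Finite :=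
  Quotient.exact (s := finiteDiff) (Quotient.out_eq (Quotient.mk finiteDiff t))

theorem basePoint_eq {t t' : ℕ+ → ℝ} (h : {i | t i ≠ t' i}.Finite) :
    basePoint t = basePoint t' := by
  rw [basePoint, basePoint, Quotient.sound (s := finiteDiff) h]

theorem basePoint_merge (S : Finset ℕ+) (t : ℕ+ → ℝ) (s : S → ℝ) :
    basePoint (merge S t s) = basePoint t := by
  refine basePoint_eq (S.finite_toSet.subset fun i hi => ?_)
  by_contra hn
  exact hi (merge_of_notMem t s hn)

/-- The integral of `∑_i η_i dt_i` along the segment from the base point of the class of `t`. -/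
def potential (η : ℕ+ → Fn 𝕜) : Fn 𝕜 := fun n t =>
  ∫ x in (0 : ℝ)..1, ∑ i ∈ (finite_ne_basePoint t).toFinset, (t i - basePoint t i) •
    η i n (fun j => basePoint t j + x * (t j - basePoint t j))

theorem potential_eq (η : ℕ+ → Fn 𝕜) (n : ℤ) (S : Finset ℕ+) {t : ℕ+ → ℝ}
    (h : ∀ i ∉ S, basePoint t i = t i) :
    potential η n t = curveIntegral (sliceForm η n S (basePoint t))
      (.segment (fun i : S => basePoint t i) (fun i : S => t i)) := by
  rw [curveIntegral_segment, potential]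
  congr 1
  funext x
  rw [sliceForm_apply]
  have h1 : merge S (basePoint t)
      (AffineMap.lineMap (fun i : S => basePoint t i) (fun i : S => t i) x) =
      fun j => basePoint t j + x * (t j - basePoint t j) := by
    funext j
    by_cases hj : j ∈ S
    · rw [merge_of_mem _ _ hj, AffineMap.lineMap_apply]
      simp [add_comm]
    · rw [merge_of_notMem _ _ hj, h j hj]; simp
  rw [h1]
  simp only [Pi.sub_apply]
  rw [Finset.sum_coe_sort S (fun i => (t i - basePoint t i) •
    η i n (fun j => basePoint t j + x * (t j - basePoint t j)))]
  refine Finset.sum_subset (fun i hi => ?_) fun i _ hi => ?_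
  · by_contra hn
    exact (by simpa using hi : basePoint t i ≠ t i) (h i hn)
  · have : basePoint t i = t i := by simpa using hi
    simp [this]

/-- Under `hS` the whole slice lies in the class of `t` and contains the base point, so every
segment of integration stays in the slice. The finite-dimensional Poincaré lemma for segment
integrals of a closed form on a convex set then applies. Base points of different classes need no
compatibility, since smoothness and partial derivatives never compare different classes. -/
theorem hasFDerivAt_potential {η : ℕ+ → Fn 𝕜} (hη : ∀ i, Smooth (η i))
    (hc : ∀ i j, pderiv i (η j) = pderiv j (η i)) (n : ℤ) (S : Finset ℕ+) (t : ℕ+ → ℝ)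
    (s : S → ℝ) (hS : ∀ i ∉ S, basePoint t i = t i) :
    HasFDerivAt (fun s : S → ℝ => potential η n (merge S t s)) (sliceForm η n S t s) s := by
  have hm : ∀ s, merge S (basePoint t) s = merge S t s := by
    intro s; funext i
    by_cases hi : i ∈ S
    · rw [merge_of_mem _ _ hi, merge_of_mem _ _ hi]
    · rw [merge_of_notMem _ _ hi, merge_of_notMem _ _ hi, hS i hi]
  have hf : sliceForm η n S (basePoint t) = sliceForm η n S t := by
    funext s; simp only [sliceForm, hm]
  have h1 : (fun s : S → ℝ => potential η n (merge S t s)) = fun s =>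
      curveIntegral (sliceForm η n S t) (.segment (fun i : S => basePoint t i) s) := by
    funext s
    rw [potential_eq η n S (fun i hi => by
      rw [basePoint_merge, merge_of_notMem _ _ hi, hS i hi]), basePoint_merge, hf]
    congr 1
    · funext i; exact merge_of_mem _ _ i.2
    · congr 1
      funext i; exact merge_of_mem _ _ i.2
  rw [h1, ← hasFDerivWithinAt_univ]
  refine convex_univ.hasFDerivWithinAt_curveIntegral_segment_of_hasFDerivWithinAt_symmetric
    (dω := fderiv ℝ (sliceForm η n S t)) (fun x _ =>
      ((contDiff_sliceForm hη n S t).differentiable (by simp) x).hasFDerivAt.hasFDerivWithinAt)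
    (fun a _ x _ y _ => ?_) trivial trivial
  rw [fderiv_sliceForm hη, fderiv_sliceForm hη, Finset.sum_comm]
  refine Finset.sum_congr rfl fun i _ => Finset.sum_congr rfl fun j _ => ?_
  rw [hc, smul_comm]

/-- The Poincaré lemma: a closed family of smooth functions is a gradient. -/
theorem exists_potential {η : ℕ+ → Fn 𝕜} (hη : ∀ i, Smooth (η i))
    (hc : ∀ i j, pderiv i (η j) = pderiv j (η i)) :
    ∃ θ : Fn 𝕜, Smooth θ ∧ ∀ i, pderiv i θ = η i := by
  have key : ∀ n t (S : Finset ℕ+), (∀ i ∉ S, basePoint t i = t i) →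
      ContDiff ℝ ∞ (fun s : S → ℝ => potential η n (merge S t s)) := by
    intro n t S hS
    rw [contDiff_infty_iff_fderiv]
    have h := fun s => hasFDerivAt_potential hη hc n S t s hS
    refine ⟨fun s => (h s).differentiableAt, ?_⟩
    have : fderiv ℝ (fun s : S → ℝ => potential η n (merge S t s)) = sliceForm η n S t :=
      funext fun s => (h s).fderiv
    rw [this]
    exact contDiff_sliceForm hη n S t
  have hS : ∀ t : ℕ+ → ℝ, ∀ S : Finset ℕ+, ∀ i ∉ S ∪ (finite_ne_basePoint t).toFinset,
      basePoint t i = t i := by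
    intro t S i hi
    rw [Finset.mem_union, not_or] at hi
    simpa using hi.2
  have hsm : Smooth (potential η) := by
    intro n t S
    -- The slice is enlarged by the finitely many coordinates in which `t` differs from its base
    -- point, and the result is then restricted to `S`.
    have h1 := key n t _ (hS t S)
    have h2 : ContDiff ℝ ∞ (fun s : S → ℝ =>
        (fun i : (S ∪ (finite_ne_basePoint t).toFinset : Finset ℕ+) => merge S t s i)) :=
      contDiff_pi.2 fun i => contDiff_merge S t i
    refine (congrArg (ContDiff ℝ ∞) (funext fun s => ?_)).mp (h1.comp h2)
    refine congrArg (potential η n) (funext fun i => ?_)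
    by_cases hi : i ∈ S ∪ (finite_ne_basePoint t).toFinset
    · rw [merge_of_mem _ _ hi]; rfl
    · rw [merge_of_notMem _ _ hi]
      rw [Finset.mem_union, not_or] at hi
      simp [hi.1]
  refine ⟨potential η, hsm, fun i => ?_⟩
  funext n t
  -- The index `i` is added so that the basis direction `i` exists in the slice.
  set S := {i} ∪ (finite_ne_basePoint t).toFinset
  have h0 : merge S t (fun j => t j) = t := by
    funext j
    by_cases hj : j ∈ S
    · rw [merge_of_mem _ _ hj]
    · rw [merge_of_notMem _ _ hj]
  have hi : i ∈ S := by simp [S]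
  have h1 := (hasFDerivAt_potential hη hc n S t (fun j => t j) (hS t {i})).unique
    (hsm.hasFDerivAt_merge n S t _)
  have h2 := congrArg (fun D => D (Pi.single ⟨i, hi⟩ 1)) h1
  simp only [sliceForm_apply, h0] at h2
  rw [Finset.sum_eq_single (⟨i, hi⟩ : S) (fun j _ hj => by simp [hj]) (by simp),
    Finset.sum_eq_single (⟨i, hi⟩ : S) (fun j _ hj => by simp [hj]) (by simp)] at h2
  simpa using h2.symm

end

end DMKP

namespace DMKP

noncomputable section

variable {𝕜 : Type*} [RCLike 𝕜]

open Finset.HasAntidiagonal (antidiagonal mem_antidiagonal)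

/-! ### The ring of pseudo-difference operators -/

/-- The shift as a linear map. -/
def shiftEnd (j : ℤ) : Module.End ℤ (Fn 𝕜) where
  toFun := shift j
  map_add' _ _ := rfl
  map_smul' _ _ := rfl

/-- The difference operator as a linear map. -/
def diffEnd : Module.End ℤ (Fn 𝕜) := shiftEnd 1 - 1

@[simp] theorem shiftEnd_apply (j : ℤ) (f : Fn 𝕜) :
    (shiftEnd j : Module.End ℤ (Fn 𝕜)) f = shift j f := rfl

theorem diffEnd_apply (f : Fn 𝕜) : (diffEnd : Module.End ℤ (Fn 𝕜)) f = diff f := rfl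

theorem shift_shift (j l : ℤ) (f : Fn 𝕜) : shift j (shift l f) = shift (j + l) f := by
  funext n t; simp [shift, add_assoc]

@[simp] theorem shift_zero (f : Fn 𝕜) : shift 0 f = f := by
  funext n t; simp [shift]

theorem shift_mul (j : ℤ) (f g : Fn 𝕜) : shift j (f * g) = shift j f * shift j g := rfl

theorem shift_add (j : ℤ) (f g : Fn 𝕜) : shift j (f + g) = shift j f + shift j g := rfl

theorem shift_sub (j : ℤ) (f g : Fn 𝕜) : shift j (f - g) = shift j f - shift j g := rfl

@[simp] theorem shift_apply_zero (j : ℤ) : shift j (0 : Fn 𝕜) = 0 := rfl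

@[simp] theorem shift_apply_one (j : ℤ) : shift j (1 : Fn 𝕜) = 1 := rfl

theorem shift_zsmul (j a : ℤ) (f : Fn 𝕜) : shift j (a • f) = a • shift j f := rfl

theorem shiftEnd_mul (j l : ℤ) : (shiftEnd j * shiftEnd l : Module.End ℤ (Fn 𝕜)) =
    shiftEnd (j + l) :=
  LinearMap.ext fun f => shift_shift j l f

theorem shiftEnd_zero : (shiftEnd 0 : Module.End ℤ (Fn 𝕜)) = 1 := LinearMap.ext shift_zero

theorem shiftEnd_pow (j : ℤ) (r : ℕ) : (shiftEnd j ^ r : Module.End ℤ (Fn 𝕜)) =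
    shiftEnd (r * j) := by
  induction r with
  | zero => simp [shiftEnd_zero]
  | succ r ih => rw [pow_succ, ih, shiftEnd_mul]; congr 1; push_cast; ring

theorem iterate_diff_eq (p : ℕ) (f : Fn 𝕜) :
    diff^[p] f = (diffEnd ^ p : Module.End ℤ (Fn 𝕜)) f := by
  rw [Module.End.pow_apply]; rfl

@[simp] theorem diff_one : diff (1 : Fn 𝕜) = 0 := sub_self _

theorem iterate_diff_one {p : ℕ} (h : p ≠ 0) : diff^[p] (1 : Fn 𝕜) = 0 := by
  obtain ⟨q, rfl⟩ := Nat.exists_eq_succ_of_ne_zero h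
  rw [Function.iterate_succ_apply, diff_one, PDO.diff_iterate_zero]

theorem commute_shiftEnd_diffEnd (j : ℤ) :
    Commute (shiftEnd j : Module.End ℤ (Fn 𝕜)) diffEnd := by
  refine Commute.sub_right ?_ (Commute.one_right _)
  rw [Commute, SemiconjBy, shiftEnd_mul, shiftEnd_mul, add_comm]

theorem shift_iterate_diff (j : ℤ) (p : ℕ) (f : Fn 𝕜) :
    shift j (diff^[p] f) = diff^[p] (shift j f) := by
  rw [iterate_diff_eq, iterate_diff_eq]
  exact congrArg (fun φ : Module.End ℤ (Fn 𝕜) => φ f) ((commute_shiftEnd_diffEnd j).pow_right p)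

/-- `(-Γ⁻¹)^r = (Γ⁻¹ Δ - 1)^r`, expanded. -/
theorem sum_choose_shift_diff (k : ℤ) (r : ℕ) (v : Fn 𝕜) :
    ∑ x ∈ antidiagonal r,
      ((-1) ^ x.2 * (r.choose x.1 : ℤ)) • shift (k - x.1) (diff^[x.1] v) =
      (-1 : ℤ) ^ r • shift (k - r) v := by
  have hc : Commute (shiftEnd (-1) * diffEnd : Module.End ℤ (Fn 𝕜)) (-1) :=
    (Commute.neg_one_right _)
  have hs : (shiftEnd (-1) * diffEnd + (-1) : Module.End ℤ (Fn 𝕜)) = (-1) * shiftEnd (-1) := by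
    rw [diffEnd, mul_sub, shiftEnd_mul, neg_add_cancel, shiftEnd_zero]; noncomm_ring
  have h := hc.add_pow' r
  rw [hs, (Commute.neg_one_left _).mul_pow, shiftEnd_pow] at h
  have h2 := congrArg (fun φ : Module.End ℤ (Fn 𝕜) => (shiftEnd k : Module.End ℤ (Fn 𝕜)) (φ v)) h
  simp only [LinearMap.sum_apply, map_sum] at h2
  have e : ∀ φ : Module.End ℤ (Fn 𝕜), (((-1 : Module.End ℤ (Fn 𝕜)) ^ r) * φ) v =
      (-1 : ℤ) ^ r • φ v := by
    intro φ
    rcases Nat.even_or_odd r with h | h <;> simp [h.neg_one_pow]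
  rw [e, map_zsmul, shiftEnd_apply, shiftEnd_apply, shift_shift, eq_comm] at h2
  convert h2 using 2 with x hx
  · have h3 := (commute_shiftEnd_diffEnd (𝕜 := 𝕜) (-1)).mul_pow x.1
    have e2 : ∀ φ : Module.End ℤ (Fn 𝕜), (φ * ((-1 : Module.End ℤ (Fn 𝕜)) ^ x.2)) v =
      (-1 : ℤ) ^ x.2 • φ v := by
      intro φ
      rcases Nat.even_or_odd x.2 with h | h <;> simp [h.neg_one_pow]
    rw [LinearMap.smul_apply, e2, h3, shiftEnd_pow, Module.End.mul_apply, ← iterate_diff_eq,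
      map_nsmul, map_zsmul, shiftEnd_apply, shiftEnd_apply, shift_shift, mul_comm, mul_smul,
      natCast_zsmul]
    congr 4
    ring
  · congr 1; ring

theorem sum_antidiagonal_assoc {M : Type*} [AddCommMonoid M] (f : ℕ → ℕ → ℕ → M) (s : ℕ) :
    ∑ x ∈ antidiagonal s, ∑ y ∈ antidiagonal x.1, f y.1 y.2 x.2 =
      ∑ x ∈ antidiagonal s, ∑ y ∈ antidiagonal x.2, f x.1 y.1 y.2 := by
  rw [Finset.sum_sigma', Finset.sum_sigma']
  refine Finset.sum_bij' (fun a _ => ⟨(a.2.1, a.2.2 + a.1.2), (a.2.2, a.1.2)⟩)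
    (fun a _ => ⟨(a.1.1 + a.2.1, a.2.2), (a.1.1, a.2.1)⟩) ?_ ?_ ?_ ?_ ?_
  all_goals
    rintro ⟨⟨a, b⟩, ⟨c, d⟩⟩ h
    simp only [Finset.mem_sigma, mem_antidiagonal] at h
    obtain ⟨rfl, rfl⟩ := h
    simp [add_assoc]

/-- This is the coefficient of `Γ^{k+l-s}` in `Δ^k ∘ v ∘ Δ^l`, computed in two ways: by the Leibniz
rule followed by `Δ = Γ - 1`, and by expanding `(Γ-1)^k v (Γ-1)^l` directly. Expanding each shift on
the right by `sum_choose_shift_diff` and regrouping binomials reduces the equality to Vandermonde's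
convolution for `(k - a) + l`. -/
theorem sum_choose_mul_choose (k l : ℤ) (s : ℕ) (v : Fn 𝕜) :
    ∑ x ∈ antidiagonal s, ((-1) ^ x.2 * Ring.choose (k + l - x.1) x.2 *
      Ring.choose k x.1) • shift (k - x.1) (diff^[x.1] v) =
    ∑ x ∈ antidiagonal s, ((-1) ^ s * Ring.choose k x.1 * Ring.choose l x.2) •
      shift (k - x.1) v := by
  have h1 : ∀ x ∈ antidiagonal s, ((-1) ^ s * Ring.choose k x.1 * Ring.choose l x.2) •
      shift (k - x.1) v = ∑ y ∈ antidiagonal x.1,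
        ((-1) ^ (y.2 + x.2) * (Ring.choose (k - y.1) y.2 * Ring.choose l x.2) *
          Ring.choose k y.1) • shift (k - y.1) (diff^[y.1] v) := by
    intro x hx
    rw [mem_antidiagonal] at hx
    have h := sum_choose_shift_diff k x.1 v
    have e : ((-1) ^ s * Ring.choose k x.1 * Ring.choose l x.2) • shift (k - x.1) v =
        ((-1) ^ x.2 * Ring.choose k x.1 * Ring.choose l x.2) • ((-1 : ℤ) ^ x.1 •
          shift (k - x.1) v) := by
      rw [smul_smul, ← hx]; congr 1; ring
    rw [e, ← h, Finset.smul_sum]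
    refine Finset.sum_congr rfl fun y hy => ?_
    rw [mem_antidiagonal] at hy
    rw [smul_smul]
    congr 1
    have hc := Ring.choose_smul_choose k (show y.1 ≤ x.1 by omega)
    rw [show x.1 - y.1 = y.2 by omega, nsmul_eq_mul] at hc
    linear_combination (-1 : ℤ) ^ (y.2 + x.2) * Ring.choose l x.2 * hc
  rw [Finset.sum_congr rfl h1, sum_antidiagonal_assoc fun a b c => ((-1) ^ (b + c) *
    (Ring.choose (k - a) b * Ring.choose l c) * Ring.choose k a) • shift (k - a) (diff^[a] v)]
  refine Finset.sum_congr rfl fun x _ => ?_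
  rw [← Finset.sum_smul, ← Finset.sum_mul, show k + l - x.1 = k - x.1 + l by ring,
    Ring.add_choose_eq _ (Commute.all _ _), Finset.mul_sum]
  congr 2
  refine Finset.sum_congr rfl fun y hy => ?_
  rw [mem_antidiagonal.1 hy]

namespace PDO

instance : Zero (PDO 𝕜) := ⟨⟨fun _ => 0, ⟨0, fun _ _ => rfl⟩⟩⟩

instance : Add (PDO 𝕜) where
  add A B := ⟨fun k => A.coeff k + B.coeff k, by
    obtain ⟨N, hN⟩ := A.bdd
    obtain ⟨M, hM⟩ := B.bdd
    exact ⟨max N M, fun k hk => by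
      rw [hN k (lt_of_le_of_lt (le_max_left _ _) hk), hM k (lt_of_le_of_lt (le_max_right _ _) hk),
        add_zero]⟩⟩

@[simp] theorem coeff_zero (k : ℤ) : (0 : PDO 𝕜).coeff k = 0 := rfl

@[simp] theorem coeff_add (A B : PDO 𝕜) (k : ℤ) : (A + B).coeff k = A.coeff k + B.coeff k := rfl

@[simp] theorem coeff_neg (A : PDO 𝕜) (k : ℤ) : (-A).coeff k = -A.coeff k := rfl

@[simp] theorem coeff_sub (A B : PDO 𝕜) (k : ℤ) : (A - B).coeff k = A.coeff k - B.coeff k := rfl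

theorem coeff_mono (k j : ℤ) (u : Fn 𝕜) : (mono k u).coeff j = if j = k then u else 0 := rfl

@[simp] theorem coeff_mono_self (k : ℤ) (u : Fn 𝕜) : (mono k u).coeff k = u := if_pos rfl

theorem coeff_mono_of_ne {k j : ℤ} (h : j ≠ k) (u : Fn 𝕜) : (mono k u).coeff j = 0 := if_neg h

theorem coeff_mul (A B : PDO 𝕜) (m : ℤ) :
    (A * B).coeff m = ∑ᶠ p : ℤ × ℕ, mulTerm A B m p := rfl

theorem one_def : (1 : PDO 𝕜) = mono 0 1 := rfl

instance : AddCommGroup (PDO 𝕜) where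
  add_assoc A B C := by ext1; funext k; simp [add_assoc]
  zero_add A := by ext1; funext k; simp
  add_zero A := by ext1; funext k; simp
  nsmul := nsmulRec
  zsmul := zsmulRec
  neg_add_cancel A := by ext1; funext k; simp
  add_comm A B := by ext1; funext k; simp [add_comm]
  sub_eq_add_neg A B := by ext1; funext k; simp [sub_eq_add_neg]

/-- `A` has order at most `N`. -/
def OrdLE (A : PDO 𝕜) (N : ℤ) : Prop := ∀ k, N < k → A.coeff k = 0

theorem exists_ordLE (A : PDO 𝕜) : ∃ N, A.OrdLE N := A.bdd

theorem OrdLE.mono {A : PDO 𝕜} {N M : ℤ} (h : A.OrdLE N) (hNM : N ≤ M) : A.OrdLE M :=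
  fun k hk => h k (by omega)

theorem OrdLE.add {A B : PDO 𝕜} {N : ℤ} (hA : A.OrdLE N) (hB : B.OrdLE N) : (A + B).OrdLE N :=
  fun k hk => by rw [coeff_add, hA k hk, hB k hk, add_zero]

theorem OrdLE.sub {A B : PDO 𝕜} {N : ℤ} (hA : A.OrdLE N) (hB : B.OrdLE N) : (A - B).OrdLE N :=
  fun k hk => by rw [coeff_sub, hA k hk, hB k hk, sub_zero]

theorem ordLE_mono (k : ℤ) (u : Fn 𝕜) : (PDO.mono k u).OrdLE k :=
  fun _ hj => coeff_mono_of_ne hj.ne' u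

theorem OrdLE.mul {A B : PDO 𝕜} {N M : ℤ} (hA : A.OrdLE N) (hB : B.OrdLE M) :
    (A * B).OrdLE (N + M) := by
  intro m hm
  rw [coeff_mul, ← finsum_zero (α := ℤ × ℕ)]
  refine finsum_congr fun p => mulTerm_eq_zero ?_
  by_cases hp : N < p.1
  · exact Or.inl (hA _ hp)
  · exact Or.inr (hB _ (by omega))

theorem iterate_diff_add (p : ℕ) (f g : Fn 𝕜) :
    diff^[p] (f + g) = diff^[p] f + diff^[p] g := by
  simp only [iterate_diff_eq, map_add]

theorem add_mul' (A A' B : PDO 𝕜) : (A + A') * B = A * B + A' * B := by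
  ext1; funext m
  rw [coeff_add, coeff_mul, coeff_mul, coeff_mul, ← finsum_add_distrib
    (mulTerm_support_finite A B m) (mulTerm_support_finite A' B m)]
  refine finsum_congr fun p => ?_
  simp only [mulTerm, coeff_add, add_mul, smul_add]

theorem mul_add' (A B B' : PDO 𝕜) : A * (B + B') = A * B + A * B' := by
  ext1; funext m
  rw [coeff_add, coeff_mul, coeff_mul, coeff_mul, ← finsum_add_distrib
    (mulTerm_support_finite A B m) (mulTerm_support_finite A B' m)]
  refine finsum_congr fun p => ?_
  simp only [mulTerm, coeff_add, iterate_diff_add, shift_add, mul_add, smul_add]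

/-- Multiplication as a biadditive map. -/
def mulHom : PDO 𝕜 →+ PDO 𝕜 →+ PDO 𝕜 :=
  AddMonoidHom.mk' (fun A => AddMonoidHom.mk' (fun B => A * B) (mul_add' A))
    fun A A' => by ext1 B; exact add_mul' A A' B

/-- Coefficients of a product with a monomial on the left. -/
theorem mono_mul_coeff (k : ℤ) (u : Fn 𝕜) {B : PDO 𝕜} {M : ℤ} (hB : B.OrdLE M) (m : ℤ) (r : ℕ)
    (hr : k + M < m + r) : (mono k u * B).coeff m =
      ∑ i ∈ Finset.range r, Ring.choose k i • (u * shift (k - i) (diff^[i] (B.coeff (m - k + i)))) := by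
  classical
  rw [coeff_mul, finsum_eq_sum_of_support_subset (s := (Finset.range r).image
    fun i => (k, i)), Finset.sum_image fun i _ j _ h => by simpa using h]
  · refine Finset.sum_congr rfl fun i _ => ?_
    simp [mulTerm]
  · rintro ⟨j, i⟩ hp
    have h1 : j = k := by
      by_contra h
      exact hp (mulTerm_eq_zero (Or.inl (coeff_mono_of_ne h u)))
    have h2 : i < r := by
      by_contra h
      exact hp (mulTerm_eq_zero (Or.inr (hB _ (by push_cast; omega))))
    simp [h1, h2]

theorem mono_mul_mono_coeff (k l : ℤ) (u v : Fn 𝕜) (p : ℕ) :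
    (mono k u * mono l v).coeff (k + l - p) =
      Ring.choose k p • (u * shift (k - p) (diff^[p] v)) := by
  rw [mono_mul_coeff k u (ordLE_mono l v) _ (p + 1) (by push_cast; omega),
    Finset.sum_eq_single p]
  · rw [show k + l - p - k + p = l by ring, coeff_mono_self]
  · intro i _ hi
    rw [coeff_mono_of_ne (by omega), diff_iterate_zero]
    simp
  · simp

/-- Separatedness of the filtration by order; limits of successive approximations are identified
through it. -/
theorem eq_zero_of_ordLE {A : PDO 𝕜} (h : ∀ N : ℤ, A.OrdLE N) : A = 0 := by
  ext1; funext k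
  exact h (k - 1) k (by omega)

/-- Subtracting the leading coefficient lowers the order. -/
theorem OrdLE.sub_mono {A : PDO 𝕜} {N : ℤ} (h : A.OrdLE N) :
    (A - PDO.mono N (A.coeff N)).OrdLE (N - 1) := by
  intro k hk
  rcases eq_or_ne k N with rfl | hn
  · simp
  · rw [coeff_sub, coeff_mono_of_ne hn, h k (by omega), sub_zero]

/-- Two additive maps out of operators agree if they agree on monomials and if, up to arbitrarily
high codimension, they only see finitely many coefficients. -/
theorem eq_zero_of_mono {X : Type*} [AddCommGroup X] (φ : PDO 𝕜 →+ X) (K : ℤ)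
    (h0 : ∀ A : PDO 𝕜, A.OrdLE K → φ A = 0) (h : ∀ k u, φ (mono k u) = 0) (A : PDO 𝕜) :
    φ A = 0 := by
  have key : ∀ (d : ℕ) (A : PDO 𝕜), A.OrdLE (K + d) → φ A = 0 := by
    intro d
    induction d with
    | zero => intro A hA; exact h0 A (by simpa using hA)
    | succ d ih =>
      intro A hA
      have := ih (A - mono _ (A.coeff _)) (hA.sub_mono.mono (by push_cast; omega))
      rwa [map_sub, h, sub_zero] at this
  obtain ⟨N, hN⟩ := A.exists_ordLE
  exact key (N - K).toNat A (hN.mono (by omega))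

/-! ### Associativity, via Laurent series in the shift. -/

/-- The coefficient of `Γ^j` after the substitution `Δ = Γ - 1`. -/
def gammaCoeff (A : PDO 𝕜) (j : ℤ) : Fn 𝕜 :=
  ∑ᶠ i : ℕ, ((-1) ^ i * Ring.choose (j + i) i : ℤ) • A.coeff (j + i)

theorem gammaCoeff_support_finite (A : PDO 𝕜) (j : ℤ) :
    (Function.support fun i : ℕ =>
      ((-1) ^ i * Ring.choose (j + i) i : ℤ) • A.coeff (j + i)).Finite := by
  obtain ⟨N, hN⟩ := A.exists_ordLE
  refine (Set.finite_Iic (N - j).toNat).subset fun i hi => ?_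
  by_contra h
  rw [Set.mem_Iic] at h
  refine hi ?_
  simp only
  rw [hN _ (by omega), smul_zero]

theorem gammaCoeff_add (A B : PDO 𝕜) (j : ℤ) :
    gammaCoeff (A + B) j = gammaCoeff A j + gammaCoeff B j := by
  rw [gammaCoeff, gammaCoeff, gammaCoeff, ← finsum_add_distrib (gammaCoeff_support_finite A j)
    (gammaCoeff_support_finite B j)]
  simp

theorem OrdLE.gammaCoeff_eq_sum {A : PDO 𝕜} {N : ℤ} (hA : A.OrdLE N) (j : ℤ) (r : ℕ)
    (hr : N < j + r) : gammaCoeff A j =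
      ∑ i ∈ Finset.range r, ((-1) ^ i * Ring.choose (j + i) i : ℤ) • A.coeff (j + i) := by
  refine finsum_eq_sum_of_support_subset _ fun i hi => ?_
  by_contra h
  refine hi ?_
  simp only
  rw [hA _ (by simp at h; omega), smul_zero]

theorem OrdLE.gammaCoeff_eq_zero {A : PDO 𝕜} {N : ℤ} (hA : A.OrdLE N) (j : ℤ) (hj : N < j) :
    gammaCoeff A j = 0 := by
  rw [hA.gammaCoeff_eq_sum j 0 (by simpa using hj), Finset.sum_range_zero]

theorem OrdLE.gammaCoeff_self {A : PDO 𝕜} {N : ℤ} (hA : A.OrdLE N) :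
    gammaCoeff A N = A.coeff N := by
  rw [hA.gammaCoeff_eq_sum N 1 (by simp)]
  simp

theorem gammaCoeff_mono (k : ℤ) (u : Fn 𝕜) (r : ℕ) :
    gammaCoeff (mono k u) (k - r) = ((-1) ^ r * Ring.choose k r : ℤ) • u := by
  rw [(ordLE_mono k u).gammaCoeff_eq_sum _ (r + 1) (by push_cast; omega),
    Finset.sum_eq_single r]
  · rw [sub_add_cancel, coeff_mono_self]
  · intro i _ hi
    rw [coeff_mono_of_ne (by omega), smul_zero]
  · simp

/-- Multiplication by a function, as a linear map. -/
def mulEnd (u : Fn 𝕜) : Module.End ℤ (Fn 𝕜) := LinearMap.mulLeft ℤ u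

@[simp] theorem mulEnd_apply (u f : Fn 𝕜) : mulEnd u f = u * f := rfl

theorem mulEnd_add (u v : Fn 𝕜) : mulEnd (u + v) = mulEnd u + mulEnd v :=
  LinearMap.ext fun f => add_mul u v f

theorem mulEnd_zero : mulEnd (0 : Fn 𝕜) = 0 := LinearMap.ext fun f => zero_mul f

/-- The series `∑_j σ_j Γ^j` of an operator, as a Laurent series with coefficients in the ring of
endomorphisms of the space of functions. -/
def gammaSeries : PDO 𝕜 →+ HahnSeries ℤ (Module.End ℤ (Fn 𝕜)) :=
  AddMonoidHom.mk' (fun A => HahnSeries.ofSuppBddBelow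
    (fun e => mulEnd (gammaCoeff A (-e)) * shiftEnd (-e)) (by
      obtain ⟨N, hN⟩ := A.exists_ordLE
      refine ⟨-N, fun k hk => ?_⟩
      by_contra hlt
      refine hk ?_
      simp only
      rw [hN.gammaCoeff_eq_zero _ (by omega), mulEnd_zero, zero_mul]))
    fun A B => by
      ext1; funext e
      change mulEnd (gammaCoeff (A + B) (-e)) * shiftEnd (-e) =
        mulEnd (gammaCoeff A (-e)) * shiftEnd (-e) + mulEnd (gammaCoeff B (-e)) * shiftEnd (-e)
      rw [gammaCoeff_add, mulEnd_add, add_mul]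

theorem gammaSeries_coeff (A : PDO 𝕜) (e : ℤ) :
    (gammaSeries A).coeff e = mulEnd (gammaCoeff A (-e)) * shiftEnd (-e) := rfl

/-- The change from powers of `Δ` to powers of `Γ` is unitriangular: at the top order the two
coefficients coincide, so the order of an operator in the kernel can be lowered indefinitely.
Evaluating the endomorphisms at the function 1 recovers the coefficients. -/
theorem gammaSeries_injective : Function.Injective (gammaSeries (𝕜 := 𝕜)) := by
  rw [injective_iff_map_eq_zero]
  intro A hA
  have h : ∀ j, gammaCoeff A j = 0 := by
    intro j
    have := congrArg (fun x => x.coeff (-j) (1 : Fn 𝕜)) hA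
    simpa [gammaSeries_coeff] using this
  obtain ⟨N, hN⟩ := A.exists_ordLE
  have key : ∀ d : ℕ, A.OrdLE (N - d) := by
    intro d
    induction d with
    | zero => simpa using hN
    | succ d ih =>
      intro k hk
      rcases eq_or_ne k (N - d) with rfl | hne
      · rw [← ih.gammaCoeff_self, h]
      · exact ih k (by push_cast at hk; omega)
  exact eq_zero_of_ordLE fun M => (key (N - M).toNat).mono (by omega)

/-- Splitting off the lowest possible powers leaves power series, for which the Cauchy product runs
over a finite antidiagonal. The powers are split off on the outer sides, so no commutativity of
coefficients is needed. -/
theorem coeff_mul_of_bounded {R : Type*} [Ring R] {x y : HahnSeries ℤ R} {a b : ℤ}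
    (hx : ∀ e < a, x.coeff e = 0) (hy : ∀ e < b, y.coeff e = 0) (s : ℕ) :
    (x * y).coeff (a + b + s) =
      ∑ p ∈ antidiagonal s, x.coeff (a + p.1) * y.coeff (b + p.2) := by
  have hx' : x = HahnSeries.single a 1 *
      HahnSeries.ofPowerSeries ℤ R (PowerSeries.mk fun i => x.coeff (a + i)) := by
    ext e
    rw [HahnSeries.coeff_single_mul, one_mul]
    rcases lt_or_ge e a with h | h
    · rw [hx e h, HahnSeries.ofPowerSeries_apply, HahnSeries.embDomain_of_notMem_range]
      simp only [Set.mem_range, not_exists]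
      intro i hi
      simp at hi
      omega
    · obtain ⟨i, rfl⟩ := Int.le.dest h
      rw [add_sub_cancel_left, HahnSeries.ofPowerSeries_apply_coeff, PowerSeries.coeff_mk]
  have hy' : y = HahnSeries.ofPowerSeries ℤ R (PowerSeries.mk fun i => y.coeff (b + i)) *
      HahnSeries.single b 1 := by
    ext e
    rw [HahnSeries.coeff_mul_single, mul_one]
    rcases lt_or_ge e b with h | h
    · rw [hy e h, HahnSeries.ofPowerSeries_apply, HahnSeries.embDomain_of_notMem_range]
      simp only [Set.mem_range, not_exists]
      intro i hi
      simp at hi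
      omega
    · obtain ⟨i, rfl⟩ := Int.le.dest h
      rw [add_sub_cancel_left, HahnSeries.ofPowerSeries_apply_coeff, PowerSeries.coeff_mk]
  rw [hx', hy', mul_assoc, ← mul_assoc (HahnSeries.ofPowerSeries ℤ R _), ← map_mul,
    HahnSeries.coeff_single_mul, HahnSeries.coeff_mul_single, one_mul, mul_one,
    show a + b + s - a - b = s by ring, HahnSeries.ofPowerSeries_apply_coeff,
    PowerSeries.coeff_mul]
  simp only [PowerSeries.coeff_mk, ← hx', ← hy']

theorem gammaSeries_coeff_of_lt {A : PDO 𝕜} {N : ℤ} (hA : A.OrdLE N) (e : ℤ) (he : e < -N) :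
    (gammaSeries A).coeff e = 0 := by
  rw [gammaSeries_coeff, hA.gammaCoeff_eq_zero _ (by omega), mulEnd_zero, zero_mul]

theorem gammaSeries_mul_coeff_of_lt {A B : PDO 𝕜} {N M : ℤ} (hA : A.OrdLE N) (hB : B.OrdLE M)
    (e : ℤ) (he : e < -(N + M)) : (gammaSeries A * gammaSeries B).coeff e = 0 := by
  have h := coeff_mul_of_bounded (a := e + M) (b := -M)
    (fun e' he' => gammaSeries_coeff_of_lt hA e' (by omega))
    (fun e' he' => gammaSeries_coeff_of_lt hB e' (by omega)) 0
  simp only [Nat.cast_zero, add_zero, add_neg_cancel_right] at h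
  rw [h]
  simp [gammaSeries_coeff_of_lt hA (e + M) (by omega)]

theorem gammaSeries_mono_mul_mono (k l : ℤ) (u v : Fn 𝕜) :
    gammaSeries (mono k u * mono l v) = gammaSeries (mono k u) * gammaSeries (mono l v) := by
  have hk := ordLE_mono k u
  have hl := ordLE_mono l v
  ext1; funext e
  rcases lt_or_ge e (-(k + l)) with h | h
  · rw [gammaSeries_coeff_of_lt (hk.mul hl) e h, gammaSeries_mul_coeff_of_lt hk hl e h]
  obtain ⟨s, rfl⟩ := Int.le.dest h
  rw [show -(k + l) + (s : ℤ) = -k + -l + s by ring, coeff_mul_of_bounded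
    (fun e he => gammaSeries_coeff_of_lt hk e he) (fun e he => gammaSeries_coeff_of_lt hl e he)]
  refine LinearMap.ext fun f => ?_
  have h1 : gammaCoeff (mono k u * mono l v) (k + l - s) =
      u * ∑ x ∈ antidiagonal s, ((-1) ^ x.2 * Ring.choose (k + l - x.1) x.2 *
        Ring.choose k x.1) • shift (k - x.1) (diff^[x.1] v) := by
    rw [(hk.mul hl).gammaCoeff_eq_sum _ (s + 1) (by push_cast; omega), Finset.mul_sum,
      ← Finset.Nat.sum_antidiagonal_swap, Finset.Nat.sum_antidiagonal_eq_sum_range_succ_mk]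
    refine Finset.sum_congr rfl fun i hi => ?_
    have his : i ≤ s := by simpa [Nat.lt_succ_iff] using hi
    have e1 : k + l - (s : ℤ) + i = k + l - (s - i : ℕ) := by push_cast [his]; ring
    rw [e1, mono_mul_mono_coeff, smul_smul, mul_smul_comm]
    rfl
  rw [gammaSeries_coeff, Module.End.mul_apply, mulEnd_apply, shiftEnd_apply,
    show -(-k + -l + (s : ℤ)) = k + l - s by ring, h1, sum_choose_mul_choose, LinearMap.sum_apply,
    mul_assoc, Finset.sum_mul, Finset.mul_sum]
  refine Finset.sum_congr rfl fun x hx => ?_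
  have hs : s = x.1 + x.2 := (mem_antidiagonal.1 hx).symm
  rw [gammaSeries_coeff, gammaSeries_coeff, show -(-k + (x.1 : ℤ)) = k - x.1 by ring,
    show -(-l + (x.2 : ℤ)) = l - x.2 by ring, gammaCoeff_mono, gammaCoeff_mono]
  simp only [Module.End.mul_apply, mulEnd_apply, shiftEnd_apply, shift_mul, shift_zsmul,
    shift_shift, smul_mul_assoc, mul_smul_comm, smul_smul]
  congr 1
  · rw [hs]; ring
  · congr 3; rw [hs]; push_cast; ring

/-- Both sides are biadditive, and a fixed coefficient vanishes when the sum of the two orders is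
low enough. Hence the right factor, for a monomial left factor, and then the left factor may be
reduced to monomials. -/
theorem gammaSeries_mul (A B : PDO 𝕜) :
    gammaSeries (A * B) = gammaSeries A * gammaSeries B := by
  ext1; funext e
  obtain ⟨N, hN⟩ := A.exists_ordLE
  obtain ⟨M, hM⟩ := B.exists_ordLE
  let ev : HahnSeries ℤ (Module.End ℤ (Fn 𝕜)) →+ Module.End ℤ (Fn 𝕜) :=
    AddMonoidHom.mk' (fun x => x.coeff e) fun _ _ => rfl
  have low : ∀ (A B : PDO 𝕜) (N M : ℤ), A.OrdLE N → B.OrdLE M → N + M < -e →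
      ev (gammaSeries (A * B) - gammaSeries A * gammaSeries B) = 0 := by
    intro A B N M hN hM h
    change (gammaSeries (A * B)).coeff e - (gammaSeries A * gammaSeries B).coeff e = 0
    rw [gammaSeries_coeff_of_lt (hN.mul hM) e (by omega),
      gammaSeries_mul_coeff_of_lt hN hM e (by omega), sub_zero]
  let φ (B : PDO 𝕜) : PDO 𝕜 →+ Module.End ℤ (Fn 𝕜) := AddMonoidHom.mk'
    (fun A => ev (gammaSeries (A * B) - gammaSeries A * gammaSeries B)) fun A A' => by
      rw [← map_add, add_mul', map_add, map_add, add_mul]; congr 1; abel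
  let ψ (A : PDO 𝕜) : PDO 𝕜 →+ Module.End ℤ (Fn 𝕜) := AddMonoidHom.mk'
    (fun B => ev (gammaSeries (A * B) - gammaSeries A * gammaSeries B)) fun B B' => by
      rw [← map_add, mul_add', map_add, map_add, mul_add]; congr 1; abel
  have h1 : ∀ k u B, ψ (mono k u) B = 0 := fun k u B =>
    eq_zero_of_mono (ψ (mono k u)) (-e - k - 1)
      (fun B hB => low _ _ _ _ (ordLE_mono k u) hB (by omega))
      (fun l v => by
        change ev (gammaSeries (mono k u * mono l v) -
          gammaSeries (mono k u) * gammaSeries (mono l v)) = 0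
        rw [gammaSeries_mono_mul_mono, sub_self, map_zero]) B
  have h2 : φ B A = 0 := eq_zero_of_mono (φ B) (-e - M - 1)
    (fun A hA => low _ _ _ _ hA hM (by omega)) (fun k u => h1 k u B) A
  exact sub_eq_zero.1 h2

theorem gammaSeries_one : gammaSeries (1 : PDO 𝕜) = 1 := by
  ext1; funext e
  rw [gammaSeries_coeff, HahnSeries.coeff_one, one_def]
  rcases lt_or_ge e 0 with h | h
  · rw [(ordLE_mono 0 1).gammaCoeff_eq_zero _ (by omega), if_neg (by omega), mulEnd_zero, zero_mul]
  obtain ⟨s, rfl⟩ := Int.le.dest h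
  rw [show -(0 + (s : ℤ)) = 0 - s by ring, gammaCoeff_mono]
  rcases Nat.eq_zero_or_pos s with rfl | hs
  · refine LinearMap.ext fun f => ?_
    simp
  · rw [Ring.choose_zero_pos ℤ hs, if_neg (by omega), mul_zero, zero_smul, mulEnd_zero, zero_mul]

instance : Ring (PDO 𝕜) :=
  { (inferInstance : AddCommGroup (PDO 𝕜)) with
    mul := (· * ·)
    one := 1
    left_distrib := mul_add'
    right_distrib := add_mul'
    zero_mul := fun A => by
      change mulHom 0 A = 0
      rw [map_zero]; rfl
    mul_zero := fun A => by
      change mulHom A 0 = 0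
      rw [map_zero]
    mul_assoc := fun A B C => gammaSeries_injective (by
      simp only [gammaSeries_mul, mul_assoc])
    one_mul := fun A => gammaSeries_injective (by
      simp only [gammaSeries_mul, gammaSeries_one, one_mul])
    mul_one := fun A => gammaSeries_injective (by
      simp only [gammaSeries_mul, gammaSeries_one, mul_one])
    zsmul := zsmulRec
    neg_add_cancel := neg_add_cancel }

end PDO

end

end DMKP

namespace DMKP

noncomputable section

variable {𝕜 : Type*} [RCLike 𝕜]

open Finset.HasAntidiagonal (antidiagonal mem_antidiagonal)

namespace PDO

/-! ### Calculus of pseudo-difference operators -/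

theorem coeff_mul_eq_sum {A B : PDO 𝕜} {N M : ℤ} (hA : A.OrdLE N) (hB : B.OrdLE M) (m : ℤ) :
    (A * B).coeff m = ∑ p ∈ Finset.Icc (m - M) N ×ˢ Finset.range ((N + M - m).toNat + 1),
      mulTerm A B m p := by
  rw [coeff_mul]
  refine finsum_eq_sum_of_support_subset _ ?_
  rintro ⟨k, i⟩ hp
  have h1 : k ≤ N := by
    by_contra hk
    exact hp (mulTerm_eq_zero (Or.inl (hA k (by omega))))
  have h2 : m - k + i ≤ M := by
    by_contra hk
    exact hp (mulTerm_eq_zero (Or.inr (hB _ (by simpa using hk))))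
  simp only [Finset.coe_product, Finset.coe_Icc, Finset.coe_range, Set.mem_prod, Set.mem_Icc,
    Set.mem_Iio]
  omega

theorem coeff_mul_leading {A B : PDO 𝕜} {N M : ℤ} (hA : A.OrdLE N) (hB : B.OrdLE M) :
    (A * B).coeff (N + M) = A.coeff N * shift N (B.coeff M) := by
  rw [coeff_mul, finsum_eq_single _ ((N, 0) : ℤ × ℕ)]
  · simp [mulTerm]
  · rintro ⟨k, i⟩ hp
    refine mulTerm_eq_zero ?_
    rcases lt_or_ge N k with h | h
    · exact Or.inl (hA k h)
    · refine Or.inr (hB _ ?_)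
      rcases eq_or_ne i 0 with rfl | hi
      · have : k ≠ N := fun h => hp (by rw [h])
        simp only
        omega
      · simp only
        omega

theorem ordLE_Δpow (k : ℤ) : (Δpow k : PDO 𝕜).OrdLE k := ordLE_mono k 1

theorem coeff_mul_Δpow (A : PDO 𝕜) (l m : ℤ) : (A * Δpow l).coeff m = A.coeff (m - l) := by
  rw [coeff_mul, finsum_eq_single _ ((m - l, 0) : ℤ × ℕ)]
  · simp [mulTerm, Δpow]
  · rintro ⟨k, i⟩ hp
    rcases eq_or_ne i 0 with rfl | hi
    · have : k ≠ m - l := fun h => hp (by rw [h])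
      refine mulTerm_eq_zero (Or.inr (coeff_mono_of_ne ?_ 1))
      simp only
      omega
    · rw [mulTerm]
      simp only [Δpow, coeff_mono]
      split_ifs
      · rw [iterate_diff_one hi]; simp
      · rw [diff_iterate_zero]; simp

theorem Δpow_mul_Δpow (k l : ℤ) : (Δpow k * Δpow l : PDO 𝕜) = Δpow (k + l) := by
  ext1; funext m
  rw [coeff_mul_Δpow, Δpow, Δpow, coeff_mono, coeff_mono]
  exact if_congr (by omega) rfl rfl

theorem Δpow_zero : (Δpow 0 : PDO 𝕜) = 1 := rfl

theorem npow_eq_pow (A : PDO 𝕜) (i : ℕ) : A.npow i = A ^ i := by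
  induction i with
  | zero => rfl
  | succ i ih => rw [pow_succ, ← ih]; rfl

theorem coeff_mono_zero_mul (u : Fn 𝕜) (A : PDO 𝕜) (m : ℤ) :
    (mono 0 u * A).coeff m = u * A.coeff m := by
  obtain ⟨M, hM⟩ := A.exists_ordLE
  rw [mono_mul_coeff 0 u hM m ((M - m).toNat + 1) (by push_cast; omega), Finset.sum_range_succ',
    Finset.sum_eq_zero]
  · simp
  · intro i _
    rw [Ring.choose_zero_succ, zero_smul]

theorem mono_eq (k : ℤ) (u : Fn 𝕜) : mono k u = mono 0 u * Δpow k := by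
  ext1; funext m
  rw [coeff_mul_Δpow, coeff_mono, coeff_mono]
  exact if_congr (by omega) rfl rfl

/-- The coefficient of `Δ⁰` of a product, as a sum over the coefficients of the left factor. -/
theorem coeff_zero_mul {A B : PDO 𝕜} {n : ℕ} (hA : A.OrdLE (n - 1)) (hB : B.OrdLE 0) :
    (A * B).coeff 0 = ∑ k ∈ Finset.range n, A.coeff k * (Δpow k * B).coeff 0 := by
  induction n generalizing A with
  | zero => rw [Finset.sum_range_zero]; exact (hA.mul hB) 0 (by simp)
  | succ n ih =>
    have hA' : A.OrdLE n := hA.mono (by simp)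
    have h := ih hA'.sub_mono
    rw [Finset.sum_range_succ, sub_mul, coeff_sub] at *
    rw [mono_eq, mul_assoc, coeff_mono_zero_mul, sub_eq_iff_eq_add] at h
    rw [h]
    congr 1
    refine Finset.sum_congr rfl fun k hk => ?_
    rw [coeff_sub, ← mono_eq, coeff_mono_of_ne, sub_zero]
    have := Finset.mem_range.1 hk
    omega

/-! #### Smooth operators and partial derivatives -/

/-- All coefficients are smooth. -/
def IsSmooth (A : PDO 𝕜) : Prop := ∀ k, Smooth (A.coeff k)

@[simp] theorem coeff_pderiv (i : ℕ+) (A : PDO 𝕜) (k : ℤ) :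
    (A.pderiv i).coeff k = DMKP.pderiv i (A.coeff k) := rfl

theorem OrdLE.pderiv {A : PDO 𝕜} {N : ℤ} (hA : A.OrdLE N) (i : ℕ+) : (A.pderiv i).OrdLE N :=
  fun k hk => by rw [coeff_pderiv, hA k hk, pderiv_zero]

theorem IsSmooth.mono {u : Fn 𝕜} (hu : Smooth u) (k : ℤ) : (PDO.mono k u).IsSmooth := by
  intro j
  rw [coeff_mono]
  split_ifs
  exacts [hu, Smooth.zero]

theorem IsSmooth.Δpow (k : ℤ) : (Δpow k : PDO 𝕜).IsSmooth := IsSmooth.mono Smooth.one k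

theorem IsSmooth.one : (1 : PDO 𝕜).IsSmooth := IsSmooth.Δpow 0

theorem IsSmooth.add {A B : PDO 𝕜} (hA : A.IsSmooth) (hB : B.IsSmooth) : (A + B).IsSmooth :=
  fun k => (hA k).add (hB k)

theorem IsSmooth.sub {A B : PDO 𝕜} (hA : A.IsSmooth) (hB : B.IsSmooth) : (A - B).IsSmooth :=
  fun k => (hA k).sub (hB k)

theorem IsSmooth.pderiv {A : PDO 𝕜} (hA : A.IsSmooth) (i : ℕ+) : (A.pderiv i).IsSmooth :=
  fun k => (hA k).pderiv i

theorem IsSmooth.mulTerm {A B : PDO 𝕜} (hA : A.IsSmooth) (hB : B.IsSmooth) (m : ℤ) (p : ℤ × ℕ) :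
    Smooth (A.mulTerm B m p) :=
  ((hA _).mul (((hB _).iterate_diff _).shift _)).zsmul _

theorem IsSmooth.mul {A B : PDO 𝕜} (hA : A.IsSmooth) (hB : B.IsSmooth) : (A * B).IsSmooth := by
  intro m
  obtain ⟨N, hN⟩ := A.exists_ordLE
  obtain ⟨M, hM⟩ := B.exists_ordLE
  rw [coeff_mul_eq_sum hN hM]
  exact Smooth.sum _ fun p _ => hA.mulTerm hB m p

theorem IsSmooth.pow {A : PDO 𝕜} (hA : A.IsSmooth) (i : ℕ) : (A ^ i).IsSmooth := by
  induction i with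
  | zero => rw [pow_zero]; exact IsSmooth.one
  | succ i ih => rw [pow_succ]; exact ih.mul hA

theorem pderiv_mul {A B : PDO 𝕜} (i : ℕ+) (hA : A.IsSmooth) (hB : B.IsSmooth) :
    (A * B).pderiv i = A.pderiv i * B + A * B.pderiv i := by
  ext1; funext m
  obtain ⟨N, hN⟩ := A.exists_ordLE
  obtain ⟨M, hM⟩ := B.exists_ordLE
  rw [coeff_pderiv, coeff_add, coeff_mul_eq_sum hN hM, coeff_mul_eq_sum (hN.pderiv i) hM,
    coeff_mul_eq_sum hN (hM.pderiv i), pderiv_sum i _ fun p _ => hA.mulTerm hB m p,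
    ← Finset.sum_add_distrib]
  refine Finset.sum_congr rfl fun p _ => ?_
  have h1 := ((hB (m - p.1 + p.2)).iterate_diff p.2).shift (p.1 - p.2)
  rw [mulTerm, mulTerm, mulTerm, pderiv_zsmul i ((hA _).mul h1), DMKP.pderiv_mul i (hA _) h1,
    pderiv_shift, pderiv_iterate_diff i (hB _), smul_add]
  rfl

theorem pderiv_add {A B : PDO 𝕜} (i : ℕ+) (hA : A.IsSmooth) (hB : B.IsSmooth) :
    (A + B).pderiv i = A.pderiv i + B.pderiv i := by
  ext1; funext m
  exact DMKP.pderiv_add i (hA m) (hB m)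

theorem pderiv_sub {A B : PDO 𝕜} (i : ℕ+) (hA : A.IsSmooth) (hB : B.IsSmooth) :
    (A - B).pderiv i = A.pderiv i - B.pderiv i := by
  ext1; funext m
  exact DMKP.pderiv_sub i (hA m) (hB m)

theorem pderiv_comm (i j : ℕ+) {A : PDO 𝕜} (hA : A.IsSmooth) :
    (A.pderiv j).pderiv i = (A.pderiv i).pderiv j := by
  ext1; funext m
  exact DMKP.pderiv_comm i j (hA m)

theorem pderiv_Δpow (i : ℕ+) (k : ℤ) : (Δpow k : PDO 𝕜).pderiv i = 0 := by
  ext1; funext m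
  rw [coeff_pderiv, Δpow, coeff_mono]
  split_ifs
  exacts [pderiv_one i, pderiv_zero i]

theorem pderiv_one (i : ℕ+) : (1 : PDO 𝕜).pderiv i = 0 := pderiv_Δpow i 0

/-! #### The parts with positive and with nonpositive powers -/

theorem coeff_geOne (A : PDO 𝕜) (k : ℤ) : A.geOne.coeff k = if 1 ≤ k then A.coeff k else 0 := rfl

theorem coeff_leZero (A : PDO 𝕜) (k : ℤ) : A.leZero.coeff k = if k ≤ 0 then A.coeff k else 0 := rfl

theorem geOne_add_leZero (A : PDO 𝕜) : A.geOne + A.leZero = A := by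
  ext1; funext k
  rw [coeff_add, coeff_geOne, coeff_leZero]
  by_cases h : 1 ≤ k
  · rw [if_pos h, if_neg (by omega), add_zero]
  · rw [if_neg h, if_pos (by omega), zero_add]

theorem leZero_add (A B : PDO 𝕜) : (A + B).leZero = A.leZero + B.leZero := by
  ext1; funext k
  simp only [coeff_add, coeff_leZero]
  split_ifs <;> simp

theorem leZero_sub (A B : PDO 𝕜) : (A - B).leZero = A.leZero - B.leZero := by
  ext1; funext k
  simp only [coeff_sub, coeff_leZero]
  split_ifs <;> simp

theorem ordLE_leZero (A : PDO 𝕜) : A.leZero.OrdLE 0 := fun k hk => if_neg (by omega)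

theorem OrdLE.leZero_eq {A : PDO 𝕜} (hA : A.OrdLE 0) : A.leZero = A := by
  ext1; funext k
  rw [coeff_leZero]
  split_ifs with h
  · rfl
  · rw [hA k (by omega)]

theorem IsSmooth.leZero {A : PDO 𝕜} (hA : A.IsSmooth) : A.leZero.IsSmooth := by
  intro k
  rw [coeff_leZero]
  split_ifs
  exacts [hA k, Smooth.zero]

theorem pderiv_leZero (i : ℕ+) (A : PDO 𝕜) : A.leZero.pderiv i = (A.pderiv i).leZero := by
  ext1; funext k
  rw [coeff_pderiv, coeff_leZero, coeff_leZero, coeff_pderiv]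
  split_ifs
  exacts [rfl, pderiv_zero i]

/-- Only powers `Δ^k` with `k ≥ 1` occur. -/
def IsPositive (A : PDO 𝕜) : Prop := ∀ k < 1, A.coeff k = 0

theorem isPositive_geOne (A : PDO 𝕜) : A.geOne.IsPositive := fun k hk => if_neg (by omega)

theorem IsPositive.leZero_eq {A : PDO 𝕜} (hA : A.IsPositive) : A.leZero = 0 := by
  ext1; funext k
  rw [coeff_leZero]
  split_ifs with h
  · exact hA k (by omega)
  · rfl

theorem IsPositive.add {A B : PDO 𝕜} (hA : A.IsPositive) (hB : B.IsPositive) :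
    (A + B).IsPositive := fun k hk => by rw [coeff_add, hA k hk, hB k hk, add_zero]

theorem IsPositive.sub {A B : PDO 𝕜} (hA : A.IsPositive) (hB : B.IsPositive) :
    (A - B).IsPositive := fun k hk => by rw [coeff_sub, hA k hk, hB k hk, sub_zero]

theorem IsPositive.pderiv {A : PDO 𝕜} (hA : A.IsPositive) (i : ℕ+) : (A.pderiv i).IsPositive :=
  fun k hk => by rw [coeff_pderiv, hA k hk, pderiv_zero]

/-- A term `Δ^k ∘ g Δ^l` with `k, l ≥ 1` can reach a power below 1 only through a Leibniz index `i >
k`, where the binomial coefficient of the nonnegative integer `k` vanishes. -/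
theorem IsPositive.mul {A B : PDO 𝕜} (hA : A.IsPositive) (hB : B.IsPositive) :
    (A * B).IsPositive := by
  intro m hm
  rw [coeff_mul, ← finsum_zero (α := ℤ × ℕ)]
  refine finsum_congr fun p => ?_
  obtain ⟨k, i⟩ := p
  rcases lt_or_ge k 1 with h | h
  · exact mulTerm_eq_zero (Or.inl (hA k h))
  rcases lt_or_ge (m - k + i) 1 with h' | h'
  · exact mulTerm_eq_zero (Or.inr (hB _ h'))
  obtain ⟨d, rfl⟩ := Int.eq_ofNat_of_zero_le (by omega : 0 ≤ k)
  rw [mulTerm]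
  simp only
  have h2 : Ring.choose (d : ℤ) i = 0 := by
    rw [Ring.choose_natCast, Nat.choose_eq_zero_of_lt (by omega), Nat.cast_zero]
  rw [h2, zero_smul]

/-! #### Constructing operators coefficient by coefficient -/

/-- Successive approximation. Passing from stage `k` to stage `k + 1` changes only the coefficient
of `Δ^{-k-1}`, so the coefficient of `Δ^m` is final from stage `(-m).toNat` on and can be read off
there. -/
theorem exists_limit (P : ℕ → PDO 𝕜 → Prop) {Z₀ : PDO 𝕜} (h0 : P 0 Z₀)
    (hstep : ∀ k Z, P k Z → ∃ z, P (k + 1) (Z + mono (-k - 1) z)) :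
    ∃ Z : PDO 𝕜, ∀ k : ℕ, ∃ Z', P k Z' ∧ (Z - Z').OrdLE (-k - 1) := by
  choose! z hz using hstep
  let W : ℕ → PDO 𝕜 := fun k => Nat.rec Z₀ (fun k Z => Z + mono (-k - 1) (z k Z)) k
  have hW : ∀ k, P k (W k) := by
    intro k
    induction k with
    | zero => exact h0
    | succ k ih => exact hz k _ ih
  have hd : ∀ k d, (W (k + d) - W k).OrdLE (-k - 1) := by
    intro k d
    induction d with
    | zero => intro m _; simp
    | succ d ih =>
      have : W (k + (d + 1)) - W k = (W (k + d) - W k) +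
          mono (-((k + d : ℕ) : ℤ) - 1) (z (k + d) (W (k + d))) := by
        change W (k + d) + mono (-((k + d : ℕ) : ℤ) - 1) (z (k + d) (W (k + d))) - W k = _
        abel
      rw [this]
      exact ih.add ((ordLE_mono _ _).mono (by push_cast; omega))
  obtain ⟨N, hN⟩ := Z₀.exists_ordLE
  refine ⟨⟨fun m => (W (-m).toNat).coeff m, ⟨max 0 N, fun m hm => ?_⟩⟩, fun k => ⟨W k, hW k, ?_⟩⟩
  · rw [Int.toNat_of_nonpos (by omega)]
    exact hN m (by omega)
  · intro m hm
    obtain ⟨d, hd'⟩ := Nat.exists_eq_add_of_le (show (-m).toNat ≤ k by omega)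
    have := hd (-m).toNat d m (by omega)
    rw [← hd', coeff_sub, sub_eq_zero] at this
    rw [coeff_sub, sub_eq_zero]
    exact this.symm

theorem exists_right_inverse {Z : PDO 𝕜} (hZ : Z.OrdLE 0) (h0 : NowhereZero (Z.coeff 0)) :
    ∃ Y : PDO 𝕜, Y.OrdLE 0 ∧ Y.coeff 0 = (Z.coeff 0)⁻¹ ∧ Z * Y = 1 := by
  have hinv : ∀ r : Fn 𝕜, Z.coeff 0 * ((Z.coeff 0)⁻¹ * r) = r := by
    intro r; funext n t
    simp [h0 n t]
  obtain ⟨Y, hY⟩ := exists_limit (Z₀ := mono 0 (Z.coeff 0)⁻¹)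
    (fun k Y => Y.OrdLE 0 ∧ Y.coeff 0 = (Z.coeff 0)⁻¹ ∧ (Z * Y - 1).OrdLE (-k - 1))
    (by
      refine ⟨ordLE_mono _ _, coeff_mono_self _ _, fun m hm => ?_⟩
      rcases eq_or_ne m 0 with rfl | h
      · have := coeff_mul_leading hZ (ordLE_mono 0 (Z.coeff 0)⁻¹)
        rw [add_zero] at this
        rw [coeff_sub, this, coeff_mono_self, shift_zero, one_def, coeff_mono_self]
        simpa [sub_eq_zero] using hinv 1
      · exact ((hZ.mul (ordLE_mono 0 (Z.coeff 0)⁻¹)).sub ((ordLE_mono 0 1).mono (by simp))) m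
          (by simp at hm ⊢; omega))
    (by
      rintro k Y ⟨h1, h2, h3⟩
      -- The top coefficient of `Z` times a monomial `y Δ^{-k-1}` is `z₀ y`; this `y` cancels the
      -- remaining error at that order.
      refine ⟨(Z.coeff 0)⁻¹ * -(Z * Y - 1).coeff (-k - 1),
        h1.add ((ordLE_mono _ _).mono (by omega)), ?_, fun m hm => ?_⟩
      · rw [coeff_add, coeff_mono_of_ne (by omega), add_zero, h2]
      · rw [mul_add, add_sub_right_comm, coeff_add]
        rcases eq_or_ne m (-k - 1) with rfl | h
        · have := coeff_mul_leading hZ (ordLE_mono (-(k : ℤ) - 1)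
            ((Z.coeff 0)⁻¹ * -(Z * Y - 1).coeff (-k - 1)))
          rw [zero_add, coeff_mono_self, shift_zero, hinv] at this
          rw [this, add_neg_cancel]
        · rw [h3 m (by push_cast at hm; omega), (hZ.mul (ordLE_mono _ _)) m
            (by push_cast at hm; omega), add_zero])
  have hle : Y.OrdLE 0 := by
    obtain ⟨Y', h1, h2⟩ := hY 0
    simpa using h1.1.add (h2.mono (by simp))
  refine ⟨Y, hle, ?_, ?_⟩
  · obtain ⟨Y', h1, h2⟩ := hY 0
    rw [← h1.2.1, ← sub_eq_zero, ← coeff_sub]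
    exact h2 0 (by simp)
  · rw [← sub_eq_zero]
    refine eq_zero_of_ordLE fun N => ?_
    obtain ⟨Y', h1, h2⟩ := hY (-N).toNat
    have := (hZ.mul h2).add (h1.2.2.mono (by simp))
    rw [show Z * (Y - Y') + (Z * Y' - 1) = Z * Y - 1 by noncomm_ring] at this
    exact this.mono (by omega)

theorem exists_inverse {Z : PDO 𝕜} (hZ : Z.OrdLE 0) (h0 : NowhereZero (Z.coeff 0)) :
    ∃ Y : PDO 𝕜, Y.OrdLE 0 ∧ Z * Y = 1 ∧ Y * Z = 1 := by
  obtain ⟨Y, h1, h2, h3⟩ := exists_right_inverse hZ h0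
  -- A right inverse `X` of the right inverse `Y` must equal `Z`, so `Y` is a two-sided inverse.
  obtain ⟨X, _, _, h6⟩ := exists_right_inverse h1 fun n t => by
    rw [h2]; exact inv_ne_zero (h0 n t)
  refine ⟨Y, h1, h3, ?_⟩
  have : Z = X := by rw [← mul_one Z, ← h6, ← mul_assoc, h3, one_mul]
  rw [this, h6]

/-- An inverse of an operator of order zero has order zero. -/
theorem ordLE_inverse {Z Y : PDO 𝕜} (hZ : Z.OrdLE 0) (h0 : NowhereZero (Z.coeff 0))
    (hYZ : Y * Z = 1) : Y.OrdLE 0 := by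
  obtain ⟨X, h1, h2, _⟩ := exists_inverse hZ h0
  have : Y = X := by rw [← mul_one Y, ← h2, ← mul_assoc, hYZ, one_mul]
  rwa [this]

end PDO

end

end DMKP

namespace DMKP

noncomputable section

variable {𝕜 : Type*} [RCLike 𝕜]

open Finset.HasAntidiagonal (antidiagonal mem_antidiagonal)

/-! ### First-order equations in `n` and `t` -/

theorem eq_zero_of_step {f : Fn 𝕜} (h0 : f 0 = 0) (h1 : ∀ n, f n = 0 → f (n + 1) = 0)
    (h2 : ∀ n, f (n + 1) = 0 → f n = 0) : f = 0 := by
  funext n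
  induction n using Int.induction_on with
  | zero => exact h0
  | succ n ih => exact h1 _ ih
  | pred n ih => exact h2 _ (by rwa [sub_add_cancel])

/-- The solution `c` of `Δ c = e` with `c(0) = 0`. -/
def indefSum (e : Fn 𝕜) : Fn 𝕜
  | .ofNat n => ∑ m ∈ Finset.range n, e m
  | .negSucc n => -∑ m ∈ Finset.range (n + 1), e (-m - 1)

theorem indefSum_zero (e : Fn 𝕜) : indefSum e 0 = 0 := Finset.sum_range_zero _

theorem diff_indefSum (e : Fn 𝕜) : diff (indefSum e) = e := by
  funext n
  rcases n with n | n
  · change ∑ m ∈ Finset.range (n + 1), e m - ∑ m ∈ Finset.range n, e m = e n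
    rw [Finset.sum_range_succ]; abel
  · rcases n with _ | n
    · change indefSum e 0 - -∑ m ∈ Finset.range 1, e (-m - 1) = e (-1)
      simp [indefSum_zero]
    · change -∑ m ∈ Finset.range (n + 1), e (-m - 1) - -∑ m ∈ Finset.range (n + 1 + 1), e (-m - 1)
        = e (Int.negSucc (n + 1))
      rw [Finset.sum_range_succ _ (n + 1)]
      have : -((n + 1 : ℕ) : ℤ) - 1 = Int.negSucc (n + 1) := by rw [Int.negSucc_eq]; ring
      rw [this]; abel

theorem Smooth.indefSum {e : Fn 𝕜} (he : Smooth e) : Smooth (indefSum e) := by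
  rintro (n | n) t S
  · have := ContDiff.sum (s := Finset.range n) fun m _ => he m t S
    refine (congrArg (ContDiff ℝ ∞) (funext fun s => ?_)).mp this
    exact (Finset.sum_apply _ _ _).symm
  · have := (ContDiff.sum (s := Finset.range (n + 1)) fun m _ => he (-m - 1) t S).neg
    refine (congrArg (ContDiff ℝ ∞) (funext fun s => ?_)).mp this
    exact congrArg Neg.neg (Finset.sum_apply _ _ _).symm

theorem pderiv_indefSum (i : ℕ+) {e : Fn 𝕜} (he : Smooth e) (h : pderiv i e = 0) :
    pderiv i (indefSum e) = 0 := by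
  have h1 : ∀ n, pderiv i (indefSum e) (n + 1) = pderiv i (indefSum e) n := by
    intro n
    have := pderiv_diff i he.indefSum
    rw [diff_indefSum, h] at this
    exact sub_eq_zero.1 (congrFun this n).symm
  refine eq_zero_of_step ?_ (fun n hn => by rw [h1, hn]) fun n hn => by rw [← h1, hn]
  funext t
  simp [pderiv, indefSum_zero]

/-- A closed family `(ρ₀, ρ)` with respect to `Δ` and the `∂/∂tᵢ` has a primitive. -/
theorem exists_primitive {ρ₀ : Fn 𝕜} {ρ : ℕ+ → Fn 𝕜} (h0 : Smooth ρ₀) (h : ∀ i, Smooth (ρ i))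
    (hd : ∀ i, diff (ρ i) = pderiv i ρ₀) (hc : ∀ i j, pderiv i (ρ j) = pderiv j (ρ i)) :
    ∃ y : Fn 𝕜, Smooth y ∧ diff y = ρ₀ ∧ ∀ i, pderiv i y = ρ i := by
  obtain ⟨θ, hθ, hθd⟩ := exists_potential h hc
  have he : Smooth (ρ₀ - diff θ) := h0.sub hθ.diff
  -- The potential in `t` need not have the right difference in `n`; the discrepancy `ρ₀ - Δθ` has
  -- vanishing `t`-derivatives by `hd`, so summing it in `n` does not disturb the equations in `t`.
  refine ⟨θ + indefSum (ρ₀ - diff θ), hθ.add he.indefSum, ?_, fun i => ?_⟩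
  · have : diff (θ + indefSum (ρ₀ - diff θ)) = diff θ + diff (indefSum (ρ₀ - diff θ)) := by
      rw [← diffEnd_apply, map_add]; rfl
    rw [this, diff_indefSum, add_sub_cancel]
  · rw [pderiv_add i hθ he.indefSum, hθd, pderiv_indefSum i he, add_zero]
    rw [pderiv_sub i h0 hθ.diff, pderiv_diff i hθ, hθd, hd, sub_self]

/-- The solution `c` of `c(n + 1) = q(n) c(n)` with `c(0) = 1`. -/
def indefProd (q : Fn 𝕜) : Fn 𝕜
  | .ofNat n => ∏ m ∈ Finset.range n, q m
  | .negSucc n => (∏ m ∈ Finset.range (n + 1), q (-m - 1))⁻¹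

theorem indefProd_zero (q : Fn 𝕜) : indefProd q 0 = 1 := Finset.prod_range_zero _

theorem indefProd_succ {q : Fn 𝕜} (hq : NowhereZero q) (n : ℤ) :
    indefProd q (n + 1) = indefProd q n * q n := by
  rcases n with n | n
  · exact Finset.prod_range_succ _ _
  · rcases n with _ | n
    · change indefProd q 0 = (∏ m ∈ Finset.range 1, q (-m - 1))⁻¹ * q (-1)
      funext t
      simp [indefProd_zero, hq (-1) t]
    · change (∏ m ∈ Finset.range (n + 1), q (-m - 1))⁻¹ =
        (∏ m ∈ Finset.range (n + 1 + 1), q (-m - 1))⁻¹ * q (Int.negSucc (n + 1))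
      rw [Finset.prod_range_succ _ (n + 1)]
      have : -((n + 1 : ℕ) : ℤ) - 1 = Int.negSucc (n + 1) := by rw [Int.negSucc_eq]; ring
      rw [this, mul_inv]
      funext t
      simp [hq (Int.negSucc (n + 1)) t]

theorem shift_indefProd {q : Fn 𝕜} (hq : NowhereZero q) :
    shift 1 (indefProd q) = indefProd q * q :=
  funext fun n => indefProd_succ hq n

theorem NowhereZero.indefProd {q : Fn 𝕜} (hq : NowhereZero q) : NowhereZero (indefProd q) := by
  rintro (n | n) t
  · change (∏ m ∈ Finset.range n, q m) t ≠ 0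
    rw [Finset.prod_apply]
    exact Finset.prod_ne_zero_iff.2 fun m _ => hq m t
  · change (∏ m ∈ Finset.range (n + 1), q (-m - 1))⁻¹ t ≠ 0
    rw [Pi.inv_apply, Finset.prod_apply]
    exact inv_ne_zero (Finset.prod_ne_zero_iff.2 fun m _ => hq _ t)

theorem Smooth.indefProd {q : Fn 𝕜} (hs : Smooth q) (hq : NowhereZero q) :
    Smooth (indefProd q) := by
  rintro (n | n) t S
  · have := contDiff_prod (t := Finset.range n) fun m _ => hs m t S
    refine (congrArg (ContDiff ℝ ∞) (funext fun s => ?_)).mp this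
    exact (Finset.prod_apply _ _ _).symm
  · have := (contDiff_prod (t := Finset.range (n + 1)) fun m _ => hs (-m - 1) t S).inv
      fun s => Finset.prod_ne_zero_iff.2 fun m _ => hq _ _
    refine (congrArg (ContDiff ℝ ∞) (funext fun s => ?_)).mp this
    exact congrArg Inv.inv (Finset.prod_apply _ _ _).symm

theorem pderiv_indefProd (i : ℕ+) {q : Fn 𝕜} (hs : Smooth q) (hq : NowhereZero q)
    (h : pderiv i q = 0) : pderiv i (indefProd q) = 0 := by
  have h1 : ∀ n, pderiv i (indefProd q) (n + 1) = pderiv i (indefProd q) n * q n := by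
    intro n
    have := pderiv_mul i (hs.indefProd hq) hs
    rw [← shift_indefProd hq, h, mul_zero, add_zero] at this
    exact congrFun this n
  refine eq_zero_of_step ?_ (fun n hn => by rw [h1, hn, zero_mul]) fun n hn => ?_
  · funext t
    simp [pderiv, indefProd_zero]
  · funext t
    have := congrFun ((h1 n).symm.trans hn) t
    exact (mul_eq_zero.1 this).resolve_right (hq n t)

theorem NowhereZero.mul_inv_cancel {f : Fn 𝕜} (hf : NowhereZero f) : f * f⁻¹ = 1 := by
  funext n t
  simp [hf n t]

theorem NowhereZero.mul_left_cancel {f g h : Fn 𝕜} (hf : NowhereZero f) (e : f * g = f * h) :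
    g = h := by
  funext n t
  exact mul_left_cancel₀ (hf n t) (congrFun (congrFun e n) t)

theorem NowhereZero.exp (f : Fn 𝕜) : NowhereZero fun n t => NormedSpace.exp (f n t) :=
  fun n t => (NormedSpace.isUnit_exp (f n t)).ne_zero

/-- A nowhere vanishing solution of `u z(n + 1) = z(n)`, `∂z/∂tᵢ = -aᵢ z`. -/
theorem exists_leading {u : Fn 𝕜} {a : ℕ+ → Fn 𝕜} (hu : Smooth u) (hu0 : NowhereZero u)
    (ha : ∀ i, Smooth (a i)) (hua : ∀ i, pderiv i u = u * diff (a i))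
    (hc : ∀ i j, pderiv i (a j) = pderiv j (a i)) :
    ∃ z : Fn 𝕜, Smooth z ∧ NowhereZero z ∧ u * shift 1 z = z ∧ ∀ i, pderiv i z = -(a i * z) := by
  obtain ⟨s, hs, hsd⟩ := exists_potential (η := fun i => -a i) (fun i => (ha i).neg)
    fun i j => by rw [pderiv_neg, pderiv_neg, hc]
  set E : Fn 𝕜 := fun n t => NormedSpace.exp (s n t) with hE
  have hEs : Smooth E := hs.exp
  have hE0 : NowhereZero E := NowhereZero.exp s
  have hEd : ∀ i, pderiv i E = -(a i * E) := by
    intro i; rw [hE, pderiv_exp i hs, hsd, neg_mul]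
  -- The relation between `∂u/∂tᵢ` and `Δ aᵢ` makes `u ΓE` satisfy the same equations in `t` as `E`.
  -- Their quotient `q` therefore has vanishing `t`-derivatives, and multiplying `E` by a solution
  -- of `c(n+1) = q c(n)` repairs the equation in `n`.
  set w : Fn 𝕜 := u * shift 1 E
  have hws : Smooth w := hu.mul (hEs.shift 1)
  have hw0 : NowhereZero w := fun n t => mul_ne_zero (hu0 n t) (hE0 (n + 1) t)
  have hwd : ∀ i, pderiv i w = -(a i * w) := by
    intro i
    rw [pderiv_mul i hu (hEs.shift 1), hua, pderiv_shift, hEd]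
    change u * (shift 1 (a i) - a i) * shift 1 E + u * (-(shift 1 (a i) * shift 1 E)) =
      -(a i * (u * shift 1 E))
    ring
  set q : Fn 𝕜 := E * w⁻¹
  have hqs : Smooth q := hEs.mul (hws.inv hw0)
  have hq0 : NowhereZero q := fun n t => mul_ne_zero (hE0 n t) (inv_ne_zero (hw0 n t))
  have hqw : w * q = E := by
    rw [mul_left_comm, hw0.mul_inv_cancel, mul_one]
  have hqd : ∀ i, pderiv i q = 0 := by
    intro i
    have h := pderiv_mul i hws hqs
    rw [hqw, hEd, hwd, ← hqw] at h
    refine hw0.mul_left_cancel ?_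
    linear_combination -h
  refine ⟨E * indefProd q, hEs.mul (hqs.indefProd hq0),
    fun n t => mul_ne_zero (hE0 n t) (hq0.indefProd n t), ?_, fun i => ?_⟩
  · rw [shift_mul, shift_indefProd hq0, ← mul_assoc]
    change w * _ = _
    linear_combination indefProd q * hqw
  · rw [pderiv_mul i hEs (hqs.indefProd hq0), pderiv_indefProd i hqs hq0 (hqd i), hEd]
    ring

/-- Solvability of the inhomogeneous equations `u z(n + 1) - z(n) = r₀`, `∂z/∂tᵢ + aᵢ z = rᵢ`. -/
theorem exists_inhomogeneous {u z₀ r₀ : Fn 𝕜} {a r : ℕ+ → Fn 𝕜} (hz : Smooth z₀)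
    (hz0 : NowhereZero z₀) (hzu : u * shift 1 z₀ = z₀)
    (hzd : ∀ i, pderiv i z₀ = -(a i * z₀)) (hr0 : Smooth r₀) (hr : ∀ i, Smooth (r i))
    (h0 : ∀ i, u * shift 1 (r i) - r i = pderiv i r₀ + a i * r₀)
    (hc : ∀ i j, pderiv i (r j) + a i * r j = pderiv j (r i) + a j * r i) :
    ∃ z : Fn 𝕜, Smooth z ∧ u * shift 1 z - z = r₀ ∧ ∀ i, pderiv i z + a i * z = r i := by
  -- Variation of constants: with `z = z₀ y` the scalar operators become `z₀ Δ` and `z₀ ∂/∂tᵢ`, and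
  -- the compatibility conditions become closedness.
  have hfac : ∀ r, Smooth r → ∃ ρ, Smooth ρ ∧ r = z₀ * ρ := fun r hr =>
    ⟨z₀⁻¹ * r, (hz.inv hz0).mul hr, by rw [← mul_assoc, hz0.mul_inv_cancel, one_mul]⟩
  have hℓ : ∀ ρ, Smooth ρ → ∀ i, pderiv i (z₀ * ρ) + a i * (z₀ * ρ) = z₀ * pderiv i ρ := by
    intro ρ hρ i
    rw [pderiv_mul i hz hρ, hzd]; ring
  have hℓ0 : ∀ ρ, u * shift 1 (z₀ * ρ) - z₀ * ρ = z₀ * diff ρ := by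
    intro ρ
    rw [shift_mul, diff]
    linear_combination shift 1 ρ * hzu
  obtain ⟨ρ₀, hρ0, rfl⟩ := hfac r₀ hr0
  choose ρ hρ hrρ using fun i => hfac (r i) (hr i)
  obtain rfl : r = fun i => z₀ * ρ i := funext hrρ
  obtain ⟨y, hy, hy0, hyd⟩ := exists_primitive hρ0 hρ
    (fun i => hz0.mul_left_cancel (by rw [← hℓ0, h0, hℓ _ hρ0]))
    (fun i j => hz0.mul_left_cancel (by rw [← hℓ _ (hρ j), hc, hℓ _ (hρ i)]))
  exact ⟨z₀ * y, hz.mul hy, by rw [hℓ0, hy0], fun i => by rw [hℓ _ hy, hyd]⟩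

/-! ### Existence of a dressing operator -/

namespace IsSolution

open PDO

variable {L : PDO 𝕜}

theorem isSmooth (hL : IsSolution L) : L.IsSmooth := hL.smooth

theorem ordLE (hL : IsSolution L) : L.OrdLE 1 := hL.order_le

theorem pderiv_eq (hL : IsSolution L) (i : ℕ+) :
    L.pderiv i = (L ^ (i : ℕ)).geOne * L - L * (L ^ (i : ℕ)).geOne := by
  rw [hL.lax, PDO.npow_eq_pow]; rfl

theorem pderiv_pow (hL : IsSolution L) (i : ℕ+) (j : ℕ) :
    (L ^ j).pderiv i = (L ^ (i : ℕ)).geOne * L ^ j - L ^ j * (L ^ (i : ℕ)).geOne := by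
  induction j with
  | zero => rw [pow_zero, PDO.pderiv_one]; simp
  | succ j ih =>
    rw [pow_succ, PDO.pderiv_mul i (hL.isSmooth.pow j) hL.isSmooth, ih, hL.pderiv_eq]
    noncomm_ring

/-- The powers of `L` commute, so the positive part in the commutator may be replaced by minus the
nonpositive part. -/
theorem pderiv_pow' (hL : IsSolution L) (i : ℕ+) (j : ℕ) :
    (L ^ j).pderiv i = L ^ j * (L ^ (i : ℕ)).leZero - (L ^ (i : ℕ)).leZero * L ^ j := by
  rw [hL.pderiv_pow]
  have h := geOne_add_leZero (L ^ (i : ℕ))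
  rw [← eq_sub_iff_add_eq] at h
  rw [h, sub_mul, mul_sub, ← pow_add, ← pow_add, add_comm]
  abel

/-- Zero curvature. With `L^i = Bᵢ + Cᵢ`, where `Bᵢ` is the positive part, `[Bᵢ, L^j] - [Bⱼ, L^i] =
[Bᵢ, Bⱼ] + [Cⱼ, Cᵢ] + [L^i, L^j]`. The last term is zero, the first has only positive powers, and
the second has order at most 0, so projecting leaves exactly the second. -/
theorem pderiv_leZero_sub (hL : IsSolution L) (i j : ℕ+) :
    (L ^ (j : ℕ)).leZero.pderiv i - (L ^ (i : ℕ)).leZero.pderiv j =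
      (L ^ (j : ℕ)).leZero * (L ^ (i : ℕ)).leZero -
        (L ^ (i : ℕ)).leZero * (L ^ (j : ℕ)).leZero := by
  rw [pderiv_leZero, pderiv_leZero, ← leZero_sub, hL.pderiv_pow, hL.pderiv_pow]
  have hi := geOne_add_leZero (L ^ (i : ℕ))
  have hj := geOne_add_leZero (L ^ (j : ℕ))
  have hcomm : L ^ (i : ℕ) * L ^ (j : ℕ) - L ^ (j : ℕ) * L ^ (i : ℕ) = 0 := by
    rw [← pow_add, ← pow_add, add_comm, sub_self]
  have pi := isPositive_geOne (L ^ (i : ℕ))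
  have pj := isPositive_geOne (L ^ (j : ℕ))
  have oi := ordLE_leZero (L ^ (i : ℕ))
  have oj := ordLE_leZero (L ^ (j : ℕ))
  generalize (L ^ (i : ℕ)).geOne = Bi at *
  generalize (L ^ (j : ℕ)).geOne = Bj at *
  generalize (L ^ (i : ℕ)).leZero = Ci at *
  generalize (L ^ (j : ℕ)).leZero = Cj at *
  rw [← hi, ← hj] at hcomm ⊢
  have e : Bi * (Bj + Cj) - (Bj + Cj) * Bi - (Bj * (Bi + Ci) - (Bi + Ci) * Bj) =
      (Bi * Bj - Bj * Bi) + (Cj * Ci - Ci * Cj) +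
        ((Bi + Ci) * (Bj + Cj) - (Bj + Cj) * (Bi + Ci)) := by noncomm_ring
  rw [e, hcomm, add_zero, leZero_add, ((pi.mul pj).sub (pj.mul pi)).leZero_eq, zero_add,
    OrdLE.leZero_eq]
  simpa using (oj.mul oi).sub (oi.mul oj)

end IsSolution

/-! ### The defects of the two dressing equations. -/

namespace PDO

/-- The failure of `L Z = Z Δ`. -/
def dressDefect (L Z : PDO 𝕜) : PDO 𝕜 := L * Z - Z * Δpow 1

/-- The failure of `∂Z/∂tᵢ = -(L^i)_{≤0} Z`. -/
def satoDefect (L : PDO 𝕜) (i : ℕ+) (Z : PDO 𝕜) : PDO 𝕜 :=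
  Z.pderiv i + (L ^ (i : ℕ)).leZero * Z

theorem IsSmooth.dressDefect {L Z : PDO 𝕜} (hL : L.IsSmooth) (hZ : Z.IsSmooth) :
    (dressDefect L Z).IsSmooth := (hL.mul hZ).sub (hZ.mul (IsSmooth.Δpow 1))

theorem IsSmooth.satoDefect {L Z : PDO 𝕜} (hL : L.IsSmooth) (hZ : Z.IsSmooth) (i : ℕ+) :
    (satoDefect L i Z).IsSmooth := (hZ.pderiv i).add ((hL.pow i).leZero.mul hZ)

theorem dressDefect_add (L Z W : PDO 𝕜) :
    dressDefect L (Z + W) = dressDefect L Z + dressDefect L W := by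
  simp only [dressDefect]; noncomm_ring

theorem satoDefect_add (L : PDO 𝕜) (i : ℕ+) {Z W : PDO 𝕜} (hZ : Z.IsSmooth) (hW : W.IsSmooth) :
    satoDefect L i (Z + W) = satoDefect L i Z + satoDefect L i W := by
  simp only [satoDefect]; rw [pderiv_add i hZ hW]; noncomm_ring

theorem OrdLE.dressDefect {L Z : PDO 𝕜} {N : ℤ} (hL : L.OrdLE 1) (hZ : Z.OrdLE N) :
    (dressDefect L Z).OrdLE (N + 1) := by
  have h := hL.mul hZ
  rw [add_comm] at h
  exact h.sub (hZ.mul (ordLE_Δpow 1))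

theorem OrdLE.satoDefect {Z : PDO 𝕜} {N : ℤ} (hZ : Z.OrdLE N) (L : PDO 𝕜) (i : ℕ+) :
    (satoDefect L i Z).OrdLE N := by
  have h := (ordLE_leZero (L ^ (i : ℕ))).mul hZ
  rw [zero_add] at h
  exact (hZ.pderiv i).add h

theorem coeff_dressDefect {L Z : PDO 𝕜} {N M : ℤ} (hL : L.OrdLE 1) (hZ : Z.OrdLE N)
    (hM : M = N + 1) :
    (dressDefect L Z).coeff M = L.coeff 1 * shift 1 (Z.coeff N) - Z.coeff N := by
  subst hM
  rw [dressDefect, coeff_sub, coeff_mul_Δpow, add_comm, coeff_mul_leading hL hZ,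
    add_sub_cancel_left]

theorem coeff_satoDefect {Z : PDO 𝕜} {N : ℤ} (hZ : Z.OrdLE N) (L : PDO 𝕜) (i : ℕ+) :
    (satoDefect L i Z).coeff N =
      DMKP.pderiv i (Z.coeff N) + (L ^ (i : ℕ)).coeff 0 * Z.coeff N := by
  have h := coeff_mul_leading (ordLE_leZero (L ^ (i : ℕ))) hZ
  rw [zero_add, shift_zero, coeff_leZero, if_pos le_rfl] at h
  rw [satoDefect, coeff_add, h, coeff_pderiv]

/-- The Lax equation in the form `∂L/∂tᵢ = [L, (L^i)_{≤0}]` says that `∂/∂tᵢ + (L^i)_{≤0}` commutes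
with left multiplication by `L`; right multiplication by `Δ` commutes with everything involved. -/
theorem satoDefect_dressDefect {L Z : PDO 𝕜} (hL : IsSolution L) (hZ : Z.IsSmooth) (i : ℕ+) :
    satoDefect L i (dressDefect L Z) = dressDefect L (satoDefect L i Z) := by
  have h := hL.pderiv_pow' i 1
  rw [pow_one] at h
  simp only [satoDefect, dressDefect]
  rw [pderiv_sub i (hL.isSmooth.mul hZ) (hZ.mul (IsSmooth.Δpow 1)), pderiv_mul i hL.isSmooth hZ,
    pderiv_mul i hZ (IsSmooth.Δpow 1), pderiv_Δpow, h]
  noncomm_ring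

theorem satoDefect_comm {L Z : PDO 𝕜} (hL : IsSolution L) (hZ : Z.IsSmooth) (i j : ℕ+) :
    satoDefect L i (satoDefect L j Z) = satoDefect L j (satoDefect L i Z) := by
  have h := hL.pderiv_leZero_sub i j
  rw [sub_eq_iff_eq_add] at h
  have hs := fun i : ℕ+ => (hL.isSmooth.pow i).leZero
  simp only [satoDefect]
  rw [pderiv_add i (hZ.pderiv j) ((hs j).mul hZ), pderiv_add j (hZ.pderiv i) ((hs i).mul hZ),
    pderiv_mul i (hs j) hZ, pderiv_mul j (hs i) hZ, h, pderiv_comm i j hZ]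
  noncomm_ring

end PDO

open PDO

/-- The hypotheses of `exists_leading` are top coefficients: order 1 of the Lax equation gives the
derivatives of `u`, and order 0 of the zero-curvature equation gives closedness, since the
commutator of two functions vanishes. -/
theorem exists_dressing_leading {L : PDO 𝕜} (hL : IsSolution L) :
    ∃ z : Fn 𝕜, Smooth z ∧ NowhereZero z ∧ L.coeff 1 * shift 1 z = z ∧
      ∀ i : ℕ+, pderiv i z = -((L ^ (i : ℕ)).coeff 0 * z) := by
  refine exists_leading (hL.smooth 1) hL.leading (fun i => hL.isSmooth.pow i 0) (fun i => ?_)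
    fun i j => ?_
  · have h := congrArg (fun A => A.coeff 1) (hL.pderiv_pow' i 1)
    simp only [pow_one, coeff_pderiv, coeff_sub] at h
    have h1 := coeff_mul_leading hL.ordLE (ordLE_leZero (L ^ (i : ℕ)))
    have h2 := coeff_mul_leading (ordLE_leZero (L ^ (i : ℕ))) hL.ordLE
    rw [add_zero] at h1
    rw [zero_add, shift_zero] at h2
    rw [h, h1, h2, coeff_leZero, if_pos le_rfl, diff]
    ring
  · have h := congrArg (fun A => A.coeff 0) (hL.pderiv_leZero_sub i j)
    have h1 := coeff_mul_leading (ordLE_leZero (L ^ (i : ℕ))) (ordLE_leZero (L ^ (j : ℕ)))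
    have h2 := coeff_mul_leading (ordLE_leZero (L ^ (j : ℕ))) (ordLE_leZero (L ^ (i : ℕ)))
    rw [add_zero, shift_zero] at h1 h2
    simp only [coeff_sub, coeff_pderiv, h1, h2, coeff_leZero, if_pos (le_refl (0 : ℤ))] at h
    rw [mul_comm, sub_self, sub_eq_zero] at h
    exact h

theorem OrdLE.of_coeff_eq_zero {A : PDO 𝕜} {N : ℤ} (h : A.OrdLE N) (h0 : A.coeff N = 0) :
    A.OrdLE (N - 1) := by
  intro k hk
  rcases eq_or_ne k N with rfl | hn
  · exact h0
  · exact h k (by omega)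

theorem exists_dressing {L : PDO 𝕜} (hL : IsSolution L) : ∃ Z Y : PDO 𝕜, IsDressing L Z Y := by
  obtain ⟨z₀, hz, hz0, hzu, hzd⟩ := exists_dressing_leading hL
  have hLs := hL.isSmooth
  -- The two error bounds differ by one because `dressDefect` raises the order by one. A new
  -- coefficient at `Δ^{-k-1}` thus acts on both top errors, at `-k` and at `-k-1`.
  obtain ⟨Z, hZ⟩ := exists_limit (Z₀ := mono 0 z₀)
    (fun k Z => Z.IsSmooth ∧ Z.OrdLE 0 ∧ Z.coeff 0 = z₀ ∧ (dressDefect L Z).OrdLE (-k) ∧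
      ∀ i, (satoDefect L i Z).OrdLE (-k - 1))
    (by
      have ho := ordLE_mono 0 z₀
      refine ⟨IsSmooth.mono hz 0, ho, coeff_mono_self _ _, ?_, fun i => ?_⟩
      · have := OrdLE.of_coeff_eq_zero (hL.ordLE.dressDefect ho)
          (by rw [coeff_dressDefect hL.ordLE ho rfl, coeff_mono_self, hzu, sub_self])
        simpa using this
      · have := OrdLE.of_coeff_eq_zero (ho.satoDefect L i)
          (by rw [coeff_satoDefect ho, coeff_mono_self, hzd]; ring)
        simpa using this)
    (by
      rintro k Z ⟨hs, ho, hc, hd, hst⟩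
      have hds := hLs.dressDefect hs
      have hss := hLs.satoDefect hs
      obtain ⟨z, hzs, hzr, hzi⟩ := exists_inhomogeneous (u := L.coeff 1)
        (a := fun i => (L ^ (i : ℕ)).coeff 0)
        (r₀ := -(dressDefect L Z).coeff (-k)) (r := fun i => -(satoDefect L i Z).coeff (-k - 1))
        hz hz0 hzu hzd (hds _).neg (fun i => (hss i _).neg)
        (fun i => by
          -- Commutation read at order `-k`: one side is the top coefficient of `satoDefect` applied
          -- to an operator of order `-k`, the other that of `dressDefect` applied to one of order
          -- `-k-1`.
          have h := congrArg (fun A => A.coeff (-k)) (satoDefect_dressDefect hL hs i)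
          rw [coeff_satoDefect hd, coeff_dressDefect hL.ordLE (hst i) (by ring)] at h
          rw [pderiv_neg]
          have : shift 1 (-(satoDefect L i Z).coeff (-k - 1)) =
            -shift 1 ((satoDefect L i Z).coeff (-k - 1)) := rfl
          rw [this]
          linear_combination h)
        (fun i j => by
          have h := congrArg (fun A => A.coeff (-k - 1)) (satoDefect_comm hL hs i j)
          rw [coeff_satoDefect (hst j), coeff_satoDefect (hst i)] at h
          rw [pderiv_neg, pderiv_neg]
          linear_combination -h)
      have hm := ordLE_mono (-(k : ℤ) - 1) z
      have hms := IsSmooth.mono hzs (-(k : ℤ) - 1)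
      refine ⟨z, hs.add hms, ho.add (hm.mono (by omega)), ?_, ?_, fun i => ?_⟩
      · rw [coeff_add, coeff_mono_of_ne (by omega), add_zero, hc]
      · have h1 : (dressDefect L (mono (-(k : ℤ) - 1) z)).OrdLE (-k) := by
          simpa using hL.ordLE.dressDefect hm
        have := OrdLE.of_coeff_eq_zero (hd.add h1) (by
          rw [coeff_add, coeff_dressDefect hL.ordLE hm (by ring), coeff_mono_self, hzr,
            add_neg_cancel])
        rw [dressDefect_add]
        exact this.mono (by push_cast; omega)
      · have := OrdLE.of_coeff_eq_zero ((hst i).add (hm.satoDefect L i)) (by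
          rw [coeff_add, coeff_satoDefect hm, coeff_mono_self, hzi, add_neg_cancel])
        rw [satoDefect_add L i hs hms]
        exact this.mono (by push_cast; omega))
  have hle : Z.OrdLE 0 := by
    obtain ⟨Z', h1, h2⟩ := hZ 0
    simpa using h1.2.1.add (h2.mono (by simp))
  have hlead : Z.coeff 0 = z₀ := by
    obtain ⟨Z', h1, h2⟩ := hZ 0
    rw [← h1.2.2.1, ← sub_eq_zero, ← coeff_sub]
    exact h2 0 (by simp)
  have hsm : Z.IsSmooth := by
    intro m
    obtain ⟨Z', h1, h2⟩ := hZ (-m).toNat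
    have : Z.coeff m = Z'.coeff m := by
      rw [← sub_eq_zero, ← coeff_sub]
      exact h2 m (by omega)
    rw [this]
    exact h1.1 m
  have hd : dressDefect L Z = 0 := by
    refine eq_zero_of_ordLE fun N => ?_
    obtain ⟨Z', h1, h2⟩ := hZ (-N).toNat
    have := (hL.ordLE.dressDefect h2).add (h1.2.2.2.1.mono (by simp))
    rw [← dressDefect_add, sub_add_cancel] at this
    exact this.mono (by omega)
  have hst : ∀ i, satoDefect L i Z = 0 := by
    intro i
    refine eq_zero_of_ordLE fun N => ?_
    obtain ⟨Z', h1, h2⟩ := hZ (-N).toNat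
    have := (h2.satoDefect L i).add (h1.2.2.2.2 i)
    rw [← satoDefect_add L i (hsm.sub h1.1) h1.1, sub_add_cancel] at this
    exact this.mono (by omega)
  have hnz : NowhereZero (Z.coeff 0) := hlead ▸ hz0
  obtain ⟨Y, _, h1, h2⟩ := exists_inverse hle hnz
  refine ⟨Z, Y, hle, hnz, hsm, h1, h2, ?_, fun i => ?_⟩
  · rw [← sub_eq_zero.1 hd, mul_assoc, h1, mul_one]
  · rw [PDO.npow_eq_pow]
    exact eq_neg_of_add_eq_zero_left (hst i)

end

end DMKP

namespace DMKP

noncomputable section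

open Finset.HasAntidiagonal (antidiagonal mem_antidiagonal)

/-! ### Miwa shifts over differential rings -/

section Miwa

open PowerSeries

variable {R : Type*} [CommRing R] [Algebra ℚ R] (d : ℕ → Derivation ℚ R R)

theorem derivation_smul (δ : Derivation ℚ R R) (q : ℚ) (f : R) : δ (q • f) = q • δ f :=
  δ.map_smul q f

theorem smul_add_self {M : Type*} [AddCommGroup M] [Module ℚ M] (q : ℚ) (f : M) :
    q • f + f = (q + 1) • f := by
  rw [add_smul, one_smul]

/-- The operator `∑_l w_l X^l d_l` on power series. -/
def weightedDer (w : ℕ → ℚ) : R⟦X⟧ →ₗ[ℚ] R⟦X⟧ where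
  toFun F := PowerSeries.mk fun k => ∑ x ∈ antidiagonal k, w x.1 • d x.1 (coeff x.2 F)
  map_add' F G := by
    ext k
    simp [Finset.sum_add_distrib]
  map_smul' a F := by
    ext k
    simp only [coeff_mk, coeff_smul, derivation_smul, RingHom.id_apply, Finset.smul_sum]
    exact Finset.sum_congr rfl fun x _ => smul_comm _ _ _

theorem coeff_weightedDer (w : ℕ → ℚ) (F : R⟦X⟧) (k : ℕ) : coeff k (weightedDer d w F) =
    ∑ x ∈ antidiagonal k, w x.1 • d x.1 (coeff x.2 F) := by
  have h : weightedDer d w F = PowerSeries.mk fun k => ∑ x ∈ antidiagonal k,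
    w x.1 • d x.1 (coeff x.2 F) := rfl
  rw [h, coeff_mk]

theorem weightedDer_mul (w : ℕ → ℚ) (F G : R⟦X⟧) :
    weightedDer d w (F * G) = weightedDer d w F * G + F * weightedDer d w G := by
  ext k
  have h1 : coeff k (weightedDer d w F * G) = ∑ x ∈ antidiagonal k, ∑ y ∈ antidiagonal x.2,
      w x.1 • (d x.1 (coeff y.1 F) * coeff y.2 G) := by
    rw [← sum_antidiagonal_assoc fun a b c => w a • (d a (coeff b F) * coeff c G),
      PowerSeries.coeff_mul]
    refine Finset.sum_congr rfl fun x _ => ?_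
    rw [coeff_weightedDer, Finset.sum_mul]
    exact Finset.sum_congr rfl fun y _ => smul_mul_assoc _ _ _
  have h2 : coeff k (F * weightedDer d w G) = ∑ x ∈ antidiagonal k, ∑ y ∈ antidiagonal x.2,
      w x.1 • (coeff y.1 F * d x.1 (coeff y.2 G)) := by
    rw [← sum_antidiagonal_assoc fun a b c => w a • (coeff b F * d a (coeff c G)),
      PowerSeries.coeff_mul]
    have : ∀ x ∈ antidiagonal k, coeff x.1 F * coeff x.2 (weightedDer d w G) =
        ∑ y ∈ antidiagonal x.2, w y.1 • (coeff x.1 F * d y.1 (coeff y.2 G)) := by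
      intro x _
      rw [coeff_weightedDer, Finset.mul_sum]
      exact Finset.sum_congr rfl fun y _ => mul_smul_comm _ _ _
    rw [Finset.sum_congr rfl this,
      ← sum_antidiagonal_assoc fun a b c => w b • (coeff a F * d b (coeff c G))]
    refine Finset.sum_congr rfl fun x _ => ?_
    exact Finset.Nat.sum_antidiagonal_swap
      (f := fun y => w y.1 • (coeff y.2 F * d y.1 (coeff x.2 G)))
  rw [map_add, h1, h2, ← Finset.sum_add_distrib, coeff_weightedDer]
  refine Finset.sum_congr rfl fun x _ => ?_
  rw [PowerSeries.coeff_mul, map_sum, Finset.smul_sum, ← Finset.sum_add_distrib]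
  refine Finset.sum_congr rfl fun y _ => ?_
  rw [Derivation.leibniz, ← smul_add, smul_eq_mul, smul_eq_mul]
  congr 1
  ring

theorem weightedDer_X_mul (w : ℕ → ℚ) (F : R⟦X⟧) :
    weightedDer d w (X * F) = X * weightedDer d w F := by
  rw [weightedDer_mul]
  have : weightedDer d w (X : R⟦X⟧) = 0 := by
    ext k
    rw [coeff_weightedDer, map_zero]
    refine Finset.sum_eq_zero fun x _ => ?_
    rw [coeff_X]
    split_ifs <;> simp
  rw [this, zero_mul, zero_add]

theorem weightedDer_C (w : ℕ → ℚ) (f : R) :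
    weightedDer d w (C f) = PowerSeries.mk fun k => w k • d k f := by
  ext k
  rw [coeff_weightedDer, coeff_mk, Finset.sum_eq_single (k, 0)]
  · simp
  · rintro ⟨a, b⟩ hx hne
    rw [mem_antidiagonal] at hx
    have : b ≠ 0 := by
      rintro rfl
      exact hne (by simpa using hx)
    rw [coeff_C, if_neg this, map_zero, smul_zero]
  · simp

/-- The extension of a derivation to power series, coefficient by coefficient. -/
def mapDer (δ : Derivation ℚ R R) : Derivation ℚ R⟦X⟧ R⟦X⟧ :=
  Derivation.mk'
    { toFun := fun F => PowerSeries.mk fun k => δ (coeff k F)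
      map_add' := fun F G => by ext k; simp
      map_smul' := fun a F => by ext k; simp }
    fun F G => by
      ext k
      simp only [LinearMap.coe_mk, AddHom.coe_mk, coeff_mk, map_add, PowerSeries.coeff_mul,
        smul_eq_mul, map_sum, Derivation.leibniz, Finset.sum_add_distrib]
      congr 1
      rw [← Finset.Nat.sum_antidiagonal_swap]
      rfl

@[simp] theorem coeff_mapDer (δ : Derivation ℚ R R) (F : R⟦X⟧) (k : ℕ) :
    coeff k (mapDer δ F) = δ (coeff k F) := by
  have h : mapDer δ F = PowerSeries.mk fun k => δ (coeff k F) := rfl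
  rw [h, coeff_mk]

theorem mapDer_C (δ : Derivation ℚ R R) (f : R) : mapDer δ (C f) = C (δ f) := by
  ext k
  rw [coeff_mapDer, coeff_C, coeff_C]
  split_ifs <;> simp

variable {d} (hd : ∀ i j f, d i (d j f) = d j (d i f))
include hd

theorem weightedDer_comm (w w' : ℕ → ℚ) (F : R⟦X⟧) :
    weightedDer d w (weightedDer d w' F) = weightedDer d w' (weightedDer d w F) := by
  have h : ∀ (w w' : ℕ → ℚ) k, coeff k (weightedDer d w (weightedDer d w' F)) =
      ∑ x ∈ antidiagonal k, ∑ y ∈ antidiagonal x.1,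
        (w y.1 * w' y.2) • d y.1 (d y.2 (coeff x.2 F)) := by
    intro w w' k
    rw [sum_antidiagonal_assoc fun a b c => (w a * w' b) • d a (d b (coeff c F)),
      coeff_weightedDer]
    refine Finset.sum_congr rfl fun x _ => ?_
    rw [coeff_weightedDer, map_sum, Finset.smul_sum]
    refine Finset.sum_congr rfl fun y _ => ?_
    rw [derivation_smul, smul_smul]
  ext k
  rw [h, h]
  refine Finset.sum_congr rfl fun x _ => ?_
  rw [← Finset.Nat.sum_antidiagonal_swap]
  refine Finset.sum_congr rfl fun y _ => ?_
  rw [hd, mul_comm]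
  rfl

theorem mapDer_comm (i j : ℕ) (F : R⟦X⟧) :
    mapDer (d i) (mapDer (d j) F) = mapDer (d j) (mapDer (d i) F) := by
  ext k
  simp [hd]

omit hd
variable (d)

/-- The operator `∑_{l ≥ 1} (X^l / l) ∂_l`, where `∂_l = d_{l-1}`. -/
def miwaOp (F : R⟦X⟧) : R⟦X⟧ := X * weightedDer d (fun l => ((l : ℚ) + 1)⁻¹) F

/-- The operator `∂_X - c ∑_l X^l d_l`, which annihilates the shifts by `c [X]`. -/
def miwaDer (c : ℚ) : Derivation ℚ R⟦X⟧ R⟦X⟧ :=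
  Derivation.mk' (((PowerSeries.derivative R).restrictScalars ℚ : Derivation ℚ R⟦X⟧ R⟦X⟧)
      - c • weightedDer d 1 : R⟦X⟧ →ₗ[ℚ] R⟦X⟧)
    fun F G => by
      simp only [LinearMap.sub_apply, LinearMap.smul_apply, weightedDer_mul,
        Derivation.coeFn_coe, Derivation.leibniz, smul_eq_mul, smul_add, mul_sub]
      rw [mul_smul_comm, mul_smul_comm, mul_comm G (weightedDer d 1 F)]
      abel

theorem coeff_miwaDer (c : ℚ) (F : R⟦X⟧) (k : ℕ) : coeff k (miwaDer d c F) =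
    coeff (k + 1) F * (k + 1) - c • ∑ x ∈ antidiagonal k, d x.1 (coeff x.2 F) := by
  change coeff k (PowerSeries.derivative R F - c • weightedDer d 1 F) = _
  rw [map_sub, coeff_derivative, coeff_smul, coeff_weightedDer]
  simp

theorem miwaDer_apply (c : ℚ) (F : R⟦X⟧) :
    miwaDer d c F = PowerSeries.derivative R F - c • weightedDer d 1 F := rfl

/-- A recursion expressing each coefficient by the previous ones. An element of the kernel of
`miwaDer` is therefore determined by its constant term, which is the uniqueness principle behind all
later identities between shifts. -/
theorem coeff_succ_of_miwaDer_eq_zero {c : ℚ} {F : R⟦X⟧} (h : miwaDer d c F = 0) (k : ℕ) :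
    coeff (k + 1) F = ((k : ℚ) + 1)⁻¹ • c • ∑ x ∈ antidiagonal k, d x.1 (coeff x.2 F) := by
  have h1 := congrArg (coeff k) h
  rw [coeff_miwaDer, map_zero, sub_eq_zero] at h1
  rw [← h1, mul_comm]
  have : ((k : R) + 1) * coeff (k + 1) F = ((k : ℚ) + 1) • coeff (k + 1) F := by
    rw [Algebra.smul_def]; simp
  rw [this, smul_smul, inv_mul_cancel₀ (by positivity), one_smul]

/-- A linear map intertwining the derivations maps solutions to solutions. -/
theorem map_coeff_of_miwaDer_eq_zero {S : Type*} [CommRing S] [Algebra ℚ S]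
    (d' : ℕ → Derivation ℚ S S) (φ : R →ₗ[ℚ] S) (hφ : ∀ l f, φ (d l f) = d' l (φ f)) {c : ℚ}
    {F : R⟦X⟧} {G : S⟦X⟧} (hF : miwaDer d c F = 0) (hG : miwaDer d' c G = 0)
    (h0 : φ (coeff 0 F) = coeff 0 G) (k : ℕ) : φ (coeff k F) = coeff k G := by
  induction k using Nat.strong_induction_on with
  | _ k ih =>
    rcases k with _ | k
    · exact h0
    rw [coeff_succ_of_miwaDer_eq_zero d hF, coeff_succ_of_miwaDer_eq_zero d' hG, map_smul,
      map_smul, map_sum]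
    congr 2
    refine Finset.sum_congr rfl fun x hx => ?_
    have := mem_antidiagonal.1 hx
    rw [hφ, ih _ (by omega)]

theorem eq_of_miwaDer_eq_zero {c : ℚ} {F G : R⟦X⟧} (hF : miwaDer d c F = 0)
    (hG : miwaDer d c G = 0) (h0 : coeff 0 F = coeff 0 G) : F = G :=
  PowerSeries.ext fun k => map_coeff_of_miwaDer_eq_zero d d LinearMap.id (fun _ _ => rfl) hF hG h0 k

theorem miwaDer_map {S : Type*} [CommRing S] [Algebra ℚ S] (d' : ℕ → Derivation ℚ S S)
    (φ : R →+* S) (hφ : ∀ l f, φ (d l f) = d' l (φ f)) (c : ℚ) (F : R⟦X⟧) :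
    miwaDer d' c (PowerSeries.map φ F) = PowerSeries.map φ (miwaDer d c F) := by
  ext k
  rw [coeff_miwaDer, coeff_map, coeff_map, coeff_miwaDer, map_sub, map_mul, map_rat_smul, map_sum]
  simp [hφ]

theorem miwaDer_C (c : ℚ) (f : R) :
    miwaDer d c (C f) = -(c • PowerSeries.mk fun k => d k f) := by
  rw [miwaDer_apply, derivative_C, weightedDer_C]
  simp

/-- The Taylor series of `f(t + c [X])`. -/
def miwa (c : ℚ) (f : R) : R⟦X⟧ := PowerSeries.mk fun k =>
  ∑ m ∈ Finset.range (k + 1), ((m.factorial : ℚ)⁻¹ * c ^ m) • coeff k ((miwaOp d)^[m] (C f))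

@[simp] theorem coeff_zero_miwa (c : ℚ) (f : R) : coeff 0 (miwa d c f) = f := by
  simp [miwa]

theorem coeff_miwaOp_zero (F : R⟦X⟧) : coeff 0 (miwaOp d F) = 0 := by
  rw [miwaOp, coeff_zero_X_mul]

theorem coeff_miwaOp_succ (F : R⟦X⟧) (k : ℕ) : coeff (k + 1) (miwaOp d F) =
    ∑ x ∈ antidiagonal k, ((x.1 : ℚ) + 1)⁻¹ • d x.1 (coeff x.2 F) := by
  rw [miwaOp, coeff_succ_X_mul, coeff_weightedDer]

theorem coeff_iterate_miwaOp (f : R) (m k : ℕ) (h : k < m) :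
    coeff k ((miwaOp d)^[m] (C f)) = 0 := by
  induction m generalizing k with
  | zero => omega
  | succ m ih =>
    rw [Function.iterate_succ_apply']
    rcases k with _ | k
    · exact coeff_miwaOp_zero d _
    · rw [coeff_miwaOp_succ]
      refine Finset.sum_eq_zero fun x hx => ?_
      have := mem_antidiagonal.1 hx
      rw [ih _ (by omega), map_zero, smul_zero]

/-- The commutator of `X ∂_X` with `X^{l+1}/(l+1)` is `X^{l+1}`: the weights in `miwaOp` cancel and
leave weights 1. -/
theorem euler_miwaOp (F : R⟦X⟧) : X * PowerSeries.derivative R (miwaOp d F) =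
    miwaOp d (X * PowerSeries.derivative R F) + X * weightedDer d 1 F := by
  ext k
  rcases k with _ | k
  · rw [map_add, coeff_miwaOp_zero, coeff_zero_X_mul, coeff_zero_X_mul, add_zero]
  rw [map_add, coeff_succ_X_mul, coeff_derivative, coeff_miwaOp_succ, coeff_miwaOp_succ,
    coeff_succ_X_mul, coeff_weightedDer, Finset.sum_mul, ← Finset.sum_add_distrib]
  refine Finset.sum_congr rfl fun x hx => ?_
  have hk := mem_antidiagonal.1 hx
  have h1 : coeff x.2 (X * PowerSeries.derivative R F) = (x.2 : ℚ) • coeff x.2 F := by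
    rcases x.2 with _ | j
    · simp
    · rw [coeff_succ_X_mul, coeff_derivative, Algebra.smul_def, mul_comm]; simp
  have h2 : ∀ r : R, r * ((k : R) + 1) = ((x.1 : ℚ) + x.2 + 1) • r := by
    intro r; rw [Algebra.smul_def, mul_comm, ← hk]; simp
  have h3 : (x.1 : ℚ) + 1 ≠ 0 := by positivity
  rw [h1, h2, derivation_smul, smul_smul, smul_smul, Pi.one_apply, one_smul, smul_add_self]
  congr 1
  field_simp
  ring

variable {d}
include hd

theorem miwaOp_comm (F : R⟦X⟧) :
    miwaOp d (X * weightedDer d 1 F) = X * weightedDer d 1 (miwaOp d F) := by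
  rw [miwaOp, miwaOp, weightedDer_X_mul, weightedDer_X_mul, weightedDer_comm hd]

/-- The power rule for the derivative of `miwaOp` iterated `m + 1` times. It holds because `miwaOp`
commutes with its own Euler derivative and `∂_X` kills the constant series. -/
theorem euler_iterate_miwaOp (f : R) (m : ℕ) :
    X * PowerSeries.derivative R ((miwaOp d)^[m + 1] (C f)) =
      ((m : ℚ) + 1) • (X * weightedDer d 1 ((miwaOp d)^[m] (C f))) := by
  have hsm : ∀ (q : ℚ) F, miwaOp d (q • F) = q • miwaOp d F := by
    intro q F
    rw [miwaOp, miwaOp, map_smul, mul_smul_comm]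
  induction m with
  | zero =>
    rw [Function.iterate_succ_apply', euler_miwaOp]
    have : miwaOp d (0 : R⟦X⟧) = 0 := by rw [miwaOp, map_zero, mul_zero]
    simp [this]
  | succ m ih =>
    rw [Function.iterate_succ_apply', euler_miwaOp, ih, hsm, miwaOp_comm hd,
      ← Function.iterate_succ_apply' (miwaOp d)]
    rw [smul_add_self, Nat.cast_succ]

/-- Differentiating the exponential series termwise: `∂_X` of term `m + 1` is `c ∑ X^l d_l` applied
to term `m`. -/
theorem miwaDer_miwa (c : ℚ) (f : R) : miwaDer d c (miwa d c f) = 0 := by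
  ext k
  have hE : ∀ m, coeff (k + 1) ((miwaOp d)^[m + 1] (C f)) * ((k : R) + 1) =
      ((m : ℚ) + 1) • ∑ x ∈ antidiagonal k, d x.1 (coeff x.2 ((miwaOp d)^[m] (C f))) := by
    intro m
    have h := congrArg (coeff (k + 1)) (euler_iterate_miwaOp hd f m)
    rw [coeff_succ_X_mul, coeff_derivative, coeff_smul, coeff_succ_X_mul,
      coeff_weightedDer] at h
    simpa using h
  -- The `m`-th iterate starts at `X^m`, so the exponential sums of all coefficients involved can be
  -- cut off at the same place.
  have hlow : ∀ x ∈ antidiagonal k, coeff x.2 (miwa d c f) = ∑ m ∈ Finset.range (k + 1),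
      ((m.factorial : ℚ)⁻¹ * c ^ m) • coeff x.2 ((miwaOp d)^[m] (C f)) := by
    intro x hx
    have := mem_antidiagonal.1 hx
    rw [miwa, coeff_mk]
    refine Finset.sum_subset (fun m hm => ?_) fun m _ hm => ?_
    · simp only [Finset.mem_range] at *; omega
    · rw [coeff_iterate_miwaOp d f m _ (by simpa using hm), smul_zero]
  rw [coeff_miwaDer, map_zero, sub_eq_zero, Finset.sum_congr rfl fun x hx =>
    congrArg (d x.1) (hlow x hx)]
  simp only [map_sum, derivation_smul]
  rw [Finset.sum_comm, miwa, coeff_mk, Finset.sum_range_succ', Finset.smul_sum]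
  have h0 : coeff (k + 1) ((miwaOp d)^[0] (C f)) = 0 := by simp
  rw [h0, smul_zero, add_zero, Finset.sum_mul]
  refine Finset.sum_congr rfl fun m _ => ?_
  rw [smul_mul_assoc, hE, smul_smul, ← Finset.smul_sum, smul_smul]
  congr 1
  have h1 : (m.factorial : ℚ) ≠ 0 := by positivity
  have h2 : (m : ℚ) + 1 ≠ 0 := by positivity
  rw [Nat.factorial_succ]
  push_cast
  field_simp
  ring

theorem eq_miwa {c : ℚ} {F : R⟦X⟧} {f : R} (hF : miwaDer d c F = 0) (h0 : coeff 0 F = f) :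
    F = miwa d c f :=
  eq_of_miwaDer_eq_zero d hF (miwaDer_miwa hd c f) (by rw [h0, coeff_zero_miwa])

/-- The shift by `c [X]` is a ring homomorphism. -/
def miwaHom (c : ℚ) : R →+* R⟦X⟧ where
  toFun := miwa d c
  map_one' := (eq_miwa hd (by simp) (by simp)).symm
  map_zero' := (eq_miwa hd (by simp) (by simp)).symm
  map_add' f g := (eq_miwa hd (by rw [map_add, miwaDer_miwa hd, miwaDer_miwa hd, add_zero])
    (by rw [map_add, coeff_zero_miwa, coeff_zero_miwa])).symm
  map_mul' f g := (eq_miwa hd (by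
      rw [Derivation.leibniz, miwaDer_miwa hd, miwaDer_miwa hd, smul_zero, smul_zero, add_zero])
    (by simp [PowerSeries.coeff_mul, coeff_zero_miwa])).symm

theorem miwaHom_apply (c : ℚ) (f : R) : miwaHom hd c f = miwa d c f := rfl

theorem map_coeff_miwa {S : Type*} [CommRing S] [Algebra ℚ S] {d' : ℕ → Derivation ℚ S S}
    (hd' : ∀ i j f, d' i (d' j f) = d' j (d' i f)) (φ : R →ₗ[ℚ] S)
    (hφ : ∀ l f, φ (d l f) = d' l (φ f)) (c : ℚ) (f : R) (k : ℕ) :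
    φ (coeff k (miwa d c f)) = coeff k (miwa d' c (φ f)) :=
  map_coeff_of_miwaDer_eq_zero d d' φ hφ (miwaDer_miwa hd c f) (miwaDer_miwa hd' c _)
    (by simp) k

/-- Shifts commute with the derivations. -/
theorem miwa_der (c : ℚ) (l : ℕ) (f : R) : miwa d c (d l f) = mapDer (d l) (miwa d c f) := by
  ext k
  rw [coeff_mapDer]
  exact (map_coeff_miwa hd hd (d l : R →ₗ[ℚ] R) (fun i f => hd l i f) c f k).symm

end Miwa

end

end DMKP

namespace DMKP

noncomputable section

open Finset.HasAntidiagonal (antidiagonal mem_antidiagonal)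

/-! ### Power series in two variables. -/

section Swap

open PowerSeries

variable {R : Type*} [CommRing R]

/-- Exchanging the two variables of a power series. -/
def swapHom : R⟦X⟧⟦X⟧ →+* R⟦X⟧⟦X⟧ where
  toFun F := PowerSeries.mk fun k => PowerSeries.mk fun j => coeff k (coeff j F)
  map_zero' := by ext k j; simp
  map_one' := by
    ext k j
    simp only [coeff_mk, coeff_one]
    split_ifs <;> simp_all [coeff_one]
  map_add' F G := by ext k j; simp
  map_mul' F G := by
    ext k j
    simp only [coeff_mk, PowerSeries.coeff_mul, map_sum]
    exact Finset.sum_comm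

theorem coeff_swapHom (F : R⟦X⟧⟦X⟧) (k j : ℕ) :
    coeff j (coeff k (swapHom F)) = coeff k (coeff j F) := by
  have h : swapHom F = PowerSeries.mk fun k => PowerSeries.mk fun j => coeff k (coeff j F) := rfl
  rw [h, coeff_mk, coeff_mk]

theorem swapHom_X : swapHom (X : R⟦X⟧⟦X⟧) = C X := by
  ext k j
  rw [coeff_swapHom, coeff_X, coeff_C]
  split_ifs <;> simp_all [coeff_X, coeff_one]

theorem swapHom_C (F : R⟦X⟧) : swapHom (C F) = PowerSeries.map C F := by
  ext k j
  rw [coeff_swapHom, coeff_C, coeff_map, coeff_C]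
  split_ifs <;> simp

theorem swapHom_map_C (F : R⟦X⟧) : swapHom (PowerSeries.map C F) = C F := by
  ext k j
  rw [coeff_swapHom, coeff_C, coeff_map, coeff_C]
  split_ifs <;> simp

/-- `V - X` is not a zero divisor: the coefficients in the outer variable vanish inductively because
multiplication by the inner variable `V` is injective. -/
theorem eq_zero_of_sub_mul {F : R⟦X⟧⟦X⟧} (h : (C X - X) * F = 0) : F = 0 := by
  have h1 : ∀ k, X * coeff k F = 0 → coeff k F = 0 := by
    intro k hk
    ext j
    have := congrArg (coeff (j + 1)) hk
    rwa [coeff_succ_X_mul, map_zero] at this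
  ext1 k
  rw [map_zero]
  induction k with
  | zero =>
    have := congrArg (coeff 0) h
    rw [sub_mul, map_sub, coeff_C_mul, coeff_zero_X_mul, sub_zero, map_zero] at this
    exact h1 _ this
  | succ k ih =>
    have := congrArg (coeff (k + 1)) h
    rw [sub_mul, map_sub, coeff_C_mul, coeff_succ_X_mul, ih, sub_zero, map_zero] at this
    exact h1 _ this

end Swap

/-! ### From the shift relation to a closed family. -/

section TauForm

open PowerSeries

variable {R : Type*} [CommRing R] [Algebra ℚ R] {d : ℕ → Derivation ℚ R R}
  (hd : ∀ i j f, d i (d j f) = d j (d i f))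
include hd

omit hd in
theorem mapDer_commute (hd : ∀ i j f, d i (d j f) = d j (d i f)) (i j : ℕ) (F : R⟦X⟧) :
    (fun l => mapDer (d l)) i ((fun l => mapDer (d l)) j F) =
      (fun l => mapDer (d l)) j ((fun l => mapDer (d l)) i F) := mapDer_comm hd i j F

omit hd in
-- The hypotheses are the coefficients of `(V - X) z(t+c[X], V) = V z(t, V) - X h(X) U(V)`. At `V =
-- X` the left side vanishes; in coefficients this is a telescoping sum along an antidiagonal.
theorem eq_mul_of_shift_relation {z U h : R⟦X⟧} {c : ℚ}
    (h0 : ∀ k, coeff k (miwa d c (coeff 0 z)) = coeff k h * coeff 0 U)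
    (h1 : ∀ k j, coeff (k + 1) (miwa d c (coeff j z)) - coeff k (miwa d c (coeff (j + 1) z)) =
      -(coeff k h * coeff (j + 1) U)) : z = h * U := by
  ext m
  rw [PowerSeries.coeff_mul, Finset.Nat.sum_antidiagonal_eq_sum_range_succ
    (fun i j => coeff i h * coeff j U), Finset.sum_range_succ, Nat.sub_self, ← h0]
  have : ∀ k ∈ Finset.range m, coeff k h * coeff (m - k) U =
      coeff k (miwa d c (coeff (m - k) z)) -
        coeff (k + 1) (miwa d c (coeff (m - (k + 1)) z)) := by
    intro k hk
    have hk' := Finset.mem_range.1 hk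
    have e : m - k = (m - (k + 1)) + 1 := by omega
    rw [e]
    linear_combination h1 k (m - (k + 1))
  rw [Finset.sum_congr rfl this, Finset.sum_range_sub'
    (fun k => coeff k (miwa d c (coeff (m - k) z)))]
  simp

/-- The symmetric form of the relation between the shifts of a wave function. -/
theorem shift_relation_symm {z U h : R⟦X⟧} {c : ℚ}
    (h0 : ∀ k, coeff k (miwa d c (coeff 0 z)) = coeff k h * coeff 0 U)
    (h1 : ∀ k j, coeff (k + 1) (miwa d c (coeff j z)) - coeff k (miwa d c (coeff (j + 1) z)) =
      -(coeff k h * coeff (j + 1) U)) :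
    miwa (fun l => mapDer (d l)) c z * C (miwa d c (coeff 0 z)) * PowerSeries.map C z =
      PowerSeries.map (miwaHom hd c) z * PowerSeries.map C (miwa d c (coeff 0 z)) * C z := by
  have hz := eq_mul_of_shift_relation h0 h1
  have hcoeff : ∀ k j, coeff j (coeff k (miwa (fun l => mapDer (d l)) c z)) =
      coeff k (miwa d c (coeff j z)) := by
    intro k j
    exact map_coeff_miwa (mapDer_commute hd) hd ((coeff (R := R) j).restrictScalars ℚ)
      (fun l F => coeff_mapDer (d l) F j) c z k
  -- The outer variable `X` carries the shift and `C X` plays the role of `V`; accordingly `C F` is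
  -- `F(V)` and `PowerSeries.map C F` is `F(X)`.
  have e1 : (C X - X) * miwa (fun l => mapDer (d l)) c z =
      C X * C z - X * PowerSeries.map C h * C U := by
    ext k j
    rw [sub_mul, map_sub, map_sub, ← map_mul, map_sub, map_sub, coeff_C_mul, coeff_C, mul_assoc]
    rcases k with _ | k
    · rw [coeff_zero_X_mul, coeff_zero_X_mul, if_pos rfl]
      rcases j with _ | j
      · simp
      · rw [coeff_succ_X_mul, coeff_succ_X_mul, hcoeff, coeff_zero_miwa]
    · rw [coeff_succ_X_mul, coeff_succ_X_mul, if_neg (by omega), coeff_mul_C, coeff_map,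
        coeff_C_mul, hcoeff]
      rcases j with _ | j
      · rw [coeff_zero_X_mul, h0]; simp
      · rw [coeff_succ_X_mul, hcoeff, h1]; simp
  have e2 : C z = C h * C U := by rw [← map_mul, ← hz]
  set P := miwa (fun l => mapDer (d l)) c z * C h * PowerSeries.map C z with hP
  -- After `U` is eliminated through `z = h U`, the right side changes sign when `X` and `V` are
  -- exchanged, as does `V - X`. Cancelling `V - X` leaves `P` symmetric.
  have e3 : (C X - X) * P =
      C z * PowerSeries.map C z * (C X * C h - X * PowerSeries.map C h) := by
    rw [hP]
    linear_combination (C h * PowerSeries.map C z) * e1 +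
      X * PowerSeries.map C h * PowerSeries.map C z * e2
  have e4 := congrArg swapHom e3
  simp only [map_mul, map_sub, swapHom_C, swapHom_map_C, swapHom_X, map_X] at e4
  have e5 : P = swapHom P := by
    rw [← sub_eq_zero]
    refine eq_zero_of_sub_mul ?_
    linear_combination e3 + e4
  have e6 : swapHom (miwa (fun l => mapDer (d l)) c z) = PowerSeries.map (miwaHom hd c) z := by
    ext k j
    rw [coeff_swapHom, hcoeff, coeff_map]
    rfl
  rw [hP, map_mul, map_mul, swapHom_C, swapHom_map_C, e6] at e5
  -- The unknown `h` is traded for the shift of `z₀`; they differ by the factor `U₀`, which is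
  -- constant in both variables.
  have e7 : miwa d c (coeff 0 z) = h * C (coeff 0 U) := by
    ext k
    rw [h0, coeff_mul_C]
  rw [e7, map_mul, map_mul, map_C]
  linear_combination C (C (coeff 0 U)) * e5

/-- The logarithmic derivative of a wave function along `∂_X - c ∑ X^l d_l` is closed. -/
theorem closed_of_shift_relation {z z' U h Ψ : R⟦X⟧} {c : ℚ} (hc : c ≠ 0) (hz' : z * z' = 1)
    (h0 : ∀ k, coeff k (miwa d c (coeff 0 z)) = coeff k h * coeff 0 U)
    (h1 : ∀ k j, coeff (k + 1) (miwa d c (coeff j z)) - coeff k (miwa d c (coeff (j + 1) z)) =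
      -(coeff k h * coeff (j + 1) U))
    (hΨ : miwaDer d c z = Ψ * z) (l m : ℕ) : d m (coeff l Ψ) = d l (coeff m Ψ) := by
  have hJ := shift_relation_symm hd h0 h1
  set D : ℕ → Derivation ℚ R⟦X⟧ R⟦X⟧ := fun l => mapDer (d l) with hD
  have hDc : ∀ i j F, D i (D j F) = D j (D i F) := mapDer_comm hd
  set T := miwaHom hd c with hT
  set g := miwa d c (coeff 0 z) with hg
  have hTd : ∀ l f, T (d l f) = D l (T f) := fun l f => miwa_der hd c l f
  have hCd : ∀ l f, C (d l f) = D l (C f) := fun l f => (mapDer_C (d l) f).symm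
  have hNg : miwaDer d c g = 0 := miwaDer_miwa hd c _
  obtain ⟨g', hg'⟩ : ∃ g', g * g' = 1 := by
    refine ⟨T (coeff 0 z'), ?_⟩
    change T (coeff 0 z) * T (coeff 0 z') = 1
    have := congrArg (coeff 0) hz'
    rw [← map_mul]
    have e : coeff 0 z * coeff 0 z' = 1 := by
      simpa [PowerSeries.coeff_mul] using this
    rw [e, map_one]
  -- Series in `X` of the logarithmic derivatives of `g(V)` and of `z(V)`. These factors do not
  -- contain `X`, so `miwaDer` in `X` sees them only through the `d_l`.
  set x : R⟦X⟧⟦X⟧ := PowerSeries.mk fun l => D l g * g' with hx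
  set y : R⟦X⟧⟦X⟧ := PowerSeries.mk fun l => D l z * z' with hy
  have hxg : miwaDer D c (C g) = -(c • (x * C g)) := by
    rw [miwaDer_C]
    congr 2
    ext1 k
    rw [coeff_mul_C, coeff_mk, coeff_mk, mul_assoc, mul_comm g', hg', mul_one]
  have hyz : miwaDer D c (C z) = -(c • (y * C z)) := by
    rw [miwaDer_C]
    congr 2
    ext1 k
    rw [coeff_mul_C, coeff_mk, coeff_mk, mul_assoc, mul_comm z', hz', mul_one]
  have hN := congrArg (miwaDer D c) hJ
  simp only [Derivation.leibniz, miwaDer_miwa hDc, smul_eq_mul, mul_zero, add_zero,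
    miwaDer_map d D C hCd, miwaDer_map d D T hTd, hΨ, hNg, map_zero, map_mul, hxg, hyz] at hN
  set P := miwa D c z * C g * PowerSeries.map C z with hP
  have hunit : ∃ P', P' * P = 1 := by
    refine ⟨miwa D c z' * C g' * PowerSeries.map C z', ?_⟩
    have a1 : miwa D c z * miwa D c z' = 1 := by
      rw [← miwaHom_apply hDc, ← miwaHom_apply hDc, ← map_mul, hz', map_one]
    have a2 : (C g : R⟦X⟧⟦X⟧) * C g' = 1 := by rw [← map_mul, hg', map_one]
    have a3 : PowerSeries.map (C : R →+* R⟦X⟧) z * PowerSeries.map C z' = 1 := by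
      rw [← map_mul, hz', map_one]
    rw [hP]
    linear_combination (C g * C g' * PowerSeries.map (C : R →+* R⟦X⟧) z * PowerSeries.map C z') * a1
      + PowerSeries.map (C : R →+* R⟦X⟧) z * PowerSeries.map C z' * a2 + a3
  obtain ⟨P', hP'⟩ := hunit
  have hsm : ∀ F : R⟦X⟧⟦X⟧, c • F = C (C (algebraMap ℚ R c)) * F := by
    intro F; ext i j; simp [Algebra.smul_def]
  rw [hsm, hsm] at hN
  set γ : R⟦X⟧⟦X⟧ := C (C (algebraMap ℚ R c)) with hγ
  -- The logarithmic derivative of the symmetric relation in `X`. The factors `z(t+c[X], V)` and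
  -- `g(X)` are shifts in `X` and contribute nothing.
  have hrel : PowerSeries.map C Ψ - γ * x = PowerSeries.map T Ψ - γ * y := by
    have : P * (PowerSeries.map C Ψ - γ * x) = P * (PowerSeries.map T Ψ - γ * y) := by
      rw [hP]
      linear_combination hN - (PowerSeries.map T Ψ - γ * y) * hJ
    have := congrArg (P' * ·) this
    simpa only [← mul_assoc, hP', one_mul] using this
  have hl := congrArg (coeff l) hrel
  have hγc : ∀ F : R⟦X⟧⟦X⟧, coeff l (γ * F) = c • coeff l F := by
    intro F; rw [← hsm, coeff_smul]
  rw [map_sub, map_sub, hγc, hγc, coeff_map, coeff_map, coeff_mk, coeff_mk] at hl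
  have hx0 : miwaDer d c (D l g * g') = 0 := by
    have e : D l g * g' * g = D l g := by rw [mul_assoc, mul_comm g', hg', mul_one]
    have e2 := congrArg (miwaDer d c) e
    have e3 : miwaDer d c (D l g) = 0 := by
      have : D l g = miwa d c (d l (coeff 0 z)) := (hTd l _).symm
      rw [this, miwaDer_miwa hd]
    rw [Derivation.leibniz, hNg, smul_zero, zero_add, e3, smul_eq_mul] at e2
    have e4 := congrArg (g' * ·) e2
    simpa only [← mul_assoc, mul_comm g' g, hg', one_mul, mul_zero] using e4
  have hcommD : ∀ F, miwaDer d c (D l F) = D l (miwaDer d c F) := by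
    intro F
    ext k
    have hDl : ∀ F k, coeff k (D l F) = d l (coeff k F) := fun F k => coeff_mapDer (d l) F k
    have : d l ((k : R) + 1) = 0 := by simp
    rw [hDl, coeff_miwaDer, coeff_miwaDer, map_sub, derivation_smul, map_sum, hDl,
      Derivation.leibniz, this, smul_zero, zero_add, smul_eq_mul, mul_comm]
    congr 2
    refine Finset.sum_congr rfl fun p _ => ?_
    rw [hDl, hd]
  have hy0 : miwaDer d c (D l z * z') = D l Ψ := by
    have e : D l z * z' * z = D l z := by rw [mul_assoc, mul_comm z', hz', mul_one]
    have e2 := congrArg (miwaDer d c) e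
    rw [(miwaDer d c).leibniz (D l z * z') z, hΨ, hcommD, hΨ, (D l).leibniz Ψ z] at e2
    simp only [smul_eq_mul] at e2
    linear_combination z' * e2 + (D l Ψ - Ψ * D l z * z' - miwaDer d c (D l z * z')) * hz'
  -- The second differentiation is in `V`, on the coefficient of `X^l`: the shift of `Ψ_l` and the
  -- logarithmic derivative of `g` are killed, the logarithmic derivative of `z` gives `d_l Ψ`, and
  -- `Ψ_l` itself gives the series of its derivatives.
  have hfin := congrArg (miwaDer d c) hl
  have hTΨ : miwaDer d c (T (coeff l Ψ)) = 0 := miwaDer_miwa hd c _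
  rw [map_sub, map_sub, derivation_smul, derivation_smul, hx0, hy0, hTΨ, smul_zero, sub_zero,
    zero_sub, miwaDer_C, neg_inj] at hfin
  have := congrArg (coeff m) hfin
  rw [coeff_smul, coeff_smul, coeff_mk, hD, coeff_mapDer] at this
  exact (IsUnit.mk0 c hc).smul_left_cancel.1 this

end TauForm

end

end DMKP

namespace DMKP

noncomputable section

variable {𝕜 : Type*} [RCLike 𝕜]

open Finset.HasAntidiagonal (antidiagonal mem_antidiagonal)

/-! ### The differential ring of smooth functions -/

variable (𝕜) in
/-- The algebra of smooth functions. -/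
def smoothFn : Subalgebra ℚ (Fn 𝕜) where
  carrier := {f | Smooth f}
  mul_mem' hf hg := hf.mul hg
  add_mem' hf hg := hf.add hg
  algebraMap_mem' q := Smooth.const fun _ => algebraMap ℚ 𝕜 q

theorem mem_smoothFn {f : Fn 𝕜} : f ∈ smoothFn 𝕜 ↔ Smooth f := Iff.rfl

theorem smooth_coe (f : smoothFn 𝕜) : Smooth (f : Fn 𝕜) := mem_smoothFn.1 f.2

theorem pderiv_rat_smul (i : ℕ+) {f : Fn 𝕜} (hf : Smooth f) (q : ℚ) :
    pderiv i (q • f) = q • pderiv i f := by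
  have h : ∀ g : Fn 𝕜, q • g = (q : 𝕜) • g := fun g => by
    funext n t
    exact Rat.smul_def q (g n t)
  rw [h, h, pderiv_smul i hf]

variable (𝕜) in
/-- The partial derivatives as derivations of the algebra of smooth functions; `partialDer 𝕜 l`
is `∂/∂t_{l+1}`. -/
def partialDer (l : ℕ) : Derivation ℚ (smoothFn 𝕜) (smoothFn 𝕜) :=
  Derivation.mk'
    { toFun := fun f => ⟨pderiv l.succPNat f, mem_smoothFn.2 ((smooth_coe f).pderiv _)⟩
      map_add' := fun f g => Subtype.ext (pderiv_add _ (smooth_coe f) (smooth_coe g))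
      map_smul' := fun q f => Subtype.ext (pderiv_rat_smul _ (smooth_coe f) q) }
    fun f g => Subtype.ext (by
      change pderiv _ ((f : Fn 𝕜) * (g : Fn 𝕜)) =
        (f : Fn 𝕜) * pderiv _ (g : Fn 𝕜) + (g : Fn 𝕜) * pderiv _ (f : Fn 𝕜)
      rw [pderiv_mul _ (smooth_coe f) (smooth_coe g)]
      ring)

theorem coe_partialDer (l : ℕ) (f : smoothFn 𝕜) :
    (partialDer 𝕜 l f : Fn 𝕜) = pderiv l.succPNat f := rfl

theorem partialDer_comm (i j : ℕ) (f : smoothFn 𝕜) :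
    partialDer 𝕜 i (partialDer 𝕜 j f) = partialDer 𝕜 j (partialDer 𝕜 i f) :=
  Subtype.ext (pderiv_comm _ _ (smooth_coe f))

namespace PDO

/-! ### Shifted operators -/

/-- The coefficients of a smooth operator as elements of the algebra of smooth functions. -/
def IsSmooth.toSmooth {A : PDO 𝕜} (hA : A.IsSmooth) (k : ℤ) : smoothFn 𝕜 :=
  ⟨A.coeff k, mem_smoothFn.2 (hA k)⟩

/-- The coefficient of `λ^{-k}` in `A(n, t + c [λ⁻¹])`. -/
def miwaCoeff (c : ℤ) {A : PDO 𝕜} (hA : A.IsSmooth) (k : ℕ) : PDO 𝕜 where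
  coeff j := (PowerSeries.coeff k (miwa (partialDer 𝕜) c (hA.toSmooth j)) : smoothFn 𝕜)
  bdd := by
    obtain ⟨N, hN⟩ := A.bdd
    refine ⟨N, fun j hj => ?_⟩
    have : hA.toSmooth j = 0 := Subtype.ext (hN j hj)
    rw [this, ← miwaHom_apply partialDer_comm, map_zero, map_zero]
    rfl

theorem coeff_miwaCoeff (c : ℤ) {A : PDO 𝕜} (hA : A.IsSmooth) (k : ℕ) (j : ℤ) :
    (miwaCoeff c hA k).coeff j =
      (PowerSeries.coeff k (miwa (partialDer 𝕜) c (hA.toSmooth j)) : smoothFn 𝕜) := rfl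

theorem IsSmooth.miwaCoeff (c : ℤ) {A : PDO 𝕜} (hA : A.IsSmooth) (k : ℕ) :
    (miwaCoeff c hA k).IsSmooth := fun _ => smooth_coe _

theorem OrdLE.miwaCoeff (c : ℤ) {A : PDO 𝕜} (hA : A.IsSmooth) {N : ℤ} (hN : A.OrdLE N) (k : ℕ) :
    (miwaCoeff c hA k).OrdLE N := by
  intro j hj
  have : hA.toSmooth j = 0 := Subtype.ext (hN j hj)
  rw [coeff_miwaCoeff, this, ← miwaHom_apply partialDer_comm, map_zero, map_zero]
  rfl

theorem miwaCoeff_zero (c : ℤ) {A : PDO 𝕜} (hA : A.IsSmooth) : miwaCoeff c hA 0 = A := by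
  ext1
  funext j
  rw [coeff_miwaCoeff, coeff_zero_miwa]
  rfl

variable (𝕜) in
/-- The coefficients of an operator as an additive map. -/
def coeffHom (j : ℤ) : PDO 𝕜 →+ Fn 𝕜 where
  toFun A := A.coeff j
  map_zero' := rfl
  map_add' _ _ := rfl

theorem coeff_finset_sum {ι : Type*} (s : Finset ι) (A : ι → PDO 𝕜) (j : ℤ) :
    (∑ i ∈ s, A i).coeff j = ∑ i ∈ s, (A i).coeff j := map_sum (coeffHom 𝕜 j) A s

theorem coeff_nsmul (m : ℕ) (A : PDO 𝕜) (j : ℤ) : (m • A).coeff j = m • A.coeff j :=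
  map_nsmul (coeffHom 𝕜 j) m A

theorem coeff_zsmul (m : ℤ) (A : PDO 𝕜) (j : ℤ) : (m • A).coeff j = m • A.coeff j :=
  map_zsmul (coeffHom 𝕜 j) m A

/-- The vanishing of `miwaDer` on shifts, written for operators and multiplied out so that only
integer scalars occur. -/
theorem miwaCoeff_succ (c : ℤ) {A : PDO 𝕜} (hA : A.IsSmooth) (k : ℕ) :
    (k + 1) • miwaCoeff c hA (k + 1) =
      c • ∑ x ∈ antidiagonal k, (miwaCoeff c hA x.2).pderiv x.1.succPNat := by
  ext1
  funext j
  have h := congrArg (PowerSeries.coeff k)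
    (miwaDer_miwa partialDer_comm (c : ℚ) (hA.toSmooth j))
  rw [coeff_miwaDer, map_zero, sub_eq_zero] at h
  have h' := congrArg ((smoothFn 𝕜).val : smoothFn 𝕜 → Fn 𝕜) h
  rw [map_mul, map_rat_smul, map_sum] at h'
  rw [coeff_nsmul, coeff_zsmul, coeff_finset_sum, nsmul_eq_mul, mul_comm,
    ← Int.cast_smul_eq_zsmul ℚ]
  simp only [map_add, map_natCast, map_one] at h'
  push_cast at h' ⊢
  exact h'

/-- If `Y * Z = 1` and `Z` is smooth, then so is `Y`. -/
theorem IsSmooth.inverse {Z Y : PDO 𝕜} (hs : Z.IsSmooth) (hZ : Z.OrdLE 0)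
    (h0 : NowhereZero (Z.coeff 0)) (hYZ : Y * Z = 1) : Y.IsSmooth := by
  have hY := ordLE_inverse hZ h0 hYZ
  have key : ∀ m : ℕ, ∃ S : PDO 𝕜, S.IsSmooth ∧ (Y - S).OrdLE (-(m : ℤ)) := by
    intro m
    induction m with
    | zero => exact ⟨0, fun _ => Smooth.zero, by simpa using hY⟩
    | succ m ih =>
      obtain ⟨S, hS, hYS⟩ := ih
      have hlead := coeff_mul_leading hYS hZ
      rw [sub_mul, hYZ] at hlead
      have h1 : shift (-(m : ℤ)) (Z.coeff 0) * (shift (-(m : ℤ)) (Z.coeff 0))⁻¹ = 1 :=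
        NowhereZero.mul_inv_cancel fun n t => h0 _ _
      have h2 : Smooth ((Y - S).coeff (-(m : ℤ))) := by
        have : (Y - S).coeff (-(m : ℤ)) =
            (1 - S * Z).coeff (-(m : ℤ) + 0) * (shift (-(m : ℤ)) (Z.coeff 0))⁻¹ := by
          rw [hlead, mul_assoc, h1, mul_one]
        rw [this]
        exact ((IsSmooth.one.sub (hS.mul hs)) _).mul (((hs 0).shift _).inv fun n t => h0 _ _)
      refine ⟨S + PDO.mono (-(m : ℤ)) ((Y - S).coeff (-(m : ℤ))), hS.add (IsSmooth.mono h2 _), ?_⟩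
      rw [← sub_sub]
      exact hYS.sub_mono.mono (by push_cast; omega)
  intro k
  obtain ⟨S, hS, hYS⟩ := key (-k + 1).toNat
  have := hYS k (by omega)
  rw [coeff_sub, sub_eq_zero] at this
  rw [this]
  exact hS k

end PDO

namespace PDO

/-! ### Products of power series of operators with `(1 - Δ X)^{±1}` -/

variable {W : ℕ → PDO 𝕜}

theorem sum_mul_Δpow_succ (G : ℕ → PDO 𝕜) (k : ℕ) :
    ∑ x ∈ antidiagonal (k + 1), G x.2 * Δpow (x.1 + 1) =
      G (k + 1) * Δpow 1 + (∑ x ∈ antidiagonal k, G x.2 * Δpow (x.1 + 1)) * Δpow 1 := by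
  rw [Finset.Nat.sum_antidiagonal_succ, Finset.sum_mul]
  congr 1
  refine Finset.sum_congr rfl fun x _ => ?_
  rw [mul_assoc, Δpow_mul_Δpow]
  push_cast
  rfl

/-- The coefficients of `(∑_k W_k X^k) (1 - Δ X)`. -/
def mulOneSub (W : ℕ → PDO 𝕜) : ℕ → PDO 𝕜
  | 0 => W 0
  | k + 1 => W (k + 1) - W k * Δpow 1

theorem mulOneSub_zero (W : ℕ → PDO 𝕜) : mulOneSub W 0 = W 0 := rfl

theorem mulOneSub_add_one (W : ℕ → PDO 𝕜) (k : ℕ) :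
    mulOneSub W (k + 1) = W (k + 1) - W k * Δpow 1 := rfl

theorem isSmooth_mulOneSub (hWs : ∀ k, (W k).IsSmooth) : ∀ k, (mulOneSub W k).IsSmooth
  | 0 => hWs 0
  | k + 1 => (hWs _).sub ((hWs k).mul (IsSmooth.Δpow 1))

theorem sum_mulOneSub_mul (W : ℕ → PDO 𝕜) (k : ℕ) :
    ∑ x ∈ antidiagonal k, mulOneSub W x.2 * Δpow (x.1 + 1) = W k * Δpow 1 := by
  induction k with
  | zero => simp [mulOneSub_zero]
  | succ k ih => rw [sum_mul_Δpow_succ, ih, mulOneSub_add_one, sub_mul, sub_add_cancel]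

theorem sum_pderiv_mulOneSub (hWs : ∀ k, (W k).IsSmooth)
    (hW : ∀ k, (k + 1) • W (k + 1) = -∑ x ∈ antidiagonal k, (W x.2).pderiv x.1.succPNat) (k : ℕ) :
    ∑ x ∈ antidiagonal k, (mulOneSub W x.2).pderiv x.1.succPNat =
      k • (W k * Δpow 1) - (k + 1) • W (k + 1) := by
  rcases k with _ | k
  · have := hW 0
    simp only [Finset.Nat.antidiagonal_zero, Finset.sum_singleton] at this ⊢
    rw [this, mulOneSub_zero, zero_smul, zero_sub, neg_neg]
  · have h : ∀ x ∈ antidiagonal k, (mulOneSub W (x.2 + 1)).pderiv x.1.succPNat =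
        (W (x.2 + 1)).pderiv x.1.succPNat - (W x.2).pderiv x.1.succPNat * Δpow 1 := by
      intro x _
      rw [mulOneSub_add_one, PDO.pderiv_sub _ (hWs _) ((hWs _).mul (IsSmooth.Δpow 1)),
        PDO.pderiv_mul _ (hWs _) (IsSmooth.Δpow 1), PDO.pderiv_Δpow, mul_zero, add_zero]
    have h2 := hW (k + 1)
    rw [Finset.Nat.sum_antidiagonal_succ'] at h2
    rw [Finset.Nat.sum_antidiagonal_succ', Finset.sum_congr rfl h, Finset.sum_sub_distrib,
      ← Finset.sum_mul, h2, ← smul_mul_assoc, hW k, mulOneSub_zero, neg_mul]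
    abel

/-- `∂/∂t_l` plus right multiplication by `Δ^l` is differentiation of the corresponding wave
function. Since `(1 - λX) e^{ξ(t,λ)} = e^{ξ(t-[X],λ)}`, the product represents a wave function at
`t-[X]`, and it obeys the shift recursion with these covariant derivatives. -/
theorem mulOneSub_succ (hWs : ∀ k, (W k).IsSmooth)
    (hW : ∀ k, (k + 1) • W (k + 1) = -∑ x ∈ antidiagonal k, (W x.2).pderiv x.1.succPNat) (k : ℕ) :
    (k + 1) • mulOneSub W (k + 1) = (-1 : ℤ) • ∑ x ∈ antidiagonal k,
      ((mulOneSub W x.2).pderiv x.1.succPNat + mulOneSub W x.2 * Δpow (x.1 + 1)) := by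
  rw [Finset.sum_add_distrib, sum_mulOneSub_mul, sum_pderiv_mulOneSub hWs hW, mulOneSub_add_one,
    smul_sub, add_smul k 1 (W k * Δpow 1), one_smul, neg_one_smul]
  abel

/-- The coefficients of `(∑_k W_k X^k) (1 - Δ X)⁻¹`. -/
def divOneSub (W : ℕ → PDO 𝕜) (k : ℕ) : PDO 𝕜 := ∑ x ∈ antidiagonal k, W x.2 * Δpow x.1

theorem divOneSub_zero (W : ℕ → PDO 𝕜) : divOneSub W 0 = W 0 := by simp [divOneSub, Δpow_zero]

theorem divOneSub_add_one (W : ℕ → PDO 𝕜) (k : ℕ) :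
    divOneSub W (k + 1) = W (k + 1) + divOneSub W k * Δpow 1 := by
  rw [divOneSub, divOneSub, Finset.Nat.sum_antidiagonal_succ, Finset.sum_mul]
  congr 1
  · simp [Δpow_zero]
  · refine Finset.sum_congr rfl fun x _ => ?_
    rw [mul_assoc, Δpow_mul_Δpow]
    push_cast
    rfl

theorem isSmooth_divOneSub (hWs : ∀ k, (W k).IsSmooth) (k : ℕ) : (divOneSub W k).IsSmooth := by
  induction k with
  | zero => rw [divOneSub_zero]; exact hWs 0
  | succ k ih => rw [divOneSub_add_one]; exact (hWs _).add (ih.mul (IsSmooth.Δpow 1))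

theorem sum_pderiv_divOneSub_succ (hWs : ∀ k, (W k).IsSmooth)
    (hW : ∀ k, (k + 1) • W (k + 1) = ∑ x ∈ antidiagonal k, (W x.2).pderiv x.1.succPNat) (k : ℕ) :
    ∑ x ∈ antidiagonal (k + 1), (divOneSub W x.2).pderiv x.1.succPNat =
      (k + 1 + 1) • W (k + 1 + 1) +
        (∑ x ∈ antidiagonal k, (divOneSub W x.2).pderiv x.1.succPNat) * Δpow 1 := by
  rw [hW, Finset.Nat.sum_antidiagonal_succ', Finset.Nat.sum_antidiagonal_succ', Finset.sum_mul,
    add_assoc, ← Finset.sum_add_distrib]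
  refine congrArg₂ _ (by rw [divOneSub_zero]) (Finset.sum_congr rfl fun x _ => ?_)
  have hG := isSmooth_divOneSub hWs x.2
  rw [divOneSub_add_one, PDO.pderiv_add _ (hWs _) (hG.mul (IsSmooth.Δpow 1)),
    PDO.pderiv_mul _ hG (IsSmooth.Δpow 1), PDO.pderiv_Δpow, mul_zero, add_zero]

/-- The counterpart of `mulOneSub_succ` for `e^{ξ(t+[X],λ)} = (1 - λX)⁻¹ e^{ξ(t,λ)}`. -/
theorem divOneSub_succ_smul (hWs : ∀ k, (W k).IsSmooth)
    (hW : ∀ k, (k + 1) • W (k + 1) = ∑ x ∈ antidiagonal k, (W x.2).pderiv x.1.succPNat) (k : ℕ) :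
    (k + 1) • divOneSub W (k + 1) = ∑ x ∈ antidiagonal k,
      ((divOneSub W x.2).pderiv x.1.succPNat + divOneSub W x.2 * Δpow (x.1 + 1)) := by
  induction k with
  | zero =>
    have := hW 0
    simpa [divOneSub_zero, divOneSub_add_one] using this
  | succ k ih =>
    rw [Finset.sum_add_distrib] at ih
    rw [Finset.sum_add_distrib, sum_mul_Δpow_succ, sum_pderiv_divOneSub_succ hWs hW,
      divOneSub_add_one W (k + 1), smul_add, add_smul (k + 1) 1 (divOneSub W (k + 1) * Δpow 1),
      one_smul, ← smul_mul_assoc, ih, add_mul]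
    abel

end PDO

namespace IsDressing

open PDO

variable {L Z Y : PDO 𝕜}

theorem ordLE (h : IsDressing L Z Y) : Z.OrdLE 0 := h.order_le

theorem isSmooth (h : IsDressing L Z Y) : Z.IsSmooth := h.smooth

theorem ordLE_inv (h : IsDressing L Z Y) : Y.OrdLE 0 := ordLE_inverse h.ordLE h.leading h.inv_mul

theorem isSmooth_inv (h : IsDressing L Z Y) : Y.IsSmooth :=
  h.isSmooth.inverse h.ordLE h.leading h.inv_mul

theorem pow_mul (h : IsDressing L Z Y) (i : ℕ) : L ^ i * Z = Z * Δpow i := by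
  have h1 : L * Z = Z * Δpow 1 := by rw [h.dress, mul_assoc, h.inv_mul, mul_one]
  induction i with
  | zero => simp [Δpow_zero]
  | succ i ih =>
    rw [pow_succ, mul_assoc, h1, ← mul_assoc, ih, mul_assoc, Δpow_mul_Δpow]
    push_cast
    rfl

/-- Since `L^l Z = Z Δ^l`, adding this term to the dressing equation replaces minus the nonpositive
part of `L^l` by its positive part. -/
theorem pderiv_add_mul (h : IsDressing L Z Y) (l : ℕ+) :
    Z.pderiv l + Z * Δpow (l : ℕ) = (L.npow l).geOne * Z := by
  rw [h.sato, ← h.pow_mul, ← PDO.npow_eq_pow, ← sub_eq_neg_add, sub_eq_iff_eq_add, ← add_mul,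
    geOne_add_leZero]

/-- Covariant differentiation of a multiple of `Z` from the left. -/
theorem pderiv_mul_add_mul (h : IsDressing L Z Y) (l : ℕ+) {Q : PDO 𝕜} (hQ : Q.IsSmooth) :
    (Q * Z).pderiv l + Q * Z * Δpow (l : ℕ) =
      (Q.pderiv l + Q * (L.npow l).geOne) * Z := by
  rw [PDO.pderiv_mul l hQ h.isSmooth, add_mul, mul_assoc Q, mul_assoc Q, ← h.pderiv_add_mul, mul_add,
    add_assoc]

/-- Operators generated from `Z` by covariant differentiations are left multiples of `Z` by
operators without terms of order `≤ 0`. -/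
theorem isPositive_mul_inv (h : IsDressing L Z Y) {G : ℕ → PDO 𝕜} (hG : ∀ k, (G k).IsSmooth)
    (h0 : G 0 = Z) (c : ℤ)
    (h1 : ∀ k, (k + 1) • G (k + 1) = c • ∑ x ∈ antidiagonal k,
      ((G x.2).pderiv x.1.succPNat + G x.2 * Δpow (x.1 + 1))) (k : ℕ) :
    (G (k + 1) * Y).IsPositive := by
  have hGY : ∀ k, G k * Y * Z = G k := fun k => by rw [mul_assoc, h.inv_mul, mul_one]
  have hstep : ∀ k, (k + 1) • (G (k + 1) * Y) = c • ∑ x ∈ antidiagonal k,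
      ((G x.2 * Y).pderiv x.1.succPNat + G x.2 * Y * (L.npow x.1.succPNat).geOne) := by
    intro k
    rw [← smul_mul_assoc, h1, smul_mul_assoc, Finset.sum_mul]
    congr 1
    refine Finset.sum_congr rfl fun x _ => ?_
    have := h.pderiv_mul_add_mul x.1.succPNat ((hG x.2).mul h.isSmooth_inv)
    rw [hGY] at this
    have e : (((x.1.succPNat : ℕ+) : ℕ) : ℤ) = x.1 + 1 := by simp
    rw [e] at this
    rw [this, mul_assoc, h.mul_inv, mul_one]
  induction k using Nat.strong_induction_on with
  | _ k ih =>
    intro j hj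
    have hz := congrArg (fun A => PDO.coeff A j) (hstep k)
    simp only [coeff_nsmul, coeff_zsmul, coeff_finset_sum] at hz
    rw [Finset.sum_eq_zero, smul_zero, smul_eq_zero] at hz
    · exact hz.resolve_left (by omega)
    rintro ⟨a, b⟩ hx
    have hb := mem_antidiagonal.1 hx
    simp only at hb ⊢
    rcases b with _ | b
    -- The contribution of `G 0 = Z`: its quotient by `Z` is 1, so only the positive part of a power
    -- of `L` survives. This is what starts the induction, since 1 itself is not positive.
    · rw [h0, h.mul_inv, one_mul, PDO.pderiv_one, zero_add]
      exact isPositive_geOne _ j hj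
    · have hp := ih b (by omega)
      exact ((hp.pderiv _).add (hp.mul (isPositive_geOne _))) j hj

/-- The coefficients of `Z(t-[X]) (1 - ΔX)` at positive powers of `X` are positive operators times
`Z`, yet have order at most 1. The left factor is therefore a single function times `Δ`, and `-q k`
is that function. -/
theorem exists_shift_relation (h : IsDressing L Z Y) : ∃ q : ℕ → Fn 𝕜, (∀ k, Smooth (q k)) ∧
    ∀ k m, (miwaCoeff (-1) h.isSmooth (k + 1)).coeff m -
      (miwaCoeff (-1) h.isSmooth k).coeff (m - 1) = -(q k * (Δpow 1 * Z).coeff m) := by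
  have hWs := IsSmooth.miwaCoeff (-1) h.isSmooth
  have hW0 := miwaCoeff_zero (-1) h.isSmooth
  have hWo := OrdLE.miwaCoeff (-1) h.isSmooth h.ordLE
  have hW := miwaCoeff_succ (-1) h.isSmooth
  generalize miwaCoeff (-1) h.isSmooth = W at *
  have hpos := h.isPositive_mul_inv (isSmooth_mulOneSub hWs) hW0 (-1)
    (mulOneSub_succ hWs fun k => by rw [hW, neg_one_smul])
  have hGo : ∀ k, (mulOneSub W (k + 1)).OrdLE 1 := fun k =>
    ((hWo _).mono (by omega)).sub (((hWo k).mul (ordLE_Δpow 1)).mono (by omega))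
  refine ⟨fun k => -(mulOneSub W (k + 1) * Y).coeff 1,
    fun k => ((isSmooth_mulOneSub hWs _).mul h.isSmooth_inv 1).neg, fun k m => ?_⟩
  have hQ : mulOneSub W (k + 1) * Y =
      PDO.mono 0 ((mulOneSub W (k + 1) * Y).coeff 1) * Δpow 1 := by
    rw [← mono_eq]
    have ho : (mulOneSub W (k + 1) * Y).OrdLE 1 := by simpa using (hGo k).mul h.ordLE_inv
    ext1
    funext j
    rcases lt_trichotomy j 1 with hj | rfl | hj
    · rw [hpos k j hj, coeff_mono_of_ne hj.ne]
    · rw [coeff_mono_self]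
    · rw [ho j hj, coeff_mono_of_ne hj.ne']
  have hGk : mulOneSub W (k + 1) =
      PDO.mono 0 ((mulOneSub W (k + 1) * Y).coeff 1) * (Δpow 1 * Z) := by
    rw [← mul_assoc, ← hQ, mul_assoc, h.inv_mul, mul_one]
  have := congrArg (fun A => PDO.coeff A m) hGk
  simp only [coeff_mono_zero_mul] at this
  rw [← coeff_mul_Δpow, ← coeff_sub, neg_mul, neg_neg, ← this]
  rfl

/-- The sum is the `X^k`-coefficient of `Z(t+[X]) (1 - ΔX)⁻¹ Z⁻¹`: it is 1 for `k = 0` and has only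
positive powers of `Δ` otherwise. -/
theorem coeff_zero_sum_shift (h : IsDressing L Z Y) (k : ℕ) :
    (∑ x ∈ antidiagonal k, miwaCoeff 1 h.isSmooth x.2 * Δpow x.1 * Y).coeff 0 =
      if k = 0 then 1 else 0 := by
  have hWs := IsSmooth.miwaCoeff 1 h.isSmooth
  have hW0 := miwaCoeff_zero 1 h.isSmooth
  have hW := miwaCoeff_succ 1 h.isSmooth
  generalize miwaCoeff 1 h.isSmooth = W at *
  have hpos := h.isPositive_mul_inv (isSmooth_divOneSub hWs) (by rw [divOneSub_zero, hW0]) 1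
    fun k => by rw [one_smul]; exact divOneSub_succ_smul hWs (fun k => by rw [hW, one_smul]) k
  rw [← Finset.sum_mul]
  rcases k with _ | k
  · change (divOneSub W 0 * Y).coeff 0 = _
    rw [divOneSub_zero, hW0, h.mul_inv, if_pos rfl, one_def, coeff_mono_self]
  · rw [if_neg (by omega)]
    exact hpos k 0 (by omega)

end IsDressing

end

end DMKP

namespace DMKP

noncomputable section

open Finset.HasAntidiagonal (antidiagonal mem_antidiagonal)

/-! ### Shifting the coefficients of a power series by its variable -/

section MiwaDiag

open PowerSeries

variable {R : Type*} [CommRing R] [Algebra ℚ R] (d : ℕ → Derivation ℚ R R)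

/-- The series `∑_s X^s F_s(t + c [X])` for `F = ∑_s X^s F_s(t)`. -/
def miwaDiag (c : ℚ) (F : R⟦X⟧) : R⟦X⟧ := PowerSeries.mk fun k =>
  ∑ x ∈ antidiagonal k, coeff x.2 (miwa d c (coeff x.1 F))

theorem coeff_miwaDiag (c : ℚ) (F : R⟦X⟧) (k : ℕ) : coeff k (miwaDiag d c F) =
    ∑ x ∈ antidiagonal k, coeff x.2 (miwa d c (coeff x.1 F)) := by rw [miwaDiag, coeff_mk]

variable {d} (hd : ∀ i j f, d i (d j f) = d j (d i f))
include hd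

theorem coeff_succ_miwa_mul (c : ℚ) (f : R) (k : ℕ) : coeff (k + 1) (miwa d c f) * ((k : R) + 1) =
    c • ∑ x ∈ antidiagonal k, coeff x.2 (miwa d c (d x.1 f)) := by
  have h := congrArg (coeff k) (miwaDer_miwa hd c f)
  rw [coeff_miwaDer, map_zero, sub_eq_zero] at h
  rw [h]
  congr 1
  refine Finset.sum_congr rfl fun x _ => ?_
  rw [miwa_der hd, coeff_mapDer]

/-- The chain rule: `X` enters through the explicit powers and through the shift, and the latter
contributes `c ∑ X^l d_l`. Together they form `miwaDer` with the opposite sign of `c`. -/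
theorem derivative_miwaDiag (c : ℚ) (F : R⟦X⟧) :
    PowerSeries.derivative R (miwaDiag d c F) = miwaDiag d c (miwaDer d (-c) F) := by
  ext k
  have hT : ∀ p f g, coeff p (miwa d c (f + g)) = coeff p (miwa d c f) + coeff p (miwa d c g) := by
    intro p f g
    rw [← miwaHom_apply hd, map_add, map_add]; rfl
  have hTs : ∀ p (s : Finset (ℕ × ℕ)) (f : ℕ × ℕ → R), coeff p (miwa d c (∑ x ∈ s, f x)) =
      ∑ x ∈ s, coeff p (miwa d c (f x)) := by
    intro p s f
    rw [← miwaHom_apply hd, map_sum, map_sum]; rfl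
  have hTq : ∀ p (q : ℚ) f, coeff p (miwa d c (q • f)) = q • coeff p (miwa d c f) := by
    intro p q f
    rw [← miwaHom_apply hd, map_rat_smul, coeff_smul]; rfl
  have hTn : ∀ p (f : R) (m : ℕ), coeff p (miwa d c (f * (m + 1))) =
      coeff p (miwa d c f) * (m + 1) := by
    intro p f m
    have e : ∀ r : R, r * (m + 1) = ((m : ℚ) + 1) • r := by
      intro r; rw [Algebra.smul_def, mul_comm]; simp
    rw [e, hTq, ← e]
  rw [coeff_derivative, coeff_miwaDiag, coeff_miwaDiag]
  have h1 : (∑ x ∈ antidiagonal (k + 1), coeff x.2 (miwa d c (coeff x.1 F))) * ((k : R) + 1) =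
      (∑ x ∈ antidiagonal (k + 1), coeff x.2 (miwa d c (coeff x.1 F)) * (x.1 : R)) +
      ∑ x ∈ antidiagonal (k + 1), coeff x.2 (miwa d c (coeff x.1 F)) * (x.2 : R) := by
    rw [← Finset.sum_add_distrib, Finset.sum_mul]
    refine Finset.sum_congr rfl fun x hx => ?_
    have e : ((k : R) + 1) = (x.1 : R) + x.2 := by
      rw [← Nat.cast_add, mem_antidiagonal.1 hx, Nat.cast_succ]
    rw [e, mul_add]
  rw [h1, Finset.Nat.sum_antidiagonal_succ, Finset.Nat.sum_antidiagonal_succ']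
  simp only [Nat.cast_zero, mul_zero, zero_add, Nat.cast_succ]
  have h2 : ∑ x ∈ antidiagonal k,
      coeff (x.2 + 1) (miwa d c (coeff x.1 F)) * ((x.2 : R) + 1) =
      ∑ x ∈ antidiagonal k, c • ∑ y ∈ antidiagonal x.1,
        coeff x.2 (miwa d c (d y.1 (coeff y.2 F))) := by
    rw [Finset.sum_congr rfl fun x _ => coeff_succ_miwa_mul hd c (coeff x.1 F) x.2,
      ← Finset.smul_sum, ← Finset.smul_sum, ← sum_antidiagonal_assoc fun a b e =>
        coeff e (miwa d c (d b (coeff a F)))]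
    congr 1
    refine Finset.sum_congr rfl fun x _ => ?_
    exact (Finset.Nat.sum_antidiagonal_swap
      (f := fun y => coeff x.2 (miwa d c (d y.1 (coeff y.2 F)))))
  rw [h2, ← Finset.sum_add_distrib]
  refine Finset.sum_congr rfl fun x _ => ?_
  rw [coeff_miwaDer, neg_smul, sub_neg_eq_add, hT, hTn, hTq, hTs]

/-- Opposite shifts cancel. The shift by `-c [X]` lies in the kernel of the derivation in
`derivative_miwaDiag`, so the result has zero derivative, hence is constant in characteristic zero.
-/
theorem miwaDiag_miwa (c : ℚ) (f : R) : miwaDiag d c (miwa d (-c) f) = C f := by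
  have h := derivative_miwaDiag hd c (miwa d (-c) f)
  have h0 : miwaDiag d c (0 : R⟦X⟧) = 0 := by
    ext k
    rw [coeff_miwaDiag, map_zero]
    refine Finset.sum_eq_zero fun x _ => ?_
    rw [map_zero, ← miwaHom_apply hd, map_zero, map_zero]
  rw [miwaDer_miwa hd, h0] at h
  ext k
  rcases k with _ | k
  · simp [coeff_miwaDiag]
  · have hk := congrArg (coeff k) h
    rw [coeff_derivative, map_zero] at hk
    have e : ∀ r : R, r * (k + 1) = ((k : ℚ) + 1) • r := by
      intro r; rw [Algebra.smul_def, mul_comm]; simp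
    rw [e, smul_eq_zero_iff_right (by positivity)] at hk
    rw [hk, coeff_C, if_neg (by omega)]

theorem miwaDiag_C_mul (c : ℚ) (f : R) (F : R⟦X⟧) :
    miwaDiag d c (C f * F) = miwa d c f * miwaDiag d c F := by
  ext k
  rw [coeff_miwaDiag, PowerSeries.coeff_mul]
  have h1 : ∀ x ∈ antidiagonal k, coeff x.2 (miwa d c (coeff x.1 (C f * F))) =
      ∑ y ∈ antidiagonal x.2, coeff y.1 (miwa d c f) * coeff y.2 (miwa d c (coeff x.1 F)) := by
    intro x _
    rw [coeff_C_mul, ← miwaHom_apply hd, map_mul, PowerSeries.coeff_mul]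
    rfl
  have h2 : ∀ x ∈ antidiagonal k, coeff x.1 (miwa d c f) * coeff x.2 (miwaDiag d c F) =
      ∑ y ∈ antidiagonal x.2, coeff x.1 (miwa d c f) * coeff y.2 (miwa d c (coeff y.1 F)) := by
    intro x _
    rw [coeff_miwaDiag, Finset.mul_sum]
  rw [Finset.sum_congr rfl h1, Finset.sum_congr rfl h2,
    ← sum_antidiagonal_assoc fun a b e => coeff b (miwa d c f) * coeff e (miwa d c (coeff a F)),
    ← sum_antidiagonal_assoc fun a b e => coeff a (miwa d c f) * coeff e (miwa d c (coeff b F))]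
  refine Finset.sum_congr rfl fun x _ => ?_
  exact (Finset.Nat.sum_antidiagonal_swap
    (f := fun y => coeff y.2 (miwa d c f) * coeff x.2 (miwa d c (coeff y.1 F)))).symm

end MiwaDiag

/-! ### Tau functions -/

namespace IsDressing

open PDO PowerSeries

variable {𝕜 : Type*} [RCLike 𝕜] {L Z Y : PDO 𝕜}

/-- The amplitude of the wave function, in terms of `X = λ⁻¹`. -/
def waveSeries (h : IsDressing L Z Y) : (smoothFn 𝕜)⟦X⟧ :=
  PowerSeries.mk fun j => h.isSmooth.toSmooth (-(j : ℤ))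

/-- The amplitude of the adjoint wave function divided by `λ⁻¹`, in terms of `X = λ⁻¹`. -/
def adjWaveSeries (h : IsDressing L Z Y) : (smoothFn 𝕜)⟦X⟧ :=
  PowerSeries.mk fun r => ((IsSmooth.Δpow (r : ℤ)).mul h.isSmooth_inv).toSmooth 0

theorem coeff_zero_waveSeries (h : IsDressing L Z Y) :
    ((coeff 0 h.waveSeries : smoothFn 𝕜) : Fn 𝕜) = Z.coeff 0 := by
  rw [waveSeries, coeff_mk]; rfl

theorem exists_inv_coeff_zero (h : IsDressing L Z Y) :
    ∃ u : smoothFn 𝕜, coeff 0 h.waveSeries * u = 1 :=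
  ⟨⟨(Z.coeff 0)⁻¹, mem_smoothFn.2 ((h.isSmooth 0).inv h.leading)⟩, Subtype.ext (by
    change ((coeff 0 h.waveSeries : smoothFn 𝕜) : Fn 𝕜) * _ = 1
    rw [coeff_zero_waveSeries]
    exact NowhereZero.mul_inv_cancel h.leading)⟩

theorem exists_inv_waveSeries (h : IsDressing L Z Y) :
    ∃ z' : (smoothFn 𝕜)⟦X⟧, h.waveSeries * z' = 1 := by
  obtain ⟨u, hu⟩ := h.exists_inv_coeff_zero
  have : IsUnit h.waveSeries := by
    rw [PowerSeries.isUnit_iff_constantCoeff, ← coeff_zero_eq_constantCoeff_apply]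
    exact IsUnit.of_mul_eq_one u hu
  exact this.exists_right_inv

/-- A function `τ₁` for which the shift of `τ₁ z₀` is `τ₁` times the wave function. -/
theorem exists_tau (h : IsDressing L Z Y) : ∃ τ : smoothFn 𝕜, NowhereZero (τ : Fn 𝕜) ∧
    C τ * h.waveSeries = miwa (partialDer 𝕜) (-1) (τ * coeff 0 h.waveSeries) := by
  obtain ⟨q, hq, hrel⟩ := h.exists_shift_relation
  obtain ⟨z', hz'⟩ := h.exists_inv_waveSeries
  set z := h.waveSeries with hz
  have hzc : ∀ k j, ((coeff k (miwa (partialDer 𝕜) (-1) (coeff j z)) : smoothFn 𝕜) : Fn 𝕜) =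
      (miwaCoeff (-1) h.isSmooth k).coeff (-(j : ℤ)) := by
    intro k j
    rw [coeff_miwaCoeff, hz, waveSeries, coeff_mk]
    norm_num
  set hh : (smoothFn 𝕜)⟦X⟧ := PowerSeries.mk fun k => ⟨q k, mem_smoothFn.2 (hq k)⟩ with hhh
  set U : (smoothFn 𝕜)⟦X⟧ :=
    PowerSeries.mk fun j => ((IsSmooth.Δpow 1).mul h.isSmooth).toSmooth (1 - (j : ℤ)) with hU
  have hhU : ∀ k j, ((coeff k hh * coeff j U : smoothFn 𝕜) : Fn 𝕜) =
      q k * (Δpow 1 * Z).coeff (1 - (j : ℤ)) := by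
    intro k j
    rw [hhh, hU, coeff_mk, coeff_mk]
    rfl
  have h0 : ∀ k, coeff k (miwa (partialDer 𝕜) (-1) (coeff 0 z)) = coeff k hh * coeff 0 U := by
    intro k
    refine Subtype.ext ?_
    have h1 := hrel k 1
    rw [OrdLE.miwaCoeff (-1) h.isSmooth h.ordLE (k + 1) 1 (by omega), zero_sub, neg_inj] at h1
    rw [hzc, hhU]
    simpa using h1
  have h1 : ∀ k j, coeff (k + 1) (miwa (partialDer 𝕜) (-1) (coeff j z)) -
      coeff k (miwa (partialDer 𝕜) (-1) (coeff (j + 1) z)) = -(coeff k hh * coeff (j + 1) U) := by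
    intro k j
    refine Subtype.ext ?_
    have h2 := hrel k (-(j : ℤ))
    have h3 : (((coeff (k + 1) (miwa (partialDer 𝕜) (-1) (coeff j z)) -
      coeff k (miwa (partialDer 𝕜) (-1) (coeff (j + 1) z)) : smoothFn 𝕜)) : Fn 𝕜) =
      (coeff (k + 1) (miwa (partialDer 𝕜) (-1) (coeff j z)) : smoothFn 𝕜) -
      (coeff k (miwa (partialDer 𝕜) (-1) (coeff (j + 1) z)) : smoothFn 𝕜) := rfl
    have h4 : ((-(coeff k hh * coeff (j + 1) U) : smoothFn 𝕜) : Fn 𝕜) =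
      -((coeff k hh * coeff (j + 1) U : smoothFn 𝕜) : Fn 𝕜) := rfl
    have e1 : 1 - ((j + 1 : ℕ) : ℤ) = -(j : ℤ) := by push_cast; ring
    have e2 : -((j + 1 : ℕ) : ℤ) = -(j : ℤ) - 1 := by push_cast; ring
    rw [h3, h4, hzc, hzc, hhU, e1, e2, h2]
  set Ψ := miwaDer (partialDer 𝕜) (-1) z * z' with hΨdef
  have hΨ : miwaDer (partialDer 𝕜) (-1) z = Ψ * z := by
    rw [hΨdef, mul_assoc, mul_comm z', hz', mul_one]
  have hclosed := closed_of_shift_relation partialDer_comm (by norm_num) hz' h0 h1 hΨ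
  -- The sign is chosen so that `τ = e^θ` has logarithmic derivatives `-Ψ_l`; these cancel `Ψ` in
  -- `miwaDer` of `τ z` for `c = -1`.
  obtain ⟨θ, hθ, hθd⟩ := exists_potential
    (η := fun i => ((-coeff i.natPred Ψ : smoothFn 𝕜) : Fn 𝕜)) (fun i => smooth_coe _)
    (fun i j => by
      have := hclosed j.natPred i.natPred
      have h2 := congrArg (fun f : smoothFn 𝕜 => ((-f : smoothFn 𝕜) : Fn 𝕜)) this
      simp only [← map_neg] at h2
      rw [coe_partialDer, coe_partialDer, PNat.succPNat_natPred, PNat.succPNat_natPred] at h2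
      exact h2)
  set τ : smoothFn 𝕜 := ⟨fun n t => NormedSpace.exp (θ n t), mem_smoothFn.2 hθ.exp⟩ with hτ
  have hτd : ∀ l, partialDer 𝕜 l τ = -(τ * coeff l Ψ) := by
    intro l
    refine Subtype.ext ?_
    rw [coe_partialDer]
    have h2 := pderiv_exp l.succPNat hθ
    rw [hθd] at h2
    simp only [Nat.natPred_succPNat] at h2
    change pderiv _ (fun n t => NormedSpace.exp (θ n t)) =
      -((τ : Fn 𝕜) * ((coeff l Ψ : smoothFn 𝕜) : Fn 𝕜))
    rw [h2, ← mul_neg, mul_comm]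
    rfl
  refine ⟨τ, NowhereZero.exp θ, eq_miwa partialDer_comm ?_ ?_⟩
  · have h2 : (PowerSeries.mk fun k => partialDer 𝕜 k τ) = -(C τ * Ψ) := by
      ext1 k
      rw [coeff_mk, hτd, map_neg, coeff_C_mul]
    rw [Derivation.leibniz, hΨ, miwaDer_C, h2, smul_eq_mul, smul_eq_mul, neg_one_smul]
    ring
  · rw [coeff_C_mul]

/-- A regrouping of `coeff_zero_sum_shift`. Expanding the `Δ⁰`-coefficient along the left factor
pairs each shifted coefficient of `Z` with the `Δ⁰`-coefficient of `Δ^r Z⁻¹`, which is a coefficient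
of the adjoint wave function. -/
theorem miwaDiag_waveSeries_mul (h : IsDressing L Z Y) :
    miwaDiag (partialDer 𝕜) 1 h.waveSeries * h.adjWaveSeries = 1 := by
  ext1 k
  refine Subtype.ext ?_
  have hk := h.coeff_zero_sum_shift k
  have hr : ((coeff k (1 : (smoothFn 𝕜)⟦X⟧) : smoothFn 𝕜) : Fn 𝕜) = if k = 0 then 1 else 0 := by
    rw [coeff_one]
    split_ifs <;> rfl
  rw [hr, ← hk, coeff_finset_sum, PowerSeries.coeff_mul]
  have h1 : ∀ x ∈ antidiagonal k, coeff x.1 (miwaDiag (partialDer 𝕜) 1 h.waveSeries) *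
      coeff x.2 h.adjWaveSeries = ∑ y ∈ antidiagonal x.1,
        coeff y.1 (miwa (partialDer 𝕜) 1 (coeff y.2 h.waveSeries)) * coeff x.2 h.adjWaveSeries := by
    intro x _
    rw [coeff_miwaDiag, Finset.sum_mul]
    exact (Finset.Nat.sum_antidiagonal_swap (f := fun y =>
      coeff y.2 (miwa (partialDer 𝕜) 1 (coeff y.1 h.waveSeries)) *
        coeff x.2 h.adjWaveSeries)).symm
  rw [Finset.sum_congr rfl h1, sum_antidiagonal_assoc fun a b e =>
    coeff a (miwa (partialDer 𝕜) 1 (coeff b h.waveSeries)) * coeff e h.adjWaveSeries]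
  change (smoothFn 𝕜).val _ = _
  rw [map_sum]
  rw [← Finset.Nat.sum_antidiagonal_swap]
  refine Finset.sum_congr rfl fun x _ => ?_
  have hA : (miwaCoeff 1 h.isSmooth x.2 * Δpow x.1).OrdLE ((x.1 + 1 : ℕ) - 1) := by
    have := (OrdLE.miwaCoeff 1 h.isSmooth h.ordLE x.2).mul (ordLE_Δpow (𝕜 := 𝕜) x.1)
    simpa using this
  rw [coeff_zero_mul hA h.ordLE_inv, map_sum, ← Finset.Nat.sum_antidiagonal_swap,
    Finset.Nat.sum_antidiagonal_eq_sum_range_succ_mk]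
  refine Finset.sum_congr rfl fun r hr => ?_
  have hr' : r ≤ x.1 := Nat.lt_succ_iff.1 (Finset.mem_range.1 hr)
  rw [coeff_mul_Δpow, coeff_miwaCoeff]
  simp only [Prod.fst_swap, Prod.snd_swap]
  rw [waveSeries, adjWaveSeries, coeff_mk, coeff_mk]
  have e : (r : ℤ) - x.1 = -((x.1 - r : ℕ) : ℤ) := by omega
  rw [e, map_mul]
  norm_num
  rfl

/-- The adjoint wave function in terms of the function `τ₁` of `exists_tau`. -/
theorem miwa_tau (h : IsDressing L Z Y) {τ : smoothFn 𝕜}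
    (hτ : C τ * h.waveSeries = miwa (partialDer 𝕜) (-1) (τ * coeff 0 h.waveSeries)) :
    C (τ * coeff 0 h.waveSeries) * h.adjWaveSeries = miwa (partialDer 𝕜) 1 τ := by
  rw [← miwaDiag_miwa partialDer_comm 1, ← hτ, miwaDiag_C_mul partialDer_comm, mul_assoc,
    h.miwaDiag_waveSeries_mul, mul_one]

end IsDressing

end

end DMKP

namespace DMKP

noncomputable section

variable {𝕜 : Type*} [RCLike 𝕜]

open Finset.HasAntidiagonal (antidiagonal mem_antidiagonal)

/-! ### Comparison of the formal Taylor series -/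

section MiwaShift

open PowerSeries

variable (𝕜) in
/-- The inclusion of smooth functions into all functions. -/
def smoothVal : smoothFn 𝕜 →+* Fn 𝕜 := (smoothFn 𝕜).val

theorem smoothVal_apply (f : smoothFn 𝕜) : smoothVal 𝕜 f = f := rfl

/-- Carries the algebraic theory over to `miwaGen`, which acts on arbitrary functions, where partial
differentiation is not a derivation. -/
theorem map_miwaOp (F : (smoothFn 𝕜)⟦X⟧) :
    PowerSeries.map (smoothVal 𝕜) (miwaOp (partialDer 𝕜) F) =
      miwaGen (PowerSeries.map (smoothVal 𝕜) F) := by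
  ext1 k
  rw [coeff_map, miwaGen, coeff_mk]
  rcases k with _ | k
  · rw [coeff_miwaOp_zero, map_zero]
    exact (Finset.sum_of_isEmpty _).symm
  · rw [coeff_miwaOp_succ, Finset.Nat.sum_antidiagonal_eq_sum_range_succ_mk, Finset.sum_range,
      map_sum]
    refine Finset.sum_congr rfl fun j _ => ?_
    funext n t
    rw [map_rat_smul, smoothVal_apply, coe_partialDer, coeff_map, smoothVal_apply,
      Nat.add_sub_add_right]
    change ((((j : ℕ) : ℚ) + 1)⁻¹) •
      (pderiv (j : ℕ).succPNat ((coeff (k - j) F : smoothFn 𝕜) : Fn 𝕜) n t) = _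
    rw [Rat.smul_def]
    push_cast
    rfl

theorem map_iterate_miwaOp (f : smoothFn 𝕜) (m : ℕ) :
    PowerSeries.map (smoothVal 𝕜) ((miwaOp (partialDer 𝕜))^[m] (C f)) =
      miwaGen^[m] (C (f : Fn 𝕜)) := by
  induction m with
  | zero => exact map_C _ _
  | succ m ih => rw [Function.iterate_succ_apply', Function.iterate_succ_apply', map_miwaOp, ih]

theorem miwaShift_eq (c : ℤ) (f : smoothFn 𝕜) : miwaShift c (f : Fn 𝕜) =
    HahnSeries.ofPowerSeries ℤ (Fn 𝕜)
      (PowerSeries.map (smoothVal 𝕜) (miwa (partialDer 𝕜) c f)) := by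
  rw [miwaShift]
  congr 1
  ext1 k
  rw [coeff_mk, coeff_map, miwa, coeff_mk, map_sum]
  refine Finset.sum_congr rfl fun m _ => ?_
  funext n t
  rw [map_rat_smul, ← coeff_map, map_iterate_miwaOp]
  change _ = (((m.factorial : ℚ)⁻¹ * (c : ℚ) ^ m)) • (coeff k (miwaGen^[m] (C (f : Fn 𝕜))) n t)
  rw [Rat.smul_def]
  push_cast
  rfl

end MiwaShift

theorem lamSeries_eq_ofPowerSeries {c : ℤ → Fn 𝕜} (h : ∃ N : ℤ, ∀ k, N < k → c k = 0)
    {F : PowerSeries (Fn 𝕜)} (h0 : ∀ k, 0 < k → c k = 0)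
    (hF : ∀ k : ℕ, c (-(k : ℤ)) = PowerSeries.coeff k F) :
    lamSeries c h = HahnSeries.ofPowerSeries ℤ (Fn 𝕜) F := by
  ext1
  funext k
  rw [PowerSeries.coeff_coe]
  change c (-k) = _
  split_ifs with hk
  · exact h0 _ (by omega)
  · obtain ⟨m, rfl⟩ := Int.eq_ofNat_of_zero_le (not_lt.1 hk)
    rw [hF, Int.natAbs_natCast]

/-! ### The adjoint wave function -/

theorem adjDiff_eq (f : Fn 𝕜) : adjDiff f = -shift (-1) (diff f) := by
  rw [adjDiff, diff, shift_sub, shift_shift, neg_add_cancel, shift_zero, neg_sub]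

theorem adjDiff_iterate (i : ℕ) (f : Fn 𝕜) :
    adjDiff^[i] f = (-1 : ℤ) ^ i • shift (-(i : ℤ)) (diff^[i] f) := by
  induction i with
  | zero => simp
  | succ i ih =>
    rw [Function.iterate_succ_apply', ih, adjDiff_eq, Function.iterate_succ_apply']
    have h1 : diff ((-1 : ℤ) ^ i • shift (-(i : ℤ)) (diff^[i] f)) =
        (-1 : ℤ) ^ i • shift (-(i : ℤ)) (diff (diff^[i] f)) := by
      simp only [diff, shift_sub, shift_zsmul, shift_shift, smul_sub, add_comm]
    rw [h1, shift_zsmul, shift_shift, pow_succ, mul_neg_one, neg_smul]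
    congr 3
    push_cast
    ring

namespace PDO

/-- Upper negation. It absorbs the signs from `Δ* = -Γ⁻¹Δ` and turns the binomials of the negative
power `(Δ*)^{-k-1}` into those of `Δ^k`. -/
theorem choose_reflect (k i : ℕ) :
    Ring.choose (-((k : ℤ) + 1) + i) i * (-1 : ℤ) ^ i = Ring.choose (k : ℤ) i := by
  have e : -((k : ℤ) + 1) + i = -((k : ℤ) + 1 - i) := by ring
  have e' : (k : ℤ) + 1 - i + i - 1 = k := by ring
  rw [e, Ring.choose_neg, e', Int.negOnePow_def, Units.smul_def, smul_eq_mul]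
  rw [zpow_natCast, Units.val_pow_eq_pow_val, mul_comm, ← mul_assoc, ← mul_pow]
  norm_num

theorem coeff_adjoint_nonneg {Y : PDO 𝕜} (hY : Y.OrdLE 0) {m : ℤ} (hm : 0 ≤ m) :
    (Y.shiftCoeff (-1) * Δpow (-1)).adjoint.coeff m = 0 := by
  change ∑ᶠ i : ℕ, _ = _
  rw [← finsum_zero (α := ℕ)]
  refine finsum_congr fun i => ?_
  rw [coeff_mul_Δpow]
  change _ • shift _ (adjDiff^[i] (shift (-1) (Y.coeff _))) = _
  rw [hY _ (by omega), shift_apply_zero, adjDiff_iterate_zero, shift_apply_zero, smul_zero]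

/-- The extra `Δ⁻¹` and the shift `n - 1` in the definition of `w*` are exactly what makes the two
Leibniz expansions agree term by term, shifts included. -/
theorem coeff_adjoint_neg {Y : PDO 𝕜} (hY : Y.OrdLE 0) (k : ℕ) :
    (Y.shiftCoeff (-1) * Δpow (-1)).adjoint.coeff (-((k : ℤ) + 1)) = (Δpow k * Y).coeff 0 := by
  refine Eq.trans ?_ (mono_mul_coeff k 1 hY 0 (k + 1) (by push_cast; omega)).symm
  change ∑ᶠ i : ℕ, _ = _
  have key : ∀ i : ℕ, Ring.choose (-((k : ℤ) + 1) + i) i • shift (-(-((k : ℤ) + 1)))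
      (adjDiff^[i] ((Y.shiftCoeff (-1) * Δpow (-1)).coeff (-((k : ℤ) + 1) + i))) =
      Ring.choose (k : ℤ) i • (1 * shift ((k : ℤ) - i) (diff^[i] (Y.coeff (0 - k + i)))) := by
    intro i
    rw [coeff_mul_Δpow]
    change _ • shift _ (adjDiff^[i] (shift (-1) (Y.coeff _))) = _
    rw [adjDiff_iterate, ← shift_iterate_diff, shift_zsmul, shift_shift, shift_shift, smul_smul,
      choose_reflect, one_mul]
    have e1 : -(-((k : ℤ) + 1)) + -(i : ℤ) + -1 = k - i := by ring
    have e2 : -((k : ℤ) + 1) + i - -1 = 0 - k + i := by ring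
    rw [e1, e2]
  rw [finsum_congr key]
  refine finsum_eq_sum_of_support_subset _ fun i hi => ?_
  rw [Function.mem_support] at hi
  rw [Finset.coe_range, Set.mem_Iio]
  by_contra hlt
  refine hi ?_
  rw [hY _ (by omega), diff_iterate_zero, shift_apply_zero, mul_zero, smul_zero]

end PDO

namespace IsDressing

open PowerSeries

variable {L Z Y : PDO 𝕜}

theorem lamSeries_eq (h : IsDressing L Z Y) : lamSeries Z.coeff Z.bdd =
    HahnSeries.ofPowerSeries ℤ (Fn 𝕜) (PowerSeries.map (smoothVal 𝕜) h.waveSeries) :=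
  lamSeries_eq_ofPowerSeries _ h.ordLE fun k => by
    rw [coeff_map, waveSeries, coeff_mk]; rfl

theorem lamSeries_adjoint_eq (h : IsDressing L Z Y) :
    lamSeries (Y.shiftCoeff (-1) * PDO.Δpow (-1)).adjoint.coeff
      (Y.shiftCoeff (-1) * PDO.Δpow (-1)).adjoint.bdd =
    HahnSeries.ofPowerSeries ℤ (Fn 𝕜) (PowerSeries.map (smoothVal 𝕜) h.adjWaveSeries) *
      lamPow (-1) := by
  have hX : lamPow (-1) = HahnSeries.ofPowerSeries ℤ (Fn 𝕜) X := by
    rw [HahnSeries.ofPowerSeries_X]; rfl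
  rw [hX, ← map_mul]
  refine lamSeries_eq_ofPowerSeries _
    (fun k hk => PDO.coeff_adjoint_nonneg h.ordLE_inv hk.le) fun k => ?_
  rcases k with _ | k
  · rw [coeff_zero_mul_X]
    exact PDO.coeff_adjoint_nonneg h.ordLE_inv (by simp)
  · rw [coeff_succ_mul_X, coeff_map, adjWaveSeries, coeff_mk]
    push_cast
    exact PDO.coeff_adjoint_neg h.ordLE_inv k

theorem exists_tau_functions (h : IsDressing L Z Y) :
    ∃ τ₀ τ₁ : Fn 𝕜, Smooth τ₀ ∧ Smooth τ₁ ∧ NowhereZero τ₀ ∧ NowhereZero τ₁ ∧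
      waveFunction Z = (HahnSeries.C τ₁⁻¹ * miwaShift (-1) τ₀) • planeWave ∧
      adjWaveFunction Y =
        (HahnSeries.C τ₀⁻¹ * miwaShift 1 τ₁ * lamPow (-1)) • adjPlaneWave := by
  obtain ⟨τ, hτ0, hτ⟩ := h.exists_tau
  have hadj := h.miwa_tau hτ
  set σ := τ * coeff 0 h.waveSeries with hσ
  have hσ' : (σ : Fn 𝕜) = (τ : Fn 𝕜) * Z.coeff 0 := by
    rw [← h.coeff_zero_waveSeries]; rfl
  have hσ0 : NowhereZero (σ : Fn 𝕜) := fun n t => by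
    rw [hσ']; exact mul_ne_zero (hτ0 n t) (h.leading n t)
  have hinv : ∀ {f : smoothFn 𝕜}, NowhereZero (f : Fn 𝕜) → ∀ F : (smoothFn 𝕜)⟦X⟧,
      HahnSeries.C (f : Fn 𝕜)⁻¹ * HahnSeries.ofPowerSeries ℤ (Fn 𝕜)
        (PowerSeries.map (smoothVal 𝕜) (C f * F)) =
      HahnSeries.ofPowerSeries ℤ (Fn 𝕜) (PowerSeries.map (smoothVal 𝕜) F) := by
    intro f hf F
    rw [← HahnSeries.ofPowerSeries_C, ← map_mul, (PowerSeries.map (smoothVal 𝕜)).map_mul, map_C,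
      ← mul_assoc, ← map_mul, smoothVal_apply, mul_comm _ (f : Fn 𝕜),
      NowhereZero.mul_inv_cancel hf, map_one, one_mul]
  refine ⟨σ, τ, smooth_coe σ, smooth_coe τ, hσ0, hτ0, ?_, ?_⟩
  · have e : HahnSeries.C (τ : Fn 𝕜)⁻¹ * miwaShift (-1) (σ : Fn 𝕜) = lamSeries Z.coeff Z.bdd := by
      rw [miwaShift_eq, h.lamSeries_eq]
      push_cast
      rw [← hτ, hinv hτ0]
    rw [e]
    rfl
  · have e : HahnSeries.C (σ : Fn 𝕜)⁻¹ * miwaShift 1 (τ : Fn 𝕜) * lamPow (-1) =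
        lamSeries (Y.shiftCoeff (-1) * PDO.Δpow (-1)).adjoint.coeff
          (Y.shiftCoeff (-1) * PDO.Δpow (-1)).adjoint.bdd := by
      rw [miwaShift_eq, h.lamSeries_adjoint_eq]
      push_cast
      rw [← hadj, hinv hσ0]
    rw [e]
    rfl

end IsDressing

end

end DMKP

theorem theorem2p1 {𝕜 : Type*} [RCLike 𝕜] (L : DMKP.PDO 𝕜) (hL : DMKP.IsSolution L) :
    (∃ Z Y : DMKP.PDO 𝕜, DMKP.IsDressing L Z Y) ∧
    ∀ Z Y : DMKP.PDO 𝕜, DMKP.IsDressing L Z Y →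
      ∃ τ₀ τ₁ : DMKP.Fn 𝕜,
        DMKP.Smooth τ₀ ∧ DMKP.Smooth τ₁ ∧ DMKP.NowhereZero τ₀ ∧ DMKP.NowhereZero τ₁ ∧
        DMKP.waveFunction Z =
          (HahnSeries.C τ₁⁻¹ * DMKP.miwaShift (-1) τ₀) • DMKP.planeWave ∧
        DMKP.adjWaveFunction Y =
          (HahnSeries.C τ₀⁻¹ * DMKP.miwaShift 1 τ₁ * DMKP.lamPow (-1)) • DMKP.adjPlaneWave :=
  ⟨DMKP.exists_dressing hL, fun _ _ h => h.exists_tau_functions⟩
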